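/- For $\theta=(\tau,\mu,\xi)$ in $\Theta=\{\theta\in\mathbb{R}^3:\tau>0,\ \xi>-1/2\}$ let $w(y;\theta)=1+\xi(y-\mu)/\tau$, let $t(y;\theta)=w(y;\theta)^{-1/\xi}$ if $\xi\neq0$ and $t(y;\theta)=e^{-(y-\mu)/\tau}$ if $\xi=0$, and let $P_\theta$ be the generalized extreme value (GEV) distribution, with density $p(y\mid\theta)=\tau^{-1}t(y;\theta)^{\xi+1}e^{-t(y;\theta)}$ where $w(y;\theta)>0$ and $p(y\mid\theta)=0$ elsewhere. Let $\theta_0\in\Theta$, and let $Y_1,Y_2,\dots$ be independent random variables with distribution $P_{\theta_0}$. Put $$L_n(\theta)=\sum_{i=1}^n\log p(Y_i\mid\theta),\qquad \Omega_n=\{\theta\in\Theta: p(Y_i\mid\theta)>0\text{ for } i=1,\dots,n\},$$ and write $L_n''$ for the $3\times3$ Hessian matrix of $L_n$ in $\theta$. Let $\hat\theta_n$ be a strongly consistent local maximum likelihood estimator: almost surely, for all sufficiently large $n$, $\hat\theta_n\in\Omega_n$ is a local maximum point of $L_n$ on $\Omega_n$; and $\hat\theta_n\to\theta_0$ almost surely.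 Let $$I(\theta_0)=\left(\int \frac{\partial\log p(y\mid\theta_0)}{\partial\theta_i}\,\frac{\partial\log p(y\mid\theta_0)}{\partial\theta_j}\,dP_{\theta_0}(y)\right)_{i,j=1}^{3}$$ be the Fisher information matrix. Then $I(\theta_0)$ is well defined (the scores $\partial\log p(\cdot\mid\theta_0)/\partial\theta_i$ are square integrable under $P_{\theta_0}$), and, almost surely as $n\to\infty$, $$n^{-1}L_n''(\hat\theta_n)\to -I(\theta_0).$$ Moreover condition (C1) holds for the GEV likelihood: almost surely, $-L_n''(\hat\theta_n)$ is positive definite (in particular invertible) for all sufficiently large $n$, and the largest eigenvalue of $\{-L_n''(\hat\theta_n)\}^{-1}$ tends to $0$ as $n\to\infty$. -/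

import Mathlib

open MeasureTheory ProbabilityTheory Filter Topology

noncomputable section

/-- The parameter space `Θ` of the GEV family. A parameter is `θ = (τ, μ, ξ)`: scale `θ 0`,
location `θ 1` and shape `θ 2`, with `τ > 0` and `ξ > -1/2`. -/
def gevParamSpace : Set (Fin 3 → ℝ) := {θ | 0 < θ 0 ∧ -(1 / 2 : ℝ) < θ 2}

/-- `w(y; θ) = 1 + ξ (y - μ) / τ`; the support of the distribution is `{y | 0 < w(y; θ)}`. -/
def gevW (θ : Fin 3 → ℝ) (y : ℝ) : ℝ := 1 + θ 2 * ((y - θ 1) / θ 0)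

/-- `w(y; θ) ^ (-1/ξ)` for `ξ ≠ 0`, and its limit `exp (-(y - μ) / τ)` for `ξ = 0`. On the support,
the distribution function is `exp (-gevT θ y)`. -/
def gevT (θ : Fin 3 → ℝ) (y : ℝ) : ℝ :=
  if θ 2 = 0 then Real.exp (-((y - θ 1) / θ 0)) else gevW θ y ^ (-1 / θ 2)

/-- The GEV density `p(y | θ)`: the `y`-derivative of `exp (-gevT θ y)` on the support, and `0`
off the support. -/
def gevPDF (θ : Fin 3 → ℝ) (y : ℝ) : ℝ :=
  if 0 < gevW θ y then (θ 0)⁻¹ * gevT θ y ^ (θ 2 + 1) * Real.exp (-gevT θ y) else 0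

/-- The GEV distribution `P_θ` on the line. -/
def gevMeasure (θ : Fin 3 → ℝ) : Measure ℝ :=
  volume.withDensity fun y => ENNReal.ofReal (gevPDF θ y)

/-- The log-likelihood `L_n(θ)` of the first `n` observations. -/
def gevLogLik (y : ℕ → ℝ) (n : ℕ) (θ : Fin 3 → ℝ) : ℝ :=
  ∑ i ∈ Finset.range n, Real.log (gevPDF θ (y i))

/-- `Ω_n`: the parameters in `Θ` under which each of the first `n` observations has positive
density. This is the domain of the log-likelihood. -/
def gevDomain (y : ℕ → ℝ) (n : ℕ) : Set (Fin 3 → ℝ) :=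
  {θ | θ ∈ gevParamSpace ∧ ∀ i ∈ Finset.range n, 0 < gevPDF θ (y i)}

/-- `θ` is a local maximum point of the log-likelihood on its domain `Ω_n`. -/
def IsLocalMLE (y : ℕ → ℝ) (n : ℕ) (θ : Fin 3 → ℝ) : Prop :=
  θ ∈ gevDomain y n ∧ IsLocalMaxOn (gevLogLik y n) (gevDomain y n) θ

/-- The score `∂ log p(y | θ) / ∂θ_i`. -/
def gevScore (θ : Fin 3 → ℝ) (y : ℝ) (i : Fin 3) : ℝ :=
  fderiv ℝ (fun η : Fin 3 → ℝ => Real.log (gevPDF η y)) θ (Pi.single i 1)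

/-- The Fisher information matrix `I(θ)` of one observation: second moments of the score. -/
def gevFisher (θ : Fin 3 → ℝ) : Matrix (Fin 3) (Fin 3) ℝ :=
  Matrix.of fun i j => ∫ y, gevScore θ y i * gevScore θ y j ∂(gevMeasure θ)

/-- The Hessian matrix `f''(θ)` of second partial derivatives. -/
def hessianMatrix (f : (Fin 3 → ℝ) → ℝ) (θ : Fin 3 → ℝ) : Matrix (Fin 3) (Fin 3) ℝ :=
  Matrix.of fun i j =>
    fderiv ℝ (fun η : Fin 3 → ℝ => fderiv ℝ f η (Pi.single j 1)) θ (Pi.single i 1)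

/-- The largest (real) eigenvalue of a square matrix. -/
def largestEigenvalue (A : Matrix (Fin 3) (Fin 3) ℝ) : ℝ :=
  sSup {l : ℝ | Module.End.HasEigenvalue (Matrix.toLin' A) l}

end

/-!
The likelihood is studied in coordinates in which it is tame. Fix the true parameter `θ₀`, put
`x = (y - μ₀) / τ₀` and `v(u) = σ + ξ u`. Then `-log t(y; θ) = η + h(x)`, where
`h(x) = ∫₀ˣ du / v(u)`, for all `ξ` (also for `ξ = 0`), and the log-density is, up to a constant,
`psi x p = -η - h(x) - log v(x) - exp (-η - h(x))` with `p = (σ, η, ξ)`. Two things are gained. The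
set of `p` under which a given `x` has positive density is defined by the affine inequalities
`σ > 0` and `v(x) > 0`, so it is convex. And all derivatives of `psi` are expressed through the
integrals `∫₀ˣ w / vⁿ`. The true parameter becomes `(1, 0, ξ₀)`, and the Gumbel variable `s = h(x)`
at the true parameter turns all expectations into integrals against `exp (-s - exp (-s))`.

The difficulty is that the support depends on the parameter. For `p` near the true parameter the
second derivative of `psi` at `x` has no integrable two-sided bound, because `v(x)` can be
arbitrarily close to `0`, so a uniform law of large numbers for the Hessian is not available. What
is available is a one-sided bound. The only term of the wrong sign, the square `(f(x) / v(x))²`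
with `f = affV d`, comes from `-log v(x)`; by integrating the derivative of `(f/v)²` it is compared
with `-ξ` times the second derivative of `h` (`sq_div_affV_le`), and for `ξ > -1/2` the term
`-(1 - t) ∂²h` of the Hessian absorbs it (`exists_psi2_le`).

An upper bound on the Hessian is all that strict concavity requires. Hence near the true parameter
the averaged log-likelihood is eventually uniformly strictly concave on its convex domain
(`eventually_sum_psi2_le`), the limiting quadratic form being minus the Fisher information by the
Bartlett identities (`integral_psi2`) and definite by `integral_psi1_sq_pos`. The score at the true
parameter is a sum of independent centred square integrable variables, so it is `O(n ^ β)` for every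
`β > 1/2` (`ae_exists_abs_sum_le`), and strict concavity turns this into the rate
`O(n ^ (β - 1))` for the distance between a consistent root of the likelihood equations and the true
parameter (`eventually_norm_sub_le`).

The rate makes the domination two-sided. With `W = 1 + (1 + |x|) / v₀(x)`, where `v₀` is the `v` of
the true parameter, `psi2` is bounded at `p` by an integrable envelope as soon as the distance from
`p` to the true parameter is at most `1 / (2 W)` (`abs_psi2_le`). Since `ξ > -1/2`, some power
`q > 2` of `W` is integrable, so the largest of the first `n` weights is `O(n ^ (1/q))`, which for
`β` close to `1/2` is `o(n ^ (1 - β))`. The averaged Hessian at the estimator therefore has the same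
limit as at the true parameter (`ae_tendsto_avg_psi2_of_root`).

It remains to return to `θ`. At a local maximum the gradient vanishes, so the Hessian transforms by
the Jacobian of the coordinate change as a quadratic form (`hessianMatrix_gevLogLik`), like the
Fisher information (`gevFisher_eq`).
-/

noncomputable section

/-! ### Integrals of powers of an affine function -/

/-- The affine function `v(u) = σ + ξ u` attached to `p = (σ, η, ξ)`. -/
def affV (p : Fin 3 → ℝ) (u : ℝ) : ℝ := p 0 + p 2 * u

/-- The parameters `p = (σ, η, ξ)` under which the point `x` has positive density. -/
def affDom (x : ℝ) : Set (Fin 3 → ℝ) := {p | 0 < p 0 ∧ 0 < affV p x}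

/-- The integral `∫₀ˣ w(u) / v(u)ⁿ du`. -/
def affInt (n : ℕ) (w : ℝ → ℝ) (x : ℝ) (p : Fin 3 → ℝ) : ℝ :=
  ∫ u in (0 : ℝ)..x, w u / affV p u ^ n

/-- An affine function on `[0, x]` is bounded below by its endpoint values. -/
lemma affV_ge {p : Fin 3 → ℝ} {x u m : ℝ} (h0 : m ≤ p 0) (hx : m ≤ affV p x)
    (hu : u ∈ Set.uIcc 0 x) : m ≤ affV p u := by
  unfold affV at *
  rcases Set.mem_uIcc.1 hu with ⟨h1, h2⟩ | ⟨h1, h2⟩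
  · rcases le_total 0 (p 2) with h | h <;> nlinarith
  · rcases le_total 0 (p 2) with h | h <;> nlinarith

lemma affV_pos {p : Fin 3 → ℝ} {x u : ℝ} (hp : p ∈ affDom x) (hu : u ∈ Set.uIcc 0 x) :
    0 < affV p u :=
  lt_of_lt_of_le (lt_min hp.1 hp.2) (affV_ge (min_le_left _ _) (min_le_right _ _) hu)

@[fun_prop]
lemma continuous_affV (p : Fin 3 → ℝ) : Continuous (affV p) := by
  unfold affV; fun_prop

lemma hasDerivAt_affV (p : Fin 3 → ℝ) (u : ℝ) : HasDerivAt (affV p) (p 2) u := by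
  unfold affV
  simpa using ((hasDerivAt_id u).const_mul (p 2)).const_add (p 0)

@[fun_prop]
lemma continuous_affV_param (u : ℝ) : Continuous fun p : Fin 3 → ℝ => affV p u := by
  unfold affV; fun_prop

lemma convex_affDom (x : ℝ) : Convex ℝ (affDom x) := by
  intro p hp q hq a b ha hb hab
  have key : ∀ s t : ℝ, 0 < s → 0 < t → 0 < a * s + b * t := by
    intro s t hs ht
    rcases ha.eq_or_lt with h | h
    · have : b = 1 := by linarith
      subst h; simp [this, ht]
    · have := mul_nonneg hb ht.le
      have := mul_pos h hs
      linarith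
  constructor
  · simpa using key _ _ hp.1 hq.1
  · have := key _ _ hp.2 hq.2
    simp only [affV, Pi.add_apply, Pi.smul_apply, smul_eq_mul] at this ⊢
    linarith

lemma continuousOn_integrand (n : ℕ) {w : ℝ → ℝ} (hw : Continuous w) {x : ℝ} {p : Fin 3 → ℝ}
    (hp : p ∈ affDom x) : ContinuousOn (fun u => w u / affV p u ^ n) (Set.uIcc 0 x) :=
  hw.continuousOn.div (by fun_prop) fun _ hu => (pow_pos (affV_pos hp hu) n).ne'

lemma intervalIntegrable_integrand (n : ℕ) {w : ℝ → ℝ} (hw : Continuous w) {x : ℝ}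
    {p : Fin 3 → ℝ} (hp : p ∈ affDom x) :
    IntervalIntegrable (fun u => w u / affV p u ^ n) volume 0 x :=
  (continuousOn_integrand n hw hp).intervalIntegrable

/-- The linear form `d ↦ d₀ + u d₂`, the derivative of `v(u)` in the parameters. -/
def affDir (u : ℝ) : (Fin 3 → ℝ) →L[ℝ] ℝ :=
  ContinuousLinearMap.proj (R := ℝ) (φ := fun _ : Fin 3 => ℝ) 0 +
    u • ContinuousLinearMap.proj (R := ℝ) (φ := fun _ : Fin 3 => ℝ) 2

@[simp] lemma affDir_apply (u : ℝ) (d : Fin 3 → ℝ) : affDir u d = affV d u := by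
  simp [affDir, affV, mul_comm]

@[fun_prop]
lemma continuous_affDir : Continuous affDir := by unfold affDir; fun_prop

lemma hasFDerivAt_affV (u : ℝ) (p : Fin 3 → ℝ) :
    HasFDerivAt (fun p : Fin 3 → ℝ => affV p u) (affDir u) p := by
  have : (fun p : Fin 3 → ℝ => affV p u) = affDir u := by ext p; simp
  rw [this]; exact (affDir u).hasFDerivAt

/-- Differentiation of `∫₀ˣ w / vⁿ` in the parameters, under the integral sign. -/
lemma exists_hasFDerivAt_affInt (n : ℕ) {w : ℝ → ℝ} (hw : Continuous w) {x : ℝ}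
    {p : Fin 3 → ℝ} (hp : p ∈ affDom x) :
    ∃ L : (Fin 3 → ℝ) →L[ℝ] ℝ, HasFDerivAt (affInt n w x) L p ∧
      ∀ d, L d = -n * affInt (n + 1) (fun u => w u * affV d u) x p := by
  set m := min (p 0) (affV p x) / 2 with hm
  have hm0 : 0 < min (p 0) (affV p x) := lt_min hp.1 hp.2
  have hmpos : 0 < m := by positivity
  set s : Set (Fin 3 → ℝ) := {q | m < q 0 ∧ m < affV q x} with hs
  have hso : s ∈ 𝓝 p := by
    apply IsOpen.mem_nhds
    · apply IsOpen.and <;> apply isOpen_lt <;> fun_prop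
    · exact ⟨lt_of_lt_of_le (half_lt_self hm0) (min_le_left _ _),
        lt_of_lt_of_le (half_lt_self hm0) (min_le_right _ _)⟩
  have hsd : ∀ q ∈ s, q ∈ affDom x := fun q hq => ⟨hmpos.trans hq.1, hmpos.trans hq.2⟩
  have hsub : Set.uIoc 0 x ⊆ Set.uIcc 0 x := Set.uIoc_subset_uIcc
  set F' : (Fin 3 → ℝ) → ℝ → ((Fin 3 → ℝ) →L[ℝ] ℝ) :=
    fun q u => (-n * (w u / affV q u ^ (n + 1))) • affDir u with hF'
  have hF'c : ∀ q ∈ affDom x, ContinuousOn (F' q) (Set.uIcc 0 x) := by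
    intro q hq
    exact (continuousOn_const.mul (continuousOn_integrand (n + 1) hw hq)).smul
      continuous_affDir.continuousOn
  have hF'i : IntervalIntegrable (F' p) volume 0 x := (hF'c p hp).intervalIntegrable
  refine ⟨∫ u in (0 : ℝ)..x, F' p u, ?_, ?_⟩
  · unfold affInt
    refine intervalIntegral.hasFDerivAt_integral_of_dominated_of_fderiv_le
      (bound := fun u => n * (|w u| / m ^ (n + 1)) * ‖affDir u‖) hso ?_ ?_ ?_ ?_ ?_ ?_
    · filter_upwards [hso] with q hq
      exact ((continuousOn_integrand n hw (hsd q hq)).mono hsub).aestronglyMeasurable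
        measurableSet_uIoc
    · exact intervalIntegrable_integrand n hw hp
    · exact ((hF'c p hp).mono hsub).aestronglyMeasurable measurableSet_uIoc
    · refine Eventually.of_forall fun u hu q hq => ?_
      have hv : m ≤ affV q u := affV_ge hq.1.le hq.2.le (hsub hu)
      simp only [hF', norm_smul, Real.norm_eq_abs, abs_mul, abs_neg, abs_div, Nat.abs_cast,
        abs_pow, abs_of_pos (hmpos.trans_le hv)]
      gcongr
    · apply Continuous.intervalIntegrable
      fun_prop
    · refine Eventually.of_forall fun u hu q hq => ?_
      have hv : 0 < affV q u := affV_pos (hsd q hq) (hsub hu)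
      have h1 := ((hasDerivAt_pow n (affV q u)).inv (pow_pos hv n).ne').const_mul (w u)
      have h2 := h1.comp_hasFDerivAt q (hasFDerivAt_affV u q)
      refine h2.congr_fderiv ?_
      simp only [hF']
      congr 1
      rcases n with _ | n
      · simp
      · simp only [Nat.add_sub_cancel]
        field_simp
        ring
  · intro d
    rw [ContinuousLinearMap.intervalIntegral_apply hF'i, affInt,
      ← intervalIntegral.integral_const_mul]
    congr 1
    ext u
    simp only [hF', smul_apply, affDir_apply, smul_eq_mul]
    ring

/-- Joint continuity of `∫₀ˣ w / vⁿ` in the endpoint and the parameters. -/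
lemma continuousAt_affInt (n : ℕ) {w : ℝ → ℝ} (hw : Continuous w) {x : ℝ}
    {p : Fin 3 → ℝ} (hp : p ∈ affDom x) :
    ContinuousAt (fun z : ℝ × (Fin 3 → ℝ) => affInt n w z.1 z.2) (x, p) := by
  have hrw : (fun z : ℝ × (Fin 3 → ℝ) => affInt n w z.1 z.2) = fun z : ℝ × (Fin 3 → ℝ) =>
      z.1 * ∫ r in (0 : ℝ)..1, w (z.1 * r) / affV z.2 (z.1 * r) ^ n := by
    ext z
    have := intervalIntegral.mul_integral_comp_mul_left (a := 0) (b := 1)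
      (f := fun u => w u / affV z.2 u ^ n) z.1
    simp only [mul_zero, mul_one] at this
    rw [this, affInt]
  rw [hrw]
  refine continuousAt_fst.mul ?_
  set m := min (p 0) (affV p x) / 2 with hm
  have hm0 : 0 < min (p 0) (affV p x) := lt_min hp.1 hp.2
  have hmpos : 0 < m := by positivity
  have hcm : ∀ {x r : ℝ}, r ∈ Set.uIcc (0 : ℝ) 1 → x * r ∈ Set.uIcc 0 x := by
    intro x r hr
    rw [Set.uIcc_of_le zero_le_one] at hr
    rw [Set.mem_uIcc]
    rcases le_total 0 x with h | h
    · left; constructor <;> nlinarith [hr.1, hr.2]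
    · right; constructor <;> nlinarith [hr.1, hr.2]
  have hnh : ∀ᶠ z : ℝ × (Fin 3 → ℝ) in 𝓝 (x, p),
      m < z.2 0 ∧ m < affV z.2 z.1 ∧ |z.1| < |x| + 1 := by
    have ho : IsOpen {z : ℝ × (Fin 3 → ℝ) | m < z.2 0 ∧ m < affV z.2 z.1 ∧ |z.1| < |x| + 1} := by
      refine IsOpen.and ?_ (IsOpen.and ?_ ?_) <;> apply isOpen_lt <;>
        first | fun_prop | (unfold affV; fun_prop)
    exact ho.mem_nhds ⟨lt_of_lt_of_le (half_lt_self hm0) (min_le_left _ _),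
        lt_of_lt_of_le (half_lt_self hm0) (min_le_right _ _), by simp⟩
  obtain ⟨B, hB⟩ := (isCompact_Icc (a := -(|x| + 1)) (b := |x| + 1)).exists_bound_of_continuousOn
    hw.continuousOn
  have hB0 : 0 ≤ B := (norm_nonneg _).trans (hB 0 ⟨by linarith [abs_nonneg x], by positivity⟩)
  refine intervalIntegral.continuousAt_of_dominated_interval (bound := fun _ => B / m ^ n)
    ?_ ?_ ?_ ?_
  · filter_upwards [hnh] with z hz
    have hz' : z.2 ∈ affDom z.1 := ⟨hmpos.trans hz.1, hmpos.trans hz.2.1⟩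
    refine ContinuousOn.aestronglyMeasurable ?_ measurableSet_uIoc
    refine ContinuousOn.div (by fun_prop) (by fun_prop) fun r hr => ?_
    exact (pow_pos (affV_pos hz' (hcm (Set.uIoc_subset_uIcc hr))) n).ne'
  · filter_upwards [hnh] with z hz
    refine Eventually.of_forall fun r hr => ?_
    have hv : m ≤ affV z.2 (z.1 * r) :=
      affV_ge hz.1.le hz.2.1.le (hcm (Set.uIoc_subset_uIcc hr))
    rw [norm_div, norm_pow, Real.norm_of_nonneg (hmpos.le.trans hv)]
    have hr' := Set.uIoc_subset_uIcc hr
    rw [Set.uIcc_of_le zero_le_one] at hr'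
    have : |z.1 * r| ≤ |x| + 1 := by
      rw [abs_mul, abs_of_nonneg hr'.1]
      nlinarith [abs_nonneg z.1, hr'.2, hz.2.2]
    have := hB (z.1 * r) (abs_le.1 this)
    gcongr
  · exact intervalIntegrable_const
  · refine Eventually.of_forall fun r hr => ?_
    have hv := affV_pos hp (hcm (Set.uIoc_subset_uIcc hr))
    refine ContinuousAt.div (by fun_prop) ?_ (pow_pos hv n).ne'
    unfold affV; fun_prop

/-- `ξ ∫₀ˣ du / v(u) = log v(x) - log σ`, also for `ξ = 0`. -/
lemma mul_affInt_one {x : ℝ} {p : Fin 3 → ℝ} (hp : p ∈ affDom x) :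
    p 2 * affInt 1 (fun _ => 1) x p = Real.log (affV p x) - Real.log (p 0) := by
  have h : ∀ u ∈ Set.uIcc 0 x,
      HasDerivAt (fun u => Real.log (affV p u)) (p 2 * (1 / affV p u ^ 1)) u := by
    intro u hu
    convert (hasDerivAt_affV p u).log (affV_pos hp hu).ne' using 1
    rw [pow_one, mul_one_div]
  rw [affInt, ← intervalIntegral.integral_const_mul,
    intervalIntegral.integral_eq_sub_of_hasDerivAt h]
  · simp [affV]
  · exact (intervalIntegrable_integrand 1 continuous_const hp).const_mul _

/-- `v(u) = σ exp(ξ h(u))` with `h(u) = ∫₀ᵘ 1 / v`. -/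
lemma affV_eq_exp {x : ℝ} {p : Fin 3 → ℝ} (hp : p ∈ affDom x) :
    affV p x = p 0 * Real.exp (p 2 * affInt 1 (fun _ => 1) x p) := by
  rw [mul_affInt_one hp, Real.exp_sub, Real.exp_log hp.2, Real.exp_log hp.1,
    mul_div_cancel₀ _ hp.1.ne']

lemma affInt_two {x : ℝ} {p : Fin 3 → ℝ} (hp : p ∈ affDom x) :
    affInt 2 (fun _ => 1) x p = x / (p 0 * affV p x) := by
  have h : ∀ u ∈ Set.uIcc 0 x, HasDerivAt (fun u => u / (p 0 * affV p u)) (1 / affV p u ^ 2) u := by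
    intro u hu
    have h0 := hp.1
    have h1 := affV_pos hp hu
    refine ((hasDerivAt_id u).div ((hasDerivAt_affV p u).const_mul (p 0))
      (by positivity)).congr_deriv ?_
    have : affV p u = p 0 + p 2 * u := rfl
    simp only [id]
    field_simp
    rw [this]; ring
  rw [affInt, intervalIntegral.integral_eq_sub_of_hasDerivAt h]
  · simp
  · exact intervalIntegrable_integrand 2 continuous_const hp

/-! ### The log-density in affine coordinates and its derivatives -/

/-- `h(x) = ∫₀ˣ du / v(u)`. -/
def affH (x : ℝ) (p : Fin 3 → ℝ) : ℝ := affInt 1 (fun _ => 1) x p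

/-- `t = exp (-η - h(x))`; the distribution function at `x` is `exp (-t)`. -/
def affT (x : ℝ) (p : Fin 3 → ℝ) : ℝ := Real.exp (-p 1 - affH x p)

/-- The logarithm of the density of the distribution function `exp (-t)`: its derivative in `x` is
`exp (-t) t / v`. -/
def psi (x : ℝ) (p : Fin 3 → ℝ) : ℝ :=
  -p 1 - affH x p - Real.log (affV p x) - affT x p

/-- The derivative of `p ↦ η + h(x)` in the direction `d`. -/
def affA (x : ℝ) (p d : Fin 3 → ℝ) : ℝ := d 1 - affInt 2 (affV d) x p

/-- The second derivative of `p ↦ η + h(x)` in the directions `d` and `e`. -/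
def affQ (x : ℝ) (p d e : Fin 3 → ℝ) : ℝ := 2 * affInt 3 (fun u => affV d u * affV e u) x p

/-- The derivative of `psi x` at `p` in the direction `d`. -/
def psi1 (x : ℝ) (p d : Fin 3 → ℝ) : ℝ :=
  -(1 - affT x p) * affA x p d - affV d x / affV p x

/-- The second derivative of `psi x` at `p` in the directions `d` and `e`. -/
def psi2 (x : ℝ) (p d e : Fin 3 → ℝ) : ℝ :=
  -(1 - affT x p) * affQ x p d e + affV d x * affV e x / affV p x ^ 2 -
    affT x p * affA x p d * affA x p e

lemma affT_pos (x : ℝ) (p : Fin 3 → ℝ) : 0 < affT x p := Real.exp_pos _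

lemma exists_hasFDerivAt_add_affH {x : ℝ} {p : Fin 3 → ℝ} (hp : p ∈ affDom x) :
    ∃ L : (Fin 3 → ℝ) →L[ℝ] ℝ, HasFDerivAt (fun p => p 1 + affH x p) L p ∧
      ∀ d, L d = affA x p d := by
  obtain ⟨L, hL, hd⟩ := exists_hasFDerivAt_affInt 1 (continuous_const (y := (1 : ℝ))) hp
  refine ⟨_, (ContinuousLinearMap.proj (R := ℝ) (φ := fun _ : Fin 3 => ℝ) 1).hasFDerivAt.add hL, ?_⟩
  intro d
  simp [hd, affA, sub_eq_add_neg]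

lemma exists_hasFDerivAt_affT {x : ℝ} {p : Fin 3 → ℝ} (hp : p ∈ affDom x) :
    ∃ L : (Fin 3 → ℝ) →L[ℝ] ℝ, HasFDerivAt (affT x) L p ∧
      ∀ d, L d = -affT x p * affA x p d := by
  obtain ⟨L, hL, hd⟩ := exists_hasFDerivAt_add_affH hp
  have h := hL.neg.exp
  have he : (fun p : Fin 3 → ℝ => Real.exp (-(p 1 + affH x p))) = affT x := by
    ext p; simp only [affT]; congr 1; ring
  refine ⟨_, he ▸ h, ?_⟩
  · intro d
    simp only [smul_apply, neg_apply, hd, smul_eq_mul, affT, Pi.neg_apply]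
    rw [show -(p 1 + affH x p) = -p 1 - affH x p by ring]; ring

lemma exists_hasFDerivAt_psi {x : ℝ} {p : Fin 3 → ℝ} (hp : p ∈ affDom x) :
    ∃ L : (Fin 3 → ℝ) →L[ℝ] ℝ, HasFDerivAt (psi x) L p ∧ ∀ d, L d = psi1 x p d := by
  obtain ⟨L, hL, hd⟩ := exists_hasFDerivAt_add_affH hp
  obtain ⟨M, hM, hd'⟩ := exists_hasFDerivAt_affT hp
  have hlog := (hasFDerivAt_affV x p).log hp.2.ne'
  have h := (hL.neg.sub hlog).sub hM
  have he : ((-fun p : Fin 3 → ℝ => p 1 + affH x p) - (fun p => Real.log (affV p x))) - affT x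
      = psi x := by
    ext p; simp only [psi, Pi.sub_apply, Pi.neg_apply]; ring
  refine ⟨_, he ▸ h, ?_⟩
  intro d
  simp only [smul_apply, neg_apply, sub_apply, hd, hd', smul_eq_mul, psi1, affDir_apply]
  ring

lemma exists_hasFDerivAt_psi1 {x : ℝ} {p : Fin 3 → ℝ} (hp : p ∈ affDom x) (d : Fin 3 → ℝ) :
    ∃ L : (Fin 3 → ℝ) →L[ℝ] ℝ, HasFDerivAt (fun p => psi1 x p d) L p ∧
      ∀ e, L e = psi2 x p d e := by
  obtain ⟨L, hL, hd⟩ := exists_hasFDerivAt_affInt 2 (continuous_affV d) hp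
  obtain ⟨M, hM, hd'⟩ := exists_hasFDerivAt_affT hp
  have hA : HasFDerivAt (fun p => affA x p d) (-L) p := hL.const_sub (d 1)
  have hv := ((hasDerivAt_inv hp.2.ne').comp_hasFDerivAt p
    (hasFDerivAt_affV x p)).const_mul (affV d x)
  have h := ((hM.const_sub 1).neg.mul hA).sub hv
  refine ⟨_, h, ?_⟩
  intro e
  have hvp := hp.2
  simp only [smul_apply, neg_apply, sub_apply, add_apply, hd, hd', smul_eq_mul, psi2, affDir_apply,
    affQ, Pi.neg_apply]
  push_cast
  field_simp
  ring

/-! ### One-sided domination of the second derivative -/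

lemma affInt_nonneg {n : ℕ} {w : ℝ → ℝ} {x : ℝ} {p : Fin 3 → ℝ} (hp : p ∈ affDom x)
    (hx : 0 ≤ x) (hw : ∀ u ∈ Set.uIcc 0 x, 0 ≤ w u) : 0 ≤ affInt n w x p := by
  refine intervalIntegral.integral_nonneg hx fun u hu => ?_
  rw [← Set.uIcc_of_le hx] at hu
  exact div_nonneg (hw u hu) (pow_nonneg (affV_pos hp hu).le _)

lemma affInt_neg_nonneg {n : ℕ} {w : ℝ → ℝ} {x : ℝ} {p : Fin 3 → ℝ} (hp : p ∈ affDom x)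
    (hx : x ≤ 0) (hw : ∀ u ∈ Set.uIcc 0 x, 0 ≤ w u) : 0 ≤ -affInt n w x p := by
  rw [affInt, ← intervalIntegral.integral_symm]
  refine intervalIntegral.integral_nonneg hx fun u hu => ?_
  rw [← Set.uIcc_of_ge hx] at hu
  exact div_nonneg (hw u hu) (pow_nonneg (affV_pos hp hu).le _)

/-- Comparison of `∫₀ˣ w / vⁿ` under one parameter with `h(x)` under another. -/
lemma abs_affInt_le {n : ℕ} {w : ℝ → ℝ} {x K : ℝ} {p q : Fin 3 → ℝ} (hq : q ∈ affDom x)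
    (hK : 0 ≤ K)
    (h : ∀ u ∈ Set.uIcc 0 x, |w u / affV p u ^ n| ≤ K * (1 / affV q u)) :
    |affInt n w x p| ≤ K * |affH x q| := by
  have hi := (intervalIntegrable_integrand 1 (continuous_const (y := (1 : ℝ))) hq).const_mul K
  have := intervalIntegral.norm_integral_le_abs_of_norm_le (μ := volume) (a := 0) (b := x)
    (f := fun u => w u / affV p u ^ n) (g := fun u => K * (1 / affV q u ^ 1)) ?_ hi
  · rw [intervalIntegral.integral_const_mul, abs_mul, abs_of_nonneg hK] at this
    exact this
  · filter_upwards [ae_restrict_mem measurableSet_uIoc] with u hu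
    rw [pow_one]
    exact h u (Set.uIoc_subset_uIcc hu)

/-- The barrier inequality: `(f/v)²` at the endpoint is controlled by `-ξ` times the second
derivative of `h`, up to terms that are of lower order as `v(x) → 0`. -/
lemma sq_div_affV_le {x : ℝ} {p : Fin 3 → ℝ} (hp : p ∈ affDom x) (d : Fin 3 → ℝ) :
    (affV d x / affV p x) ^ 2 ≤ (d 0 / p 0) ^ 2 - p 2 * affQ x p d d +
      2 * (affV d x / affV p x) * (d 2 * x / p 0) := by
  have h : ∀ u ∈ Set.uIcc 0 x, HasDerivAt (fun u => (affV d u / affV p u) ^ 2)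
      (2 * d 2 * (affV d u / affV p u ^ 2) -
        2 * p 2 * ((affV d u * affV d u) / affV p u ^ 3)) u := by
    intro u hu
    have hv := affV_pos hp hu
    refine (((hasDerivAt_affV d u).div (hasDerivAt_affV p u) hv.ne').pow 2).congr_deriv ?_
    simp only [Pi.div_apply, Nat.add_one_sub_one, pow_one, Nat.cast_ofNat]
    field_simp
  have i1 := intervalIntegrable_integrand 2 (continuous_affV d) hp
  have i2 := intervalIntegrable_integrand 3 (w := fun u => affV d u * affV d u) (by fun_prop) hp
  have key := intervalIntegral.integral_eq_sub_of_hasDerivAt h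
    ((i1.const_mul _).sub (i2.const_mul _))
  rw [intervalIntegral.integral_sub (i1.const_mul _) (i2.const_mul _),
    intervalIntegral.integral_const_mul, intervalIntegral.integral_const_mul] at key
  have h0 : affV d 0 / affV p 0 = d 0 / p 0 := by simp [affV]
  rw [h0] at key
  -- `f(u) = f(x) - d₂ (x - u)`, and the integral of `(x - u) / v²` from `0` to `x` is nonnegative
  -- for both signs of `x`
  have hrem : 0 ≤ affInt 2 (fun u => x - u) x p := by
    rcases le_total 0 x with hx | hx
    · refine affInt_nonneg hp hx fun u hu => ?_
      rw [Set.uIcc_of_le hx] at hu; linarith [hu.2]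
    · have := affInt_neg_nonneg (n := 2) (w := fun u => u - x) hp hx fun u hu => by
        rw [Set.uIcc_of_ge hx] at hu; linarith [hu.1]
      rw [affInt, ← intervalIntegral.integral_neg] at this
      refine this.trans_eq ?_
      rw [affInt]; congr 1; ext u; ring
  have hsplit : affInt 2 (affV d) x p = affV d x * (x / (p 0 * affV p x)) -
      d 2 * affInt 2 (fun u => x - u) x p := by
    rw [← affInt_two hp, affInt, affInt, affInt, ← intervalIntegral.integral_const_mul,
      ← intervalIntegral.integral_const_mul, ← intervalIntegral.integral_sub]
    · congr 1; ext u; simp only [affV]; ring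
    · exact (intervalIntegrable_integrand 2 continuous_const hp).const_mul _
    · exact (intervalIntegrable_integrand 2 (by fun_prop) hp).const_mul _
  have e1 : (∫ u in (0:ℝ)..x, affV d u / affV p u ^ 2) = affInt 2 (affV d) x p := rfl
  have e2 : 2 * (∫ u in (0:ℝ)..x, (affV d u * affV d u) / affV p u ^ 3) = affQ x p d d := rfl
  have h3 := hp.1
  have h4 := hp.2
  have e3 : 2 * d 2 * (affV d x * (x / (p 0 * affV p x))) =
      2 * (affV d x / affV p x) * (d 2 * x / p 0) := by field_simp
  rw [e1, hsplit] at key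
  have h6 := mul_nonneg (sq_nonneg (d 2)) hrem
  rw [← e2]
  linarith

lemma abs_affV_le (d : Fin 3 → ℝ) (u : ℝ) : |affV d u| ≤ ‖d‖ * (1 + |u|) := by
  have h0 := norm_le_pi_norm d 0
  have h2 := norm_le_pi_norm d 2
  rw [Real.norm_eq_abs] at h0 h2
  calc |affV d u| ≤ |d 0| + |d 2| * |u| := by
        rw [affV, ← abs_mul]; exact abs_add_le _ _
    _ ≤ ‖d‖ + ‖d‖ * |u| := by gcongr
    _ = _ := by ring

lemma abs_le_of_mem_uIcc_zero {u x : ℝ} (hu : u ∈ Set.uIcc 0 x) : |u| ≤ |x| := by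
  rcases Set.mem_uIcc.1 hu with ⟨h1, h2⟩ | ⟨h1, h2⟩
  · rw [abs_of_nonneg h1, abs_of_nonneg (h1.trans h2)]; exact h2
  · rw [abs_of_nonpos h2, abs_of_nonpos (h1.trans h2)]; linarith

lemma exp_half_le_two : Real.exp (1 / 2) ≤ 2 := by
  have h : Real.exp (1 / 2) ^ 2 ≤ 2 ^ 2 := by
    rw [← Real.exp_nat_mul]; norm_num; linarith [Real.exp_one_lt_d9]
  exact (pow_le_pow_iff_left₀ (Real.exp_pos _).le (by norm_num) two_ne_zero).1 h

/-- The coordinates `(1, 0, ξ)` of the true parameter. -/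
def baseParam (ξ : ℝ) : Fin 3 → ℝ := ![1, 0, ξ]

@[simp] lemma baseParam_zero (ξ : ℝ) : baseParam ξ 0 = 1 := rfl
@[simp] lemma baseParam_one (ξ : ℝ) : baseParam ξ 1 = 0 := rfl
@[simp] lemma baseParam_two (ξ : ℝ) : baseParam ξ 2 = ξ := rfl

/-- If `|h(x)| ≤ M` then `v` is bounded below on `[0, x]`, and the singular terms are tame. -/
lemma bounds_of_abs_affH_le {x M Z : ℝ} {p : Fin 3 → ℝ} (hp : p ∈ affDom x) (hσ : 1 / 2 ≤ p 0)
    (hZ : |p 2| ≤ Z) (hM : |affH x p| ≤ M) (d : Fin 3 → ℝ) :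
    (affV d x / affV p x) ^ 2 ≤ 8 * Real.exp (Z * M) ^ 2 * ((1 + x ^ 2) * ‖d‖ ^ 2) ∧
    |affQ x p d d| ≤ 16 * M * Real.exp (Z * M) ^ 2 * ((1 + x ^ 2) * ‖d‖ ^ 2) := by
  set E := Real.exp (Z * M) with hE
  have hE0 : 0 < E := Real.exp_pos _
  have hM0 : 0 ≤ M := (abs_nonneg _).trans hM
  have hvx : E⁻¹ / 2 ≤ affV p x := by
    rw [affV_eq_exp hp, hE, ← Real.exp_neg]
    have h1 : -(Z * M) ≤ p 2 * affInt 1 (fun _ => 1) x p := by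
      have : |p 2 * affH x p| ≤ Z * M := by
        rw [abs_mul]; exact mul_le_mul hZ hM (abs_nonneg _) ((abs_nonneg _).trans hZ)
      exact (abs_le.1 this).1
    have h2 := Real.exp_le_exp.2 h1
    have := Real.exp_pos (-(Z * M))
    nlinarith
  have hE1 : E⁻¹ / 2 ≤ p 0 := by
    refine le_trans ?_ hσ
    have : E⁻¹ ≤ 1 := by
      apply inv_le_one_of_one_le₀
      exact Real.one_le_exp (mul_nonneg ((abs_nonneg _).trans hZ) hM0)
    linarith
  have hsq : ∀ u ∈ Set.uIcc 0 x, (affV d u) ^ 2 / affV p u ^ 2 ≤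
      8 * E ^ 2 * ((1 + x ^ 2) * ‖d‖ ^ 2) := by
    intro u hu
    have h1 : E⁻¹ / 2 ≤ affV p u := affV_ge hE1 hvx hu
    have h2 : |affV d u| ≤ ‖d‖ * (1 + |x|) := by
      refine (abs_affV_le d u).trans ?_
      have := abs_le_of_mem_uIcc_zero hu
      gcongr
    have h3 : (affV d u) ^ 2 ≤ 2 * (1 + x ^ 2) * ‖d‖ ^ 2 := by
      rw [← sq_abs]
      calc |affV d u| ^ 2 ≤ (‖d‖ * (1 + |x|)) ^ 2 := by gcongr
        _ ≤ _ := by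
          have : (1 + |x|) ^ 2 ≤ 2 * (1 + x ^ 2) := by
            nlinarith [sq_nonneg (1 - |x|), sq_abs x]
          rw [mul_pow]; nlinarith [sq_nonneg ‖d‖]
    have h4 : (E⁻¹ / 2) ^ 2 ≤ affV p u ^ 2 := by gcongr
    calc (affV d u) ^ 2 / affV p u ^ 2 ≤ (2 * (1 + x ^ 2) * ‖d‖ ^ 2) / (E⁻¹ / 2) ^ 2 := by gcongr
      _ = _ := by field_simp; ring
  constructor
  · rw [div_pow]; exact hsq x Set.right_mem_uIcc
  · have hk := abs_affInt_le (n := 3) (w := fun u => affV d u * affV d u) (p := p)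
      (K := 8 * E ^ 2 * ((1 + x ^ 2) * ‖d‖ ^ 2)) hp (by positivity) ?_
    · rw [affQ, abs_mul, abs_two]
      have : 8 * E ^ 2 * ((1 + x ^ 2) * ‖d‖ ^ 2) * |affH x p| ≤
        8 * E ^ 2 * ((1 + x ^ 2) * ‖d‖ ^ 2) * M := by gcongr
      linarith
    · intro u hu
      have hv := affV_pos hp hu
      have := hsq u hu
      rw [abs_of_nonneg (div_nonneg (mul_self_nonneg _) (by positivity))]
      calc affV d u * affV d u / affV p u ^ 3 =
          (affV d u) ^ 2 / affV p u ^ 2 * (1 / affV p u) := by field_simp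
        _ ≤ _ := by gcongr

lemma affQ_nonneg {x : ℝ} {p : Fin 3 → ℝ} (hp : p ∈ affDom x) (hx : 0 ≤ x) (d : Fin 3 → ℝ) :
    0 ≤ affQ x p d d :=
  mul_nonneg zero_le_two (affInt_nonneg hp hx fun _ _ => mul_self_nonneg _)

lemma affQ_nonpos {x : ℝ} {p : Fin 3 → ℝ} (hp : p ∈ affDom x) (hx : x ≤ 0) (d : Fin 3 → ℝ) :
    affQ x p d d ≤ 0 := by
  have := affInt_neg_nonneg (n := 3) hp hx (w := fun u => affV d u * affV d u)
    fun _ _ => mul_self_nonneg _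
  unfold affQ; linarith

lemma affH_nonneg {x : ℝ} {p : Fin 3 → ℝ} (hp : p ∈ affDom x) (hx : 0 ≤ x) : 0 ≤ affH x p :=
  affInt_nonneg hp hx fun _ _ => zero_le_one

lemma affH_nonpos {x : ℝ} {p : Fin 3 → ℝ} (hp : p ∈ affDom x) (hx : x ≤ 0) : affH x p ≤ 0 := by
  have := affInt_neg_nonneg (n := 1) hp hx (w := fun _ => 1) fun _ _ => zero_le_one
  unfold affH; linarith

lemma psi2_self_le {x : ℝ} {p : Fin 3 → ℝ} (d : Fin 3 → ℝ) :
    psi2 x p d d ≤ -(1 - affT x p) * affQ x p d d + (affV d x / affV p x) ^ 2 := by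
  have : 0 ≤ affT x p * affA x p d * affA x p d := by
    rw [mul_assoc]; exact mul_nonneg (affT_pos _ _).le (mul_self_nonneg _)
  rw [psi2, div_pow, sq (affV d x)]; linarith

/-- The barrier inequality with its cross term absorbed by Young's inequality: the factor `4 / 3`
is what `(f/v)²` costs after a quarter of it moves to the left-hand side. -/
lemma sq_div_affV_le' {x : ℝ} {p : Fin 3 → ℝ} (hp : p ∈ affDom x) (hσ : 1 / 2 ≤ p 0)
    (d : Fin 3 → ℝ) :
    (affV d x / affV p x) ^ 2 ≤ 22 * ((1 + x ^ 2) * ‖d‖ ^ 2) - 4 / 3 * (p 2 * affQ x p d d) := by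
  have h := sq_div_affV_le hp d
  have h0 := norm_le_pi_norm d 0
  have h2 := norm_le_pi_norm d 2
  rw [Real.norm_eq_abs] at h0 h2
  have e0 : (d 0 / p 0) ^ 2 ≤ 4 * ‖d‖ ^ 2 := by
    rw [div_pow, div_le_iff₀ (by positivity)]
    have : d 0 ^ 2 ≤ ‖d‖ ^ 2 := by rw [← sq_abs]; gcongr
    nlinarith [mul_le_mul hσ hσ (by norm_num) (by linarith), sq_nonneg ‖d‖]
  have e2 : (d 2 * x / p 0) ^ 2 ≤ 4 * (x ^ 2 * ‖d‖ ^ 2) := by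
    rw [div_pow, div_le_iff₀ (by positivity), mul_pow]
    have : d 2 ^ 2 ≤ ‖d‖ ^ 2 := by rw [← sq_abs]; gcongr
    have h5 : d 2 ^ 2 * x ^ 2 ≤ ‖d‖ ^ 2 * x ^ 2 := by gcongr
    have h6 : 1 / 4 ≤ p 0 ^ 2 := by nlinarith
    nlinarith [mul_nonneg (sq_nonneg x) (sq_nonneg ‖d‖)]
  nlinarith [sq_nonneg (affV d x / affV p x / 2 - 2 * (d 2 * x / p 0)), sq_nonneg ‖d‖,
    mul_nonneg (sq_nonneg x) (sq_nonneg ‖d‖)]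

/-- For `x ≥ 0` the second derivative is dominated: if `t ≤ 1/3` then
`1 - t ≥ 2/3 ≥ -(4/3) ξ` and the barrier inequality applies, otherwise `h(x)` is bounded. This is
where `ξ > -1/2` enters. -/
lemma psi2_le_of_nonneg {x : ℝ} {p : Fin 3 → ℝ} {Z : ℝ} (hp : p ∈ affDom x) (hσ : 1 / 2 ≤ p 0)
    (hη : |p 1| ≤ 1 / 2) (hξ : -(1 / 2) ≤ p 2) (hZ : |p 2| ≤ Z) (hx : 0 ≤ x) (d : Fin 3 → ℝ) :
    psi2 x p d d ≤ (22 + 72 * Real.exp (Z * 2) ^ 2) * ((1 + x ^ 2) * ‖d‖ ^ 2) := by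
  have hQ := affQ_nonneg hp hx d
  have hN : 0 ≤ (1 + x ^ 2) * ‖d‖ ^ 2 := by positivity
  have hE : 0 ≤ Real.exp (Z * 2) ^ 2 * ((1 + x ^ 2) * ‖d‖ ^ 2) := by positivity
  have hle := psi2_self_le (x := x) (p := p) d
  have hH := affH_nonneg hp hx
  have hT := affT_pos x p
  obtain ⟨hη1, hη2⟩ := abs_le.1 hη
  by_cases h : affT x p ≤ 1 / 3
  · have := sq_div_affV_le' hp hσ d
    nlinarith
  · push Not at h
    have h2 : affH x p ≤ 2 := by
      by_contra hc
      push Not at hc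
      have : affT x p ≤ Real.exp (-(3 / 2)) := Real.exp_le_exp.2 (by linarith)
      have h3 : (3 : ℝ) ≤ Real.exp (3 / 2) := by
        have := Real.quadratic_le_exp_of_nonneg (x := 3 / 2) (by norm_num)
        linarith
      have h4 : Real.exp (-(3 / 2)) ≤ 1 / 3 := by
        rw [Real.exp_neg, one_div]; exact inv_anti₀ (by norm_num) h3
      linarith
    have hT2 : affT x p ≤ 2 := by
      have h5 : affT x p ≤ Real.exp (1 / 2) := Real.exp_le_exp.2 (by linarith)
      have h6 := exp_half_le_two
      linarith
    obtain ⟨b1, b2⟩ := bounds_of_abs_affH_le hp hσ hZ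
      (M := 2) (by rw [abs_of_nonneg hH]; exact h2) d
    rw [abs_of_nonneg hQ] at b2
    nlinarith

/-- For `x ≤ 0` the second derivative of `h` is nonpositive, so the barrier inequality applies as
soon as `t ≥ 1 + (4/3) Z`; otherwise `h(x)` is bounded. -/
lemma psi2_le_of_nonpos {x : ℝ} {p : Fin 3 → ℝ} {Z : ℝ} (hp : p ∈ affDom x) (hσ : 1 / 2 ≤ p 0)
    (hη : |p 1| ≤ 1 / 2) (hZ : |p 2| ≤ Z) (hx : x ≤ 0) (d : Fin 3 → ℝ) :
    psi2 x p d d ≤ (22 + (8 + 16 * (1 + 4 / 3 * Z)) * Real.exp (Z * (1 + 4 / 3 * Z)) ^ 2) *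
      ((1 + x ^ 2) * ‖d‖ ^ 2) := by
  have hQ := affQ_nonpos hp hx d
  have hZ0 : 0 ≤ Z := (abs_nonneg _).trans hZ
  have hN : 0 ≤ (1 + x ^ 2) * ‖d‖ ^ 2 := by positivity
  set M := 1 + 4 / 3 * Z with hM
  set E := Real.exp (Z * M) ^ 2 with hE
  have hM0 : 0 < M := by positivity
  have hle := psi2_self_le (x := x) (p := p) d
  have hH := affH_nonpos hp hx
  have hT := affT_pos x p
  obtain ⟨hη1, hη2⟩ := abs_le.1 hη
  obtain ⟨hZ1, hZ2⟩ := abs_le.1 hZ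
  have hEN : 0 ≤ (8 + 16 * M) * E * ((1 + x ^ 2) * ‖d‖ ^ 2) := by positivity
  by_cases h : M ≤ affT x p
  · have := sq_div_affV_le' hp hσ d
    nlinarith
  · push Not at h
    have h2 : -affH x p ≤ M := by
      have h3 : -p 1 - affH x p ≤ Real.log M := by
        rw [Real.le_log_iff_exp_le hM0]; exact h.le
      have := Real.log_le_sub_one_of_pos hM0
      linarith
    obtain ⟨b1, b2⟩ := bounds_of_abs_affH_le hp hσ hZ
      (M := M) (by rw [abs_of_nonpos hH]; exact h2) d
    rw [abs_of_nonpos hQ] at b2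
    rw [← hE] at b1 b2
    nlinarith

/-- For `ξ > 0` and `x ≥ 0`, `v(u)` is at least a multiple of `1 + u`, and the bound is uniform
in `x`. -/
lemma psi2_le_of_pos {x : ℝ} {p : Fin 3 → ℝ} {k : ℝ} (hp : p ∈ affDom x) (hk : 0 < k)
    (hkσ : k ≤ p 0) (hη : |p 1| ≤ 1 / 2) (hkξ : k ≤ p 2) (hx : 0 ≤ x) (d : Fin 3 → ℝ) :
    psi2 x p d d ≤ 5 / k ^ 2 * ‖d‖ ^ 2 := by
  have hQ := affQ_nonneg hp hx d
  have hle := psi2_self_le (x := x) (p := p) d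
  have hH := affH_nonneg hp hx
  have hT := affT_pos x p
  obtain ⟨hη1, hη2⟩ := abs_le.1 hη
  have hsq : ∀ u ∈ Set.uIcc 0 x, (affV d u) ^ 2 / affV p u ^ 2 ≤ ‖d‖ ^ 2 / k ^ 2 := by
    intro u hu
    rw [Set.uIcc_of_le hx] at hu
    have hu0 := hu.1
    have h1 : k * (1 + u) ≤ affV p u := by unfold affV; nlinarith
    have h2 := abs_affV_le d u
    rw [abs_of_nonneg hu0] at h2
    rw [← sq_abs (affV d u)]
    calc |affV d u| ^ 2 / affV p u ^ 2 ≤ (‖d‖ * (1 + u)) ^ 2 / (k * (1 + u)) ^ 2 := by gcongr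
      _ = _ := by field_simp
  have hQle : affQ x p d d ≤ 2 * (‖d‖ ^ 2 / k ^ 2) * affH x p := by
    have hk := abs_affInt_le (n := 3) (w := fun u => affV d u * affV d u) (p := p)
      (K := ‖d‖ ^ 2 / k ^ 2) hp (by positivity) ?_
    · rw [abs_of_nonneg hH] at hk
      have := (le_abs_self _).trans hk
      unfold affQ; linarith
    · intro u hu
      have hv := affV_pos hp hu
      have := hsq u hu
      rw [abs_of_nonneg (div_nonneg (mul_self_nonneg _) (by positivity))]
      calc affV d u * affV d u / affV p u ^ 3 =
          (affV d u) ^ 2 / affV p u ^ 2 * (1 / affV p u) := by field_simp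
        _ ≤ _ := by gcongr
  have hTH : affT x p * affH x p ≤ 2 := by
    have e : affT x p = Real.exp (-p 1) * Real.exp (-affH x p) := by
      rw [affT, ← Real.exp_add]; congr 1
    have h5 : Real.exp (-p 1) ≤ Real.exp (1 / 2) := Real.exp_le_exp.2 (by linarith)
    have h6 := exp_half_le_two
    have h8 : Real.exp (-affH x p) * affH x p ≤ 1 := by
      rw [Real.exp_neg, inv_mul_le_iff₀ (Real.exp_pos _)]
      linarith [Real.add_one_le_exp (affH x p)]
    have h9 : 0 ≤ Real.exp (-affH x p) * affH x p := mul_nonneg (Real.exp_pos _).le hH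
    rw [e, mul_assoc]
    nlinarith [Real.exp_pos (-p 1)]
  have hX := hsq x Set.right_mem_uIcc
  have hTQ : affT x p * affQ x p d d ≤ 4 * (‖d‖ ^ 2 / k ^ 2) := by
    have h10 : 0 ≤ ‖d‖ ^ 2 / k ^ 2 := by positivity
    nlinarith
  rw [div_pow] at hle
  have : 5 / k ^ 2 * ‖d‖ ^ 2 = 5 * (‖d‖ ^ 2 / k ^ 2) := by ring
  nlinarith

/-- The growth in `x` of the one-sided bound on the second derivative. The two cases are needed:
for `ξ ≥ 1/2` the factor `x²` is not integrable in the upper tail. -/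
def growthBound (ξ x : ℝ) : ℝ := if 0 < ξ ∧ 0 ≤ x then 1 else 1 + x ^ 2

/-- One-sided domination of the second derivative at every parameter near the base parameter under
which `x` has positive density. There is no such lower bound, as `v(x)` may be arbitrarily small. -/
lemma exists_psi2_le {ξ : ℝ} (hξ : -(1 / 2) < ξ) : ∃ ρ > 0, ∃ C : ℝ, 0 ≤ C ∧ ∀ x, ∀ p ∈ affDom x,
    ‖p - baseParam ξ‖ ≤ ρ → ∀ d, psi2 x p d d ≤ C * (growthBound ξ x * ‖d‖ ^ 2) := by
  set k : ℝ := if 0 < ξ then min (1 / 2) (ξ / 2) else 1 / 2 with hk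
  have hk0 : 0 < k := by
    rw [hk]; split_ifs with h <;> [exact lt_min (by norm_num) (by linarith); norm_num]
  have hk12 : k ≤ 1 / 2 := by
    rw [hk]; split_ifs with h <;> [exact min_le_left _ _; exact le_rfl]
  set Z := |ξ| + 1 / 2 with hZ
  set C₁ := 22 + 72 * Real.exp (Z * 2) ^ 2 with hC₁
  set C₂ := 22 + (8 + 16 * (1 + 4 / 3 * Z)) * Real.exp (Z * (1 + 4 / 3 * Z)) ^ 2 with hC₂
  have hZ0 : 0 ≤ Z := by positivity
  refine ⟨min k (ξ + 1 / 2), lt_min hk0 (by linarith), C₁ + C₂ + 5 / k ^ 2, by positivity, ?_⟩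
  intro x p hp hρ d
  have hj : ∀ j, |p j - baseParam ξ j| ≤ min k (ξ + 1 / 2) := fun j =>
    (norm_le_pi_norm (p - baseParam ξ) j).trans hρ
  have h0 := abs_le.1 ((hj 0).trans (min_le_left _ _))
  have h1 := (hj 1).trans (min_le_left _ _)
  have h2 := abs_le.1 ((hj 2).trans (min_le_left _ _))
  have h2' := abs_le.1 ((hj 2).trans (min_le_right _ _))
  simp only [baseParam_zero, baseParam_one, baseParam_two, sub_zero] at h0 h1 h2 h2'
  have hσ : 1 / 2 ≤ p 0 := by linarith
  have hη : |p 1| ≤ 1 / 2 := h1.trans hk12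
  have hZp : |p 2| ≤ Z := by
    have := abs_add_le (p 2 - ξ) ξ
    have h3 := (hj 2).trans (min_le_left _ _)
    simp only [baseParam_two] at h3
    rw [sub_add_cancel] at this
    linarith
  have hN : 0 ≤ (1 + x ^ 2) * ‖d‖ ^ 2 := by positivity
  have p1 : 0 ≤ C₁ := by positivity
  have p2 : 0 ≤ C₂ := by positivity
  have p3 : 0 ≤ 5 / k ^ 2 := by positivity
  unfold growthBound
  split_ifs with hc
  · have hk' : k ≤ ξ / 2 := by rw [hk, if_pos hc.1]; exact min_le_right _ _
    have := psi2_le_of_pos hp hk0 (by linarith) hη (by linarith) hc.2 d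
    nlinarith [sq_nonneg ‖d‖]
  · rcases le_total 0 x with hx | hx
    · have := psi2_le_of_nonneg hp hσ hη (by linarith) hZp hx d
      nlinarith
    · have := psi2_le_of_nonpos hp hσ hη hZp hx d
      nlinarith

/-! ### Two-sided domination of the derivatives -/

/-- The weight `W = 1 + (1 + |x|) / v₀(x)`, where `v₀(u) = 1 + ξ u`. If `p` is within `1 / (2 W)` of
the base parameter then `v ≥ v₀ / 2` on `[0, x]`. -/
def affW (ξ x : ℝ) : ℝ := 1 + (1 + |x|) / affV (baseParam ξ) x

lemma one_le_affW {ξ x : ℝ} (hx : baseParam ξ ∈ affDom x) : 1 ≤ affW ξ x := by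
  have := hx.2
  unfold affW
  have : 0 ≤ (1 + |x|) / affV (baseParam ξ) x := by positivity
  linarith

lemma one_add_abs_le_affW_mul {ξ x u : ℝ} (hx : baseParam ξ ∈ affDom x) (hu : u ∈ Set.uIcc 0 x) :
    1 + |u| ≤ affW ξ x * affV (baseParam ξ) u := by
  have hW := one_le_affW hx
  have hv := hx.2
  have hWv : affW ξ x * affV (baseParam ξ) x = affV (baseParam ξ) x + (1 + |x|) := by
    unfold affW; field_simp
  -- `W v₀(u) - (1 + |u|)` is affine in `u` between `0` and `x`, so its endpoint values decide
  rcases le_total 0 x with h | h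
  · have hu0 : 0 ≤ u := by rw [Set.uIcc_of_le h] at hu; exact hu.1
    have := affV_ge (p := ![affW ξ x - 1, 0, affW ξ x * ξ - 1]) (m := 0) (x := x) (u := u)
      (by simpa using hW) ?_ hu
    · simp [affV] at this ⊢
      rw [abs_of_nonneg hu0]; linarith
    · simp [affV] at hWv hv ⊢
      rw [abs_of_nonneg h] at hWv; linarith
  · have hu0 : u ≤ 0 := by rw [Set.uIcc_of_ge h] at hu; exact hu.2
    have := affV_ge (p := ![affW ξ x - 1, 0, affW ξ x * ξ + 1]) (m := 0) (x := x) (u := u)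
      (by simpa using hW) ?_ hu
    · simp [affV] at this ⊢
      rw [abs_of_nonpos hu0]; linarith
    · simp [affV] at hWv hv ⊢
      rw [abs_of_nonpos h] at hWv; linarith

lemma abs_affV_sub_le (p q : Fin 3 → ℝ) (u : ℝ) : |affV p u - affV q u| ≤ ‖p - q‖ * (1 + |u|) := by
  have := abs_affV_le (p - q) u
  have e : affV (p - q) u = affV p u - affV q u := by simp [affV]; ring
  rwa [e] at this

lemma half_affV_le {ξ x : ℝ} {p : Fin 3 → ℝ} (hx : baseParam ξ ∈ affDom x)
    (hp : ‖p - baseParam ξ‖ * (2 * affW ξ x) ≤ 1) {u : ℝ} (hu : u ∈ Set.uIcc 0 x) :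
    affV (baseParam ξ) u / 2 ≤ affV p u := by
  have h1 := abs_affV_sub_le p (baseParam ξ) u
  have h2 := one_add_abs_le_affW_mul hx hu
  have h3 := affV_pos hx hu
  have h4 := (abs_le.1 h1).1
  have h5 : ‖p - baseParam ξ‖ * (1 + |u|) ≤ ‖p - baseParam ξ‖ *
    (affW ξ x * affV (baseParam ξ) u) := by gcongr
  nlinarith

lemma mem_affDom_of_affW {ξ x : ℝ} {p : Fin 3 → ℝ} (hx : baseParam ξ ∈ affDom x)
    (hp : ‖p - baseParam ξ‖ * (2 * affW ξ x) ≤ 1) : p ∈ affDom x := by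
  have h1 := half_affV_le hx hp Set.left_mem_uIcc
  have h2 := half_affV_le hx hp Set.right_mem_uIcc
  have := hx.2
  constructor
  · simp [affV] at h1; linarith
  · linarith

lemma abs_affA_le {ξ x : ℝ} {p : Fin 3 → ℝ} (hx : baseParam ξ ∈ affDom x)
    (hp : ‖p - baseParam ξ‖ * (2 * affW ξ x) ≤ 1) (d : Fin 3 → ℝ) :
    |affA x p d| ≤ 4 * affW ξ x * (1 + |affH x (baseParam ξ)|) * ‖d‖ := by
  have hW := one_le_affW hx
  have hd := norm_le_pi_norm d 1
  rw [Real.norm_eq_abs] at hd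
  have h := abs_affInt_le (n := 2) (w := affV d) (p := p) (K := 4 * affW ξ x * ‖d‖) hx
    (by positivity) ?_
  · have := abs_sub (d 1) (affInt 2 (affV d) x p)
    unfold affA
    have : ‖d‖ ≤ affW ξ x * ‖d‖ := le_mul_of_one_le_left (norm_nonneg _) hW
    nlinarith [norm_nonneg d]
  · intro u hu
    have h1 := half_affV_le hx hp hu
    have h2 := affV_pos hx hu
    have h3 := one_add_abs_le_affW_mul hx hu
    have h4 := abs_affV_le d u
    have h5 : 0 < affV p u := by linarith
    rw [abs_div, abs_of_pos (pow_pos h5 2)]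
    calc |affV d u| / affV p u ^ 2 ≤
        (‖d‖ * (affW ξ x * affV (baseParam ξ) u)) / (affV (baseParam ξ) u / 2) ^ 2 := by
          gcongr; exact h4.trans (by gcongr)
      _ = _ := by field_simp; ring

lemma abs_affQ_le {ξ x : ℝ} {p : Fin 3 → ℝ} (hx : baseParam ξ ∈ affDom x)
    (hp : ‖p - baseParam ξ‖ * (2 * affW ξ x) ≤ 1) (d e : Fin 3 → ℝ) :
    |affQ x p d e| ≤ 16 * affW ξ x ^ 2 * |affH x (baseParam ξ)| * (‖d‖ * ‖e‖) := by
  have hW := one_le_affW hx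
  have h := abs_affInt_le (n := 3) (w := fun u => affV d u * affV e u) (p := p)
    (K := 8 * affW ξ x ^ 2 * (‖d‖ * ‖e‖)) hx (by positivity) ?_
  · rw [affQ, abs_mul, abs_two]; linarith
  · intro u hu
    have h1 := half_affV_le hx hp hu
    have h2 := affV_pos hx hu
    have h3 := one_add_abs_le_affW_mul hx hu
    have h4 := abs_affV_le d u
    have h4' := abs_affV_le e u
    have h5 : 0 < affV p u := by linarith
    rw [abs_div, abs_of_pos (pow_pos h5 3), abs_mul]
    calc |affV d u| * |affV e u| / affV p u ^ 3 ≤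
        ((‖d‖ * (affW ξ x * affV (baseParam ξ) u)) * (‖e‖ * (affW ξ x * affV (baseParam ξ) u)))
          / (affV (baseParam ξ) u / 2) ^ 3 := by
          gcongr
          · exact h4.trans (by gcongr)
          · exact h4'.trans (by gcongr)
      _ = _ := by field_simp; ring

lemma abs_div_affV_le {ξ x : ℝ} {p : Fin 3 → ℝ} (hx : baseParam ξ ∈ affDom x)
    (hp : ‖p - baseParam ξ‖ * (2 * affW ξ x) ≤ 1) (d : Fin 3 → ℝ) :
    |affV d x / affV p x| ≤ 2 * affW ξ x * ‖d‖ := by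
  have h1 := half_affV_le hx hp Set.right_mem_uIcc
  have h2 := hx.2
  have h3 := one_add_abs_le_affW_mul hx Set.right_mem_uIcc
  have h4 := abs_affV_le d x
  have h5 : 0 < affV p x := by linarith
  have hW : 0 < affW ξ x := zero_lt_one.trans_le (one_le_affW hx)
  rw [abs_div, abs_of_pos h5]
  calc |affV d x| / affV p x ≤
      (‖d‖ * (affW ξ x * affV (baseParam ξ) x)) / (affV (baseParam ξ) x / 2) := by
        gcongr; exact h4.trans (by gcongr)
    _ = _ := by field_simp

lemma affT_le {ξ x : ℝ} {p : Fin 3 → ℝ} (hx : baseParam ξ ∈ affDom x)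
    (hp : ‖p - baseParam ξ‖ * (2 * affW ξ x) ≤ 1) :
    affT x p ≤ 2 * (1 + Real.exp (-2 * affH x (baseParam ξ))) := by
  have hW := one_le_affW hx
  have hpd := mem_affDom_of_affW hx hp
  have hη : |p 1| ≤ 1 / 2 := by
    have := norm_le_pi_norm (p - baseParam ξ) 1
    simp at this
    nlinarith [norm_nonneg (p - baseParam ξ)]
  have h6 := exp_half_le_two
  have hη' := (abs_le.1 hη).1
  have hpos := Real.exp_pos (-2 * affH x (baseParam ξ))
  rcases le_total 0 x with h | h
  · have := affH_nonneg hpd h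
    have : affT x p ≤ Real.exp (1 / 2) := Real.exp_le_exp.2 (by linarith)
    linarith
  · have h1 := affH_nonpos hpd h
    have h2 := affH_nonpos hx h
    have h3 := abs_affInt_le (n := 1) (w := fun _ => 1) (p := p) (K := 2) hx (by positivity)
      fun u hu => by
        have h1 := half_affV_le hx hp hu
        have h2 := affV_pos hx hu
        have h5 : 0 < affV p u := by linarith
        rw [pow_one, abs_of_pos (by positivity)]
        calc 1 / affV p u ≤ 1 / (affV (baseParam ξ) u / 2) := by gcongr
          _ = _ := by field_simp
    change |affH x p| ≤ _ at h3
    rw [abs_of_nonpos h1, abs_of_nonpos h2] at h3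
    have : affT x p ≤ Real.exp (1 / 2) * Real.exp (-2 * affH x (baseParam ξ)) := by
      rw [← Real.exp_add]; exact Real.exp_le_exp.2 (by linarith)
    nlinarith

/-- Two-sided domination of the second derivative, for parameters so close to the base
parameter that `v` and `v₀` are comparable on `[0, x]`. -/
lemma abs_psi2_le {ξ x : ℝ} {p : Fin 3 → ℝ} (hx : baseParam ξ ∈ affDom x)
    (hp : ‖p - baseParam ξ‖ * (2 * affW ξ x) ≤ 1) (d e : Fin 3 → ℝ) :
    |psi2 x p d e| ≤ 84 * ((1 + Real.exp (-2 * affH x (baseParam ξ))) * affW ξ x ^ 2 *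
      (1 + |affH x (baseParam ξ)|) ^ 2) * (‖d‖ * ‖e‖) := by
  have hA := abs_affA_le hx hp d
  have hA' := abs_affA_le hx hp e
  have hQ := abs_affQ_le hx hp d e
  have hD := abs_div_affV_le hx hp d
  have hD' := abs_div_affV_le hx hp e
  have hT := affT_le hx hp
  have hT0 := affT_pos x p
  have hW := one_le_affW hx
  set E := 1 + Real.exp (-2 * affH x (baseParam ξ)) with hE
  have hE1 : 1 ≤ E := by have := Real.exp_pos (-2 * affH x (baseParam ξ)); linarith
  set a := |affH x (baseParam ξ)| with ha
  have ha0 : 0 ≤ a := abs_nonneg _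
  set W := affW ξ x
  have t1 : |-(1 - affT x p) * affQ x p d e| ≤ 48 * (E * W ^ 2 * (1 + a) ^ 2) * (‖d‖ * ‖e‖) := by
    rw [abs_mul]
    have : |-(1 - affT x p)| ≤ 3 * E := by rw [abs_le]; constructor <;> linarith
    calc _ ≤ (3 * E) * (16 * W ^ 2 * a * (‖d‖ * ‖e‖)) := by gcongr
      _ = 48 * (E * W ^ 2 * a) * (‖d‖ * ‖e‖) := by ring
      _ ≤ _ := by gcongr; nlinarith
  have t2 : |affV d x * affV e x / affV p x ^ 2| ≤ 4 * (E * W ^ 2 * (1 + a) ^ 2) * (‖d‖ * ‖e‖) := by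
    have : affV d x * affV e x / affV p x ^ 2 = affV d x / affV p x * (affV e x / affV p x) := by
      ring
    rw [this, abs_mul]
    calc _ ≤ (2 * W * ‖d‖) * (2 * W * ‖e‖) := by gcongr
      _ = 4 * (1 * W ^ 2 * 1) * (‖d‖ * ‖e‖) := by ring
      _ ≤ _ := by gcongr; nlinarith
  have t3 : |affT x p * affA x p d * affA x p e| ≤
      32 * (E * W ^ 2 * (1 + a) ^ 2) * (‖d‖ * ‖e‖) := by
    rw [abs_mul, abs_mul, abs_of_pos hT0]
    calc _ ≤ (2 * E) * (4 * W * (1 + a) * ‖d‖) * (4 * W * (1 + a) * ‖e‖) := by gcongr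
      _ = _ := by ring
  have := abs_sub (-(1 - affT x p) * affQ x p d e + affV d x * affV e x / affV p x ^ 2)
    (affT x p * affA x p d * affA x p e)
  have := abs_add_le (-(1 - affT x p) * affQ x p d e) (affV d x * affV e x / affV p x ^ 2)
  unfold psi2
  linarith

lemma abs_psi1_le {ξ x : ℝ} {p : Fin 3 → ℝ} (hx : baseParam ξ ∈ affDom x)
    (hp : ‖p - baseParam ξ‖ * (2 * affW ξ x) ≤ 1) (d : Fin 3 → ℝ) :
    |psi1 x p d| ≤ 14 * ((1 + Real.exp (-2 * affH x (baseParam ξ))) * affW ξ x *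
      (1 + |affH x (baseParam ξ)|)) * ‖d‖ := by
  have hA := abs_affA_le hx hp d
  have hD := abs_div_affV_le hx hp d
  have hT := affT_le hx hp
  have hT0 := affT_pos x p
  have hW := one_le_affW hx
  set E := 1 + Real.exp (-2 * affH x (baseParam ξ)) with hE
  have hE1 : 1 ≤ E := by have := Real.exp_pos (-2 * affH x (baseParam ξ)); linarith
  set a := |affH x (baseParam ξ)| with ha
  have ha0 : 0 ≤ a := abs_nonneg _
  set W := affW ξ x
  have t1 : |-(1 - affT x p) * affA x p d| ≤ 12 * (E * W * (1 + a)) * ‖d‖ := by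
    rw [abs_mul]
    have : |-(1 - affT x p)| ≤ 3 * E := by rw [abs_le]; constructor <;> linarith
    calc _ ≤ (3 * E) * (4 * W * (1 + a) * ‖d‖) := by gcongr
      _ = _ := by ring
  have t2 : |affV d x / affV p x| ≤ 2 * (E * W * (1 + a)) * ‖d‖ := by
    calc _ ≤ 2 * (1 * W * 1) * ‖d‖ := by linarith
      _ ≤ _ := by gcongr; linarith
  have := abs_sub (-(1 - affT x p) * affA x p d) (affV d x / affV p x)
  unfold psi1
  linarith

/-! ### Continuity, symmetry and coordinate expansions -/

lemma continuousAt_affV_pair (x : ℝ) (p : Fin 3 → ℝ) :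
    ContinuousAt (fun z : ℝ × (Fin 3 → ℝ) => affV z.2 z.1) (x, p) := by
  unfold affV; fun_prop

lemma continuousAt_affT {x : ℝ} {p : Fin 3 → ℝ} (hp : p ∈ affDom x) :
    ContinuousAt (fun z : ℝ × (Fin 3 → ℝ) => affT z.1 z.2) (x, p) := by
  have h := continuousAt_affInt 1 (continuous_const (y := (1 : ℝ))) hp
  unfold affT affH
  refine Real.continuous_exp.continuousAt.comp (ContinuousAt.sub ?_ h)
  fun_prop

lemma continuousAt_psi1 {x : ℝ} {p : Fin 3 → ℝ} (hp : p ∈ affDom x) (d : Fin 3 → ℝ) :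
    ContinuousAt (fun z : ℝ × (Fin 3 → ℝ) => psi1 z.1 z.2 d) (x, p) := by
  have hT := continuousAt_affT hp
  have hA := continuousAt_affInt 2 (continuous_affV d) hp
  have hv := continuousAt_affV_pair x p
  have hd : ContinuousAt (fun z : ℝ × (Fin 3 → ℝ) => affV d z.1) (x, p) := by fun_prop
  unfold psi1 affA
  exact ((continuousAt_const.sub hT).neg.mul (continuousAt_const.sub hA)).sub
    (hd.div hv hp.2.ne')

/-- Joint continuity of the second derivative in the observation and the parameters. -/
lemma continuousAt_psi2 {x : ℝ} {p : Fin 3 → ℝ} (hp : p ∈ affDom x) (d e : Fin 3 → ℝ) :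
    ContinuousAt (fun z : ℝ × (Fin 3 → ℝ) => psi2 z.1 z.2 d e) (x, p) := by
  have hT := continuousAt_affT hp
  have hA := continuousAt_affInt 2 (continuous_affV d) hp
  have hA' := continuousAt_affInt 2 (continuous_affV e) hp
  have hQ := continuousAt_affInt 3 ((continuous_affV d).mul (continuous_affV e)) hp
  have hv := continuousAt_affV_pair x p
  have hd : ContinuousAt (fun z : ℝ × (Fin 3 → ℝ) => affV d z.1) (x, p) := by fun_prop
  have he : ContinuousAt (fun z : ℝ × (Fin 3 → ℝ) => affV e z.1) (x, p) := by fun_prop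
  unfold psi2 affA affQ
  exact (((continuousAt_const.sub hT).neg.mul (hQ.const_mul 2)).add
    ((hd.mul he).div (hv.pow 2) (pow_pos hp.2 2).ne')).sub
      ((hT.mul (continuousAt_const.sub hA)).mul (continuousAt_const.sub hA'))

lemma psi2_comm (x : ℝ) (p d e : Fin 3 → ℝ) : psi2 x p d e = psi2 x p e d := by
  have : affQ x p d e = affQ x p e d := by
    simp only [affQ, mul_comm (affV d _)]
  rw [psi2, psi2, this]; ring

/-- Expansion of the second derivative in coordinates. -/
lemma psi2_eq_sum {x : ℝ} {p : Fin 3 → ℝ} (hp : p ∈ affDom x) (d e : Fin 3 → ℝ) :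
    psi2 x p d e = ∑ j, ∑ k, d j * e k * psi2 x p (Pi.single j 1) (Pi.single k 1) := by
  have h1 : ∀ d e : Fin 3 → ℝ, psi2 x p d e = ∑ k, e k * psi2 x p d (Pi.single k 1) := by
    intro d e
    obtain ⟨L, -, hL⟩ := exists_hasFDerivAt_psi1 hp d
    simp only [← hL]
    conv_lhs => rw [pi_eq_sum_univ' e]
    simp
  rw [h1, Finset.sum_comm]
  refine Finset.sum_congr rfl fun k _ => ?_
  rw [psi2_comm, h1, Finset.mul_sum]
  refine Finset.sum_congr rfl fun j _ => ?_
  rw [psi2_comm]; ring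

lemma psi1_eq_sum {x : ℝ} {p : Fin 3 → ℝ} (hp : p ∈ affDom x) (d : Fin 3 → ℝ) :
    psi1 x p d = ∑ j, d j * psi1 x p (Pi.single j 1) := by
  obtain ⟨L, -, hL⟩ := exists_hasFDerivAt_psi hp
  simp only [← hL]
  conv_lhs => rw [pi_eq_sum_univ' d]
  simp

/-! ### Exponential growth and the Gumbel density -/

/-- The Gumbel density `exp (-s - exp (-s))`. -/
def gumbelPDF (s : ℝ) : ℝ := Real.exp (-s - Real.exp (-s))

/-- `exp (a s)` for `s ≥ 0` and `exp (-m s)` for `s ≤ 0`. -/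
def expEnv (a m s : ℝ) : ℝ := Real.exp (a * max s 0 + m * max (-s) 0)

/-- `f` grows at most like `exp (a s)` at `+∞` and at most exponentially at `-∞`. -/
def ExpBounded (a : ℝ) (f : ℝ → ℝ) : Prop :=
  ∃ C m, 0 ≤ C ∧ 0 ≤ m ∧ ∀ s, |f s| ≤ C * expEnv a m s

lemma expEnv_mono {a b m k s : ℝ} (hab : a ≤ b) (hmk : m ≤ k) : expEnv a m s ≤ expEnv b k s := by
  unfold expEnv
  have h1 : 0 ≤ max s 0 := le_max_right _ _
  have h2 : 0 ≤ max (-s) 0 := le_max_right _ _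
  gcongr

lemma expEnv_mul (a b m k s : ℝ) : expEnv a m s * expEnv b k s = expEnv (a + b) (m + k) s := by
  unfold expEnv
  rw [← Real.exp_add]; congr 1; ring

lemma ExpBounded.mul {a b : ℝ} {f g : ℝ → ℝ} (hf : ExpBounded a f) (hg : ExpBounded b g) :
    ExpBounded (a + b) (fun s => f s * g s) := by
  obtain ⟨C, m, hC, hm, h⟩ := hf
  obtain ⟨D, k, hD, hk, h'⟩ := hg
  refine ⟨C * D, m + k, by positivity, by positivity, fun s => ?_⟩
  rw [abs_mul, ← expEnv_mul]
  calc |f s| * |g s| ≤ (C * expEnv a m s) * (D * expEnv b k s) :=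
        mul_le_mul (h s) (h' s) (abs_nonneg _) ((abs_nonneg _).trans (h s))
    _ = _ := by ring

lemma ExpBounded.add {a : ℝ} {f g : ℝ → ℝ} (hf : ExpBounded a f) (hg : ExpBounded a g) :
    ExpBounded a (fun s => f s + g s) := by
  obtain ⟨C, m, hC, hm, h⟩ := hf
  obtain ⟨D, k, hD, hk, h'⟩ := hg
  refine ⟨C + D, m + k, by positivity, by positivity, fun s => ?_⟩
  have h1 : expEnv a m s ≤ expEnv a (m + k) s := expEnv_mono le_rfl (by linarith)
  have h2 : expEnv a k s ≤ expEnv a (m + k) s := expEnv_mono le_rfl (by linarith)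
  calc |f s + g s| ≤ |f s| + |g s| := abs_add_le _ _
    _ ≤ C * expEnv a m s + D * expEnv a k s := add_le_add (h s) (h' s)
    _ ≤ C * expEnv a (m + k) s + D * expEnv a (m + k) s := by gcongr
    _ = _ := by ring

lemma ExpBounded.of_le {a b : ℝ} {f g : ℝ → ℝ} (hg : ExpBounded a g) (hab : a ≤ b)
    (h : ∀ s, |f s| ≤ |g s|) : ExpBounded b f := by
  obtain ⟨C, m, hC, hm, h'⟩ := hg
  exact ⟨C, m, hC, hm, fun s =>
    (h s).trans ((h' s).trans (by gcongr; exact expEnv_mono hab le_rfl))⟩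

lemma expBounded_const {a : ℝ} (ha : 0 ≤ a) (c : ℝ) : ExpBounded a (fun _ => c) := by
  refine ⟨|c|, 0, abs_nonneg _, le_rfl, fun s => le_mul_of_one_le_right (abs_nonneg _) ?_⟩
  unfold expEnv
  have h1 : 0 ≤ max s 0 := le_max_right _ _
  exact Real.one_le_exp (by positivity)

lemma expBounded_abs {a : ℝ} (ha : 0 < a) : ExpBounded a (fun s => 1 + |s|) := by
  refine ⟨1 + 1 / a, a, by positivity, ha.le, fun s => ?_⟩
  have h1 : a * max s 0 + a * max (-s) 0 = a * |s| := by
    rw [← mul_add]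
    rcases le_total 0 s with h | h
    · rw [max_eq_left h, max_eq_right (by linarith), abs_of_nonneg h, add_zero]
    · rw [max_eq_right h, max_eq_left (by linarith), abs_of_nonpos h, zero_add]
  have h2 := Real.add_one_le_exp (a * |s|)
  have h3 : 1 ≤ Real.exp (a * |s|) := Real.one_le_exp (by positivity)
  rw [abs_of_nonneg (by positivity), expEnv, h1]
  have : |s| ≤ 1 / a * Real.exp (a * |s|) := by
    rw [one_div, ← div_eq_inv_mul, le_div_iff₀ ha]; linarith
  linarith

lemma expBounded_exp (c : ℝ) : ExpBounded (max c 0) (fun s => Real.exp (c * s)) := by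
  refine ⟨1, max (-c) 0, zero_le_one, le_max_right _ _, fun s => ?_⟩
  rw [abs_of_pos (Real.exp_pos _), one_mul, expEnv]
  apply Real.exp_le_exp.2
  rcases le_total 0 s with h | h
  · rw [max_eq_left h, max_eq_right (a := -s) (by linarith)]
    nlinarith [le_max_left c 0]
  · rw [max_eq_right h, max_eq_left (a := -s) (by linarith)]
    nlinarith [le_max_left (-c) 0]

lemma gumbelPDF_pos (s : ℝ) : 0 < gumbelPDF s := Real.exp_pos _

@[fun_prop]
lemma continuous_gumbelPDF : Continuous gumbelPDF := by unfold gumbelPDF; fun_prop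

lemma continuous_expEnv (a m : ℝ) : Continuous (expEnv a m) := by unfold expEnv; fun_prop

lemma integrable_exp_neg_mul_abs {c : ℝ} (hc : 0 < c) :
    Integrable fun s : ℝ => Real.exp (-c * |s|) := by
  have h1 : IntegrableOn (fun s : ℝ => Real.exp (-c * |s|)) (Set.Ioi 0) := by
    refine (exp_neg_integrableOn_Ioi 0 hc).congr_fun (fun s hs => ?_) measurableSet_Ioi
    simp only [abs_of_pos hs.out]
  have h2 : IntegrableOn (fun s : ℝ => Real.exp (-c * |s|)) (Set.Iic 0) := by
    refine (integrableOn_exp_mul_Iic hc 0).congr_fun (fun s hs => ?_) measurableSet_Iic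
    simp only [abs_of_nonpos hs.out, mul_neg, neg_mul, neg_neg]
  rw [← integrableOn_univ, ← Set.Iic_union_Ioi (a := (0 : ℝ))]
  exact h2.union h1

lemma integrable_gumbelPDF_mul_expEnv {a : ℝ} (ha : a < 1) (m : ℝ) :
    Integrable fun s => gumbelPDF s * expEnv a m s := by
  set c := 1 - a with hc
  have hc0 : 0 < c := by linarith
  set b := 1 + m + c with hb
  refine ((integrable_exp_neg_mul_abs hc0).const_mul (Real.exp (b ^ 2 / 2))).mono'
    (by have := continuous_expEnv a m; fun_prop) (Eventually.of_forall fun s => ?_)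
  rw [Real.norm_of_nonneg (mul_nonneg (gumbelPDF_pos s).le (Real.exp_pos _).le :
      0 ≤ gumbelPDF s * expEnv a m s), gumbelPDF, expEnv,
    ← Real.exp_add, ← Real.exp_add]
  apply Real.exp_le_exp.2
  have hb2 : 0 ≤ b ^ 2 / 2 := by positivity
  rcases le_total 0 s with h | h
  · rw [max_eq_left h, max_eq_right (a := -s) (by linarith), abs_of_nonneg h]
    have := Real.exp_pos (-s)
    nlinarith
  · rw [max_eq_right h, max_eq_left (a := -s) (by linarith), abs_of_nonpos h]
    have := Real.quadratic_le_exp_of_nonneg (x := -s) (by linarith)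
    nlinarith [sq_nonneg (b + s)]

lemma ExpBounded.integrable {a : ℝ} {f : ℝ → ℝ} (hf : ExpBounded a f) (ha : a < 1)
    (hc : Continuous f) : Integrable fun s => gumbelPDF s * f s := by
  obtain ⟨C, m, hC, hm, h⟩ := hf
  refine ((integrable_gumbelPDF_mul_expEnv ha m).const_mul C).mono' (by fun_prop)
    (Eventually.of_forall fun s => ?_)
  rw [norm_mul, Real.norm_of_nonneg (gumbelPDF_pos s).le, Real.norm_eq_abs]
  calc gumbelPDF s * |f s| ≤ gumbelPDF s * (C * expEnv a m s) :=
        mul_le_mul_of_nonneg_left (h s) (gumbelPDF_pos s).le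
    _ = _ := by ring

/-! ### The Gumbel coordinate -/

/-- The inverse of `x ↦ h(x)` at the base parameter: `∫₀ˢ exp (ξ r) dr`, that is
`(exp (ξ s) - 1) / ξ`, or `s` if `ξ = 0`. It carries the standard Gumbel distribution to the GEV
distribution with location `0`, scale `1` and shape `ξ`. -/
def gevQuantile (ξ s : ℝ) : ℝ := ∫ r in (0 : ℝ)..s, Real.exp (ξ * r)

lemma hasDerivAt_gevQuantile (ξ s : ℝ) : HasDerivAt (gevQuantile ξ) (Real.exp (ξ * s)) s := by
  have hc : Continuous fun r : ℝ => Real.exp (ξ * r) := by fun_prop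
  exact intervalIntegral.integral_hasDerivAt_right (hc.intervalIntegrable _ _)
    (hc.stronglyMeasurableAtFilter _ _) hc.continuousAt

@[fun_prop]
lemma continuous_gevQuantile (ξ : ℝ) : Continuous (gevQuantile ξ) :=
  continuous_iff_continuousAt.2 fun s => (hasDerivAt_gevQuantile ξ s).continuousAt

@[simp] lemma gevQuantile_zero_right (ξ : ℝ) : gevQuantile ξ 0 = 0 := by simp [gevQuantile]

@[simp] lemma gevQuantile_zero_left (s : ℝ) : gevQuantile 0 s = s := by simp [gevQuantile]

lemma affV_gevQuantile (ξ s : ℝ) : affV (baseParam ξ) (gevQuantile ξ s) = Real.exp (ξ * s) := by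
  have h : ∀ u ∈ Set.uIcc 0 s, HasDerivAt (fun r => Real.exp (ξ * r)) (ξ * Real.exp (ξ * u)) u := by
    intro u _
    have := ((hasDerivAt_id u).const_mul ξ).exp
    refine this.congr_deriv ?_
    simp; ring
  have := intervalIntegral.integral_eq_sub_of_hasDerivAt h
    (Continuous.intervalIntegrable (by fun_prop) _ _)
  rw [intervalIntegral.integral_const_mul] at this
  simp only [affV, baseParam_zero, baseParam_two, gevQuantile, this]
  simp

lemma gevQuantile_mem (ξ s : ℝ) : baseParam ξ ∈ affDom (gevQuantile ξ s) :=
  ⟨by simp, by rw [affV_gevQuantile]; exact Real.exp_pos _⟩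

lemma strictMono_gevQuantile (ξ : ℝ) : StrictMono (gevQuantile ξ) :=
  strictMono_of_hasDerivAt_pos (fun s => hasDerivAt_gevQuantile ξ s) fun _ => Real.exp_pos _

lemma hasDerivAt_affInt (n : ℕ) {w : ℝ → ℝ} (hw : Continuous w) {x : ℝ} {p : Fin 3 → ℝ}
    (hp : p ∈ affDom x) : HasDerivAt (fun x => affInt n w x p) (w x / affV p x ^ n) x := by
  have ho : IsOpen {y | 0 < affV p y} := isOpen_lt continuous_const (continuous_affV p)
  have hc : ContinuousOn (fun u => w u / affV p u ^ n) {y | 0 < affV p y} :=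
    hw.continuousOn.div (by fun_prop) fun u hu => (pow_pos hu n).ne'
  exact intervalIntegral.integral_hasDerivAt_right (intervalIntegrable_integrand n hw hp)
    (hc.stronglyMeasurableAtFilter ho x hp.2) (hc.continuousAt (ho.mem_nhds hp.2))

lemma affH_gevQuantile (ξ s : ℝ) : affH (gevQuantile ξ s) (baseParam ξ) = s := by
  have h : ∀ s, HasDerivAt (fun s => affH (gevQuantile ξ s) (baseParam ξ) - s) 0 s := by
    intro s
    have h1 := hasDerivAt_affInt 1 (continuous_const (y := (1 : ℝ))) (gevQuantile_mem ξ s)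
    have h2 := (h1.comp s (hasDerivAt_gevQuantile ξ s)).sub (hasDerivAt_id s)
    refine h2.congr_deriv ?_
    rw [affV_gevQuantile, pow_one, one_div, inv_mul_cancel₀ (Real.exp_pos _).ne', sub_self]
  have := is_const_of_deriv_eq_zero (fun s => (h s).differentiableAt) (fun s => (h s).deriv) s 0
  simp only [gevQuantile_zero_right, affH, affInt, intervalIntegral.integral_same, sub_zero] at this
  simp only [affH, affInt]
  linarith

lemma gevQuantile_affH {ξ x : ℝ} (hx : baseParam ξ ∈ affDom x) :
    gevQuantile ξ (affH x (baseParam ξ)) = x := by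
  by_cases h : ξ = 0
  · subst h
    simp [affH, affInt, affV]
  · have h1 := affV_gevQuantile ξ (affH x (baseParam ξ))
    have h2 := affV_eq_exp hx
    simp only [baseParam_zero, baseParam_two, one_mul] at h2
    change _ = Real.exp (ξ * affH x (baseParam ξ)) at h2
    rw [← h2] at h1
    simp only [affV, baseParam_zero, baseParam_two, add_right_inj] at h1
    exact mul_left_cancel₀ h h1

lemma affT_gevQuantile (ξ s : ℝ) : affT (gevQuantile ξ s) (baseParam ξ) = Real.exp (-s) := by
  rw [affT, affH_gevQuantile]; simp

lemma abs_gevQuantile_le (ξ s : ℝ) : |gevQuantile ξ s| ≤ |s| * (1 + Real.exp (ξ * s)) := by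
  have := intervalIntegral.norm_integral_le_of_norm_le_const (a := 0) (b := s)
    (f := fun r => Real.exp (ξ * r)) (C := 1 + Real.exp (ξ * s)) ?_
  · rw [sub_zero, mul_comm] at this; exact this
  · intro r hr
    rw [Real.norm_of_nonneg (Real.exp_pos _).le]
    have hr := Set.uIoc_subset_uIcc hr
    have h1 := Real.exp_pos (ξ * s)
    have h2 : ξ * r ≤ 0 ∨ ξ * r ≤ ξ * s := by
      rcases le_total 0 ξ with h | h <;> rcases Set.mem_uIcc.1 hr with ⟨h2, h3⟩ | ⟨h2, h3⟩
      · right; nlinarith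
      · left; nlinarith
      · left; nlinarith
      · right; nlinarith
    rcases h2 with h | h
    · have := Real.exp_le_one_iff.2 h; linarith
    · have := Real.exp_le_exp.2 h; linarith

/-- The two-sided envelope of the second derivative in the Gumbel coordinate. It is integrable
against the Gumbel density because `W²` grows like `exp (2 max (-ξ) 0 s)`, up to a factor `s²`,
and `2 max (-ξ) 0 < 1`. -/
def hessEnv (ξ s : ℝ) : ℝ := (1 + Real.exp (-2 * s)) * affW ξ (gevQuantile ξ s) ^ 2 * (1 + |s|) ^ 2

lemma affW_gevQuantile (ξ s : ℝ) :
    affW ξ (gevQuantile ξ s) = 1 + (1 + |gevQuantile ξ s|) * Real.exp (-ξ * s) := by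
  rw [affW, affV_gevQuantile, neg_mul, Real.exp_neg, div_eq_mul_inv]

@[fun_prop]
lemma continuous_affW_gevQuantile (ξ : ℝ) : Continuous fun s => affW ξ (gevQuantile ξ s) := by
  simp only [affW_gevQuantile]; fun_prop

@[fun_prop]
lemma continuous_hessEnv (ξ : ℝ) : Continuous (hessEnv ξ) := by unfold hessEnv; fun_prop

lemma one_le_affW_gevQuantile (ξ s : ℝ) : 1 ≤ affW ξ (gevQuantile ξ s) :=
  one_le_affW (gevQuantile_mem ξ s)

lemma one_le_hessEnv (ξ s : ℝ) : 1 ≤ hessEnv ξ s := by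
  unfold hessEnv
  have h1 := one_le_affW_gevQuantile ξ s
  have h2 : 1 ≤ 1 + Real.exp (-2 * s) := by linarith [Real.exp_pos (-2 * s)]
  have h3 : 1 ≤ 1 + |s| := by linarith [abs_nonneg s]
  exact one_le_mul_of_one_le_of_one_le
    (one_le_mul_of_one_le_of_one_le h2 (one_le_pow₀ h1)) (one_le_pow₀ h3)

lemma expBounded_affW {ξ ε : ℝ} (hε : 0 < ε) :
    ExpBounded (ε + max (-ξ) 0) fun s => affW ξ (gevQuantile ξ s) := by
  have h1 : ExpBounded (max (-ξ) 0) fun s => 1 + Real.exp (-ξ * s) :=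
    (expBounded_const (le_max_right _ _) 1).add (expBounded_exp (-ξ))
  have h2 := (expBounded_const le_rfl 2).mul ((expBounded_abs hε).mul h1)
  rw [zero_add] at h2
  refine h2.of_le le_rfl fun s => ?_
  have h3 := one_le_affW_gevQuantile ξ s
  have e := Real.exp_pos (-ξ * s)
  rw [abs_of_nonneg (by linarith), abs_of_nonneg (by positivity), affW_gevQuantile]
  have h4 := abs_gevQuantile_le ξ s
  have h5 : |gevQuantile ξ s| * Real.exp (-ξ * s) ≤ |s| * (1 + Real.exp (-ξ * s)) := by
    calc _ ≤ |s| * (1 + Real.exp (ξ * s)) * Real.exp (-ξ * s) := by gcongr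
      _ = |s| * (1 + Real.exp (-ξ * s)) := by
        have : Real.exp (ξ * s) * Real.exp (-ξ * s) = 1 := by
          rw [← Real.exp_add]; simp
        linear_combination |s| * this
  nlinarith [abs_nonneg s, mul_nonneg (abs_nonneg s) e.le]

lemma expBounded_hessEnv {ξ ε : ℝ} (hε : 0 < ε) :
    ExpBounded (2 * max (-ξ) 0 + 4 * ε) (hessEnv ξ) := by
  have h1 : ExpBounded 0 fun s => 1 + Real.exp (-2 * s) := by
    have := (expBounded_const le_rfl 1).add ((expBounded_exp (-2)).of_le (b := 0) (by norm_num)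
      fun _ => le_rfl)
    exact this
  have hW := expBounded_affW (ξ := ξ) hε
  have ha := expBounded_abs hε
  have := (h1.mul (hW.mul hW)).mul (ha.mul ha)
  refine this.of_le (by linarith) fun s => le_of_eq ?_
  congr 1
  unfold hessEnv; ring

lemma exists_pos_two_mul_max_lt {ξ : ℝ} (hξ : -(1 / 2) < ξ) :
    ∃ ε > 0, 2 * max (-ξ) 0 + 4 * ε < 1 := by
  have : max (-ξ) 0 < 1 / 2 := max_lt (by linarith) (by norm_num)
  exact ⟨(1 - 2 * max (-ξ) 0) / 8, by linarith, by linarith⟩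

lemma integrable_hessEnv {ξ : ℝ} (hξ : -(1 / 2) < ξ) :
    Integrable fun s => gumbelPDF s * hessEnv ξ s := by
  obtain ⟨ε, hε, h⟩ := exists_pos_two_mul_max_lt hξ
  exact (expBounded_hessEnv hε).integrable h (continuous_hessEnv ξ)

/-- A function dominated by the envelope is integrable against the Gumbel density. -/
lemma integrable_of_abs_le_hessEnv {ξ : ℝ} (hξ : -(1 / 2) < ξ) {f : ℝ → ℝ} (hf : Continuous f)
    {C : ℝ} (h : ∀ s, |f s| ≤ C * hessEnv ξ s) : Integrable fun s => gumbelPDF s * f s := by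
  refine ((integrable_hessEnv hξ).const_mul C).mono' (by fun_prop)
    (Eventually.of_forall fun s => ?_)
  rw [norm_mul, Real.norm_of_nonneg (gumbelPDF_pos s).le, Real.norm_eq_abs]
  calc gumbelPDF s * |f s| ≤ gumbelPDF s * (C * hessEnv ξ s) :=
        mul_le_mul_of_nonneg_left (h s) (gumbelPDF_pos s).le
    _ = _ := by ring

/-- Some power of the weight `affW` larger than two is integrable. -/
lemma exists_integrable_affW_rpow {ξ : ℝ} (hξ : -(1 / 2) < ξ) :
    ∃ q : ℝ, 2 < q ∧ Integrable fun s => gumbelPDF s * affW ξ (gevQuantile ξ s) ^ q := by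
  obtain ⟨ε, hε, h⟩ := exists_pos_two_mul_max_lt hξ
  set a := ε + max (-ξ) 0 with ha
  have ha0 : 0 < a := by have := le_max_right (-ξ) 0; linarith
  have ha2 : a < 1 / 2 := by linarith
  obtain ⟨C, m, hC, hm, hb⟩ := expBounded_affW (ξ := ξ) hε
  set q := 2 / (a + 1 / 2) with hq
  have hq2 : 2 < q := by rw [hq, lt_div_iff₀ (by positivity)]; linarith
  have hqa : a * q < 1 := by
    rw [hq, mul_div_assoc', div_lt_one (by positivity)]; linarith
  refine ⟨q, hq2, ?_⟩
  have hbd : ExpBounded (a * q) fun s => affW ξ (gevQuantile ξ s) ^ q := by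
    refine ⟨C ^ q, m * q, by positivity, by positivity, fun s => ?_⟩
    have h1 := one_le_affW_gevQuantile ξ s
    rw [abs_of_nonneg (by positivity)]
    have h2 := hb s
    rw [abs_of_nonneg (by linarith)] at h2
    calc affW ξ (gevQuantile ξ s) ^ q ≤ (C * expEnv a m s) ^ q := by gcongr
      _ = C ^ q * expEnv a m s ^ q := Real.mul_rpow hC (Real.exp_pos _).le
      _ = _ := by
        congr 1
        rw [expEnv, expEnv, ← Real.exp_mul]; congr 1; ring
  refine hbd.integrable hqa ?_
  have := continuous_affW_gevQuantile ξ
  exact this.rpow_const fun s => Or.inl (by linarith [one_le_affW_gevQuantile ξ s])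

lemma growthBound_le {ξ : ℝ} (hξ : -(1 / 2) < ξ) (s : ℝ) :
    growthBound ξ (gevQuantile ξ s) ≤ 4 * hessEnv ξ s := by
  have h1 := one_le_affW_gevQuantile ξ s
  have h2 := Real.exp_pos (-2 * s)
  have h3 := abs_nonneg s
  have h4 := one_le_hessEnv ξ s
  have h5 : 0 ≤ (1 + Real.exp (-2 * s)) * (1 + |s|) ^ 2 := by positivity
  have h6 : (1 + Real.exp (-2 * s)) * (1 + |s|) ^ 2 ≤ hessEnv ξ s := by
    unfold hessEnv
    have := one_le_pow₀ h1 (n := 2)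
    calc (1 + Real.exp (-2 * s)) * (1 + |s|) ^ 2 =
        (1 + Real.exp (-2 * s)) * 1 * (1 + |s|) ^ 2 := by ring
      _ ≤ _ := by gcongr
  have h7 := abs_gevQuantile_le ξ s
  unfold growthBound
  split_ifs with h
  · linarith
  · have hx : gevQuantile ξ s ^ 2 ≤ 4 * (|s| ^ 2 * (1 + Real.exp (-2 * s))) := by
      rcases le_or_gt (ξ * s) 0 with h8 | h8
      · have h9 : |gevQuantile ξ s| ≤ 2 * |s| := by
          have := Real.exp_le_one_iff.2 h8
          nlinarith
        rw [← sq_abs]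
        calc |gevQuantile ξ s| ^ 2 ≤ (2 * |s|) ^ 2 := by gcongr
          _ ≤ _ := by nlinarith [sq_nonneg |s|]
      · have hs : s < 0 := by
          by_contra hc
          push Not at hc
          have : 0 ≤ gevQuantile ξ s := by
            have := (strictMono_gevQuantile ξ).monotone hc
            simpa using this
          exact h ⟨pos_of_mul_pos_left h8 hc, this⟩
        have h9 : |gevQuantile ξ s| ≤ 2 * |s| * Real.exp (-s) := by
          have e1 : 1 ≤ Real.exp (-s) := Real.one_le_exp (by linarith)
          have e2 : Real.exp (ξ * s) ≤ Real.exp (-s) := Real.exp_le_exp.2 (by nlinarith)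
          nlinarith
        have e3 : Real.exp (-s) ^ 2 = Real.exp (-2 * s) := by
          rw [← Real.exp_nat_mul]; congr 1; push_cast; ring
        rw [← sq_abs]
        calc |gevQuantile ξ s| ^ 2 ≤ (2 * |s| * Real.exp (-s)) ^ 2 := by gcongr
          _ = 4 * (|s| ^ 2 * Real.exp (-2 * s)) := by rw [← e3]; ring
          _ ≤ _ := by gcongr; linarith
    nlinarith

/-! ### Bartlett identities -/

lemma continuous_psi1_gevQuantile (ξ : ℝ) (d : Fin 3 → ℝ) :
    Continuous fun s => psi1 (gevQuantile ξ s) (baseParam ξ) d := by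
  refine continuous_iff_continuousAt.2 fun s => ?_
  exact (continuousAt_psi1 (gevQuantile_mem ξ s) d).comp
    (f := fun s => (gevQuantile ξ s, baseParam ξ)) (by fun_prop)

lemma continuous_psi2_gevQuantile (ξ : ℝ) (d e : Fin 3 → ℝ) :
    Continuous fun s => psi2 (gevQuantile ξ s) (baseParam ξ) d e := by
  refine continuous_iff_continuousAt.2 fun s => ?_
  exact (continuousAt_psi2 (gevQuantile_mem ξ s) d e).comp
    (f := fun s => (gevQuantile ξ s, baseParam ξ)) (by fun_prop)

lemma abs_affA_gevQuantile_le (ξ s : ℝ) (d : Fin 3 → ℝ) :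
    |affA (gevQuantile ξ s) (baseParam ξ) d| ≤
      4 * affW ξ (gevQuantile ξ s) * (1 + |s|) * ‖d‖ := by
  have := abs_affA_le (p := baseParam ξ) (gevQuantile_mem ξ s) (by simp) d
  rwa [affH_gevQuantile] at this

lemma abs_affQ_gevQuantile_le (ξ s : ℝ) (d e : Fin 3 → ℝ) :
    |affQ (gevQuantile ξ s) (baseParam ξ) d e| ≤
      16 * affW ξ (gevQuantile ξ s) ^ 2 * |s| * (‖d‖ * ‖e‖) := by
  have := abs_affQ_le (p := baseParam ξ) (gevQuantile_mem ξ s) (by simp) d e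
  rwa [affH_gevQuantile] at this

lemma abs_psi1_gevQuantile_le (ξ s : ℝ) (d : Fin 3 → ℝ) :
    |psi1 (gevQuantile ξ s) (baseParam ξ) d| ≤
      14 * ((1 + Real.exp (-2 * s)) * affW ξ (gevQuantile ξ s) * (1 + |s|)) * ‖d‖ := by
  have := abs_psi1_le (p := baseParam ξ) (gevQuantile_mem ξ s) (by simp) d
  rwa [affH_gevQuantile] at this

lemma abs_psi2_gevQuantile_le {ξ s : ℝ} {p : Fin 3 → ℝ}
    (hp : ‖p - baseParam ξ‖ * (2 * affW ξ (gevQuantile ξ s)) ≤ 1) (d e : Fin 3 → ℝ) :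
    |psi2 (gevQuantile ξ s) p d e| ≤ 84 * hessEnv ξ s * (‖d‖ * ‖e‖) := by
  have := abs_psi2_le (gevQuantile_mem ξ s) hp d e
  rwa [affH_gevQuantile] at this

lemma hasDerivAt_affA_gevQuantile (ξ s : ℝ) (d : Fin 3 → ℝ) :
    HasDerivAt (fun s => affA (gevQuantile ξ s) (baseParam ξ) d)
      (-(affV d (gevQuantile ξ s) / affV (baseParam ξ) (gevQuantile ξ s))) s := by
  have h1 := hasDerivAt_affInt 2 (continuous_affV d) (gevQuantile_mem ξ s)
  have h2 := (h1.comp s (hasDerivAt_gevQuantile ξ s)).const_sub (d 1)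
  refine h2.congr_deriv ?_
  rw [← affV_gevQuantile]
  have := (gevQuantile_mem ξ s).2
  field_simp

lemma hasDerivAt_affQ_gevQuantile (ξ s : ℝ) (d e : Fin 3 → ℝ) :
    HasDerivAt (fun s => affQ (gevQuantile ξ s) (baseParam ξ) d e)
      (2 * (affV d (gevQuantile ξ s) * affV e (gevQuantile ξ s) /
        affV (baseParam ξ) (gevQuantile ξ s) ^ 2)) s := by
  have h1 := hasDerivAt_affInt 3 (w := fun u => affV d u * affV e u) (by fun_prop)
    (gevQuantile_mem ξ s)
  have h2 := (h1.comp s (hasDerivAt_gevQuantile ξ s)).const_mul 2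
  refine h2.congr_deriv ?_
  rw [← affV_gevQuantile]
  have := (gevQuantile_mem ξ s).2
  field_simp

lemma hasDerivAt_exp_neg (s : ℝ) : HasDerivAt (fun s : ℝ => Real.exp (-s)) (-Real.exp (-s)) s := by
  simpa using (hasDerivAt_neg s).exp

lemma hasDerivAt_gumbelPDF (s : ℝ) :
    HasDerivAt gumbelPDF (-(1 - Real.exp (-s)) * gumbelPDF s) s := by
  have h := ((hasDerivAt_neg s).sub (hasDerivAt_exp_neg s)).exp
  refine h.congr_deriv ?_
  simp only [gumbelPDF, Pi.sub_apply]; ring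

/-- With `g` the Gumbel density and `A = affA`, the function `g A` is a primitive of `g psi1`. This
gives the first Bartlett identity. -/
lemma hasDerivAt_gumbelPDF_mul_affA (ξ s : ℝ) (d : Fin 3 → ℝ) :
    HasDerivAt (fun s => gumbelPDF s * affA (gevQuantile ξ s) (baseParam ξ) d)
      (gumbelPDF s * psi1 (gevQuantile ξ s) (baseParam ξ) d) s := by
  refine ((hasDerivAt_gumbelPDF s).mul (hasDerivAt_affA_gevQuantile ξ s d)).congr_deriv ?_
  rw [psi1, affT_gevQuantile]; ring

/-- With `g` the Gumbel density, a primitive of `g (psi2 + psi1 psi1)`. -/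
lemma hasDerivAt_bartlett (ξ s : ℝ) (d e : Fin 3 → ℝ) :
    HasDerivAt (fun s => gumbelPDF s * (affQ (gevQuantile ξ s) (baseParam ξ) d e -
        (1 - Real.exp (-s)) * (affA (gevQuantile ξ s) (baseParam ξ) d *
          affA (gevQuantile ξ s) (baseParam ξ) e)))
      (gumbelPDF s * (psi2 (gevQuantile ξ s) (baseParam ξ) d e +
        psi1 (gevQuantile ξ s) (baseParam ξ) d * psi1 (gevQuantile ξ s) (baseParam ξ) e)) s := by
  have hd := hasDerivAt_affA_gevQuantile ξ s d
  have he := hasDerivAt_affA_gevQuantile ξ s e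
  refine ((hasDerivAt_gumbelPDF s).mul ((hasDerivAt_affQ_gevQuantile ξ s d e).sub
    (((hasDerivAt_exp_neg s).const_sub 1).mul (hd.mul he)))).congr_deriv ?_
  have := (gevQuantile_mem ξ s).2
  simp only [psi1, psi2, affT_gevQuantile, Pi.mul_apply, Pi.sub_apply]
  field_simp
  ring

lemma continuous_affA_gevQuantile (ξ : ℝ) (d : Fin 3 → ℝ) :
    Continuous fun s => affA (gevQuantile ξ s) (baseParam ξ) d :=
  continuous_iff_continuousAt.2 fun s => (hasDerivAt_affA_gevQuantile ξ s d).continuousAt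

lemma continuous_affQ_gevQuantile (ξ : ℝ) (d e : Fin 3 → ℝ) :
    Continuous fun s => affQ (gevQuantile ξ s) (baseParam ξ) d e :=
  continuous_iff_continuousAt.2 fun s => (hasDerivAt_affQ_gevQuantile ξ s d e).continuousAt

section

variable {ξ : ℝ}

/-- A factor `1 + exp (-2 s)` does not spoil integrability, as the Gumbel density decays doubly
exponentially at `-∞`. -/
lemma integrable_gumbelPDF_mul_of_le (hξ : -(1 / 2) < ξ) {f : ℝ → ℝ} (hf : Continuous f) {C : ℝ}
    (h : ∀ s, |f s| ≤ C * ((1 + Real.exp (-2 * s)) * hessEnv ξ s)) :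
    Integrable fun s => gumbelPDF s * f s := by
  obtain ⟨ε, hε, hlt⟩ := exists_pos_two_mul_max_lt hξ
  have h1 : ExpBounded 0 fun s => 1 + Real.exp (-2 * s) :=
    (expBounded_const le_rfl 1).add ((expBounded_exp (-2)).of_le (b := 0) (by norm_num)
      fun _ => le_rfl)
  have h2 := (expBounded_const le_rfl C).mul (h1.mul (expBounded_hessEnv (ξ := ξ) hε))
  refine (h2.of_le (by linarith : _ ≤ 2 * max (-ξ) 0 + 4 * ε) fun s => ?_).integrable hlt hf
  exact (h s).trans (le_abs_self _)

lemma integrable_psi1_mul_psi1 (hξ : -(1 / 2) < ξ) (d e : Fin 3 → ℝ) :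
    Integrable fun s => gumbelPDF s * (psi1 (gevQuantile ξ s) (baseParam ξ) d *
      psi1 (gevQuantile ξ s) (baseParam ξ) e) := by
  refine integrable_gumbelPDF_mul_of_le hξ (C := 196 * (‖d‖ * ‖e‖))
    ((continuous_psi1_gevQuantile ξ d).mul (continuous_psi1_gevQuantile ξ e)) fun s => ?_
  rw [abs_mul]
  have h1 := one_le_affW_gevQuantile ξ s
  calc _ ≤ _ := mul_le_mul (abs_psi1_gevQuantile_le ξ s d) (abs_psi1_gevQuantile_le ξ s e)
        (abs_nonneg _) (by positivity)
    _ = _ := by unfold hessEnv; ring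

lemma integrable_psi1 (hξ : -(1 / 2) < ξ) (d : Fin 3 → ℝ) :
    Integrable fun s => gumbelPDF s * psi1 (gevQuantile ξ s) (baseParam ξ) d := by
  refine integrable_of_abs_le_hessEnv hξ (C := 14 * ‖d‖) (continuous_psi1_gevQuantile ξ d)
    fun s => ?_
  refine (abs_psi1_gevQuantile_le ξ s d).trans ?_
  have h1 := one_le_affW_gevQuantile ξ s
  have h2 : affW ξ (gevQuantile ξ s) ≤ affW ξ (gevQuantile ξ s) ^ 2 := le_self_pow₀ h1 two_ne_zero
  have h3 : 1 + |s| ≤ (1 + |s|) ^ 2 := le_self_pow₀ (by linarith [abs_nonneg s]) two_ne_zero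
  calc _ ≤ 14 * ((1 + Real.exp (-2 * s)) * affW ξ (gevQuantile ξ s) ^ 2 * (1 + |s|) ^ 2) * ‖d‖ := by
        gcongr
    _ = _ := by unfold hessEnv; ring

lemma integrable_psi2 (hξ : -(1 / 2) < ξ) (d e : Fin 3 → ℝ) :
    Integrable fun s => gumbelPDF s * psi2 (gevQuantile ξ s) (baseParam ξ) d e := by
  refine integrable_of_abs_le_hessEnv hξ (C := 84 * (‖d‖ * ‖e‖))
    (continuous_psi2_gevQuantile ξ d e) fun s => ?_
  exact (abs_psi2_gevQuantile_le (by simp) d e).trans_eq (by ring)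

lemma integrable_affA (hξ : -(1 / 2) < ξ) (d : Fin 3 → ℝ) :
    Integrable fun s => gumbelPDF s * affA (gevQuantile ξ s) (baseParam ξ) d := by
  refine integrable_of_abs_le_hessEnv hξ (C := 4 * ‖d‖) (continuous_affA_gevQuantile ξ d)
    fun s => ?_
  refine (abs_affA_gevQuantile_le ξ s d).trans ?_
  have h1 := one_le_affW_gevQuantile ξ s
  have h2 : affW ξ (gevQuantile ξ s) ≤ affW ξ (gevQuantile ξ s) ^ 2 := le_self_pow₀ h1 two_ne_zero
  have h3 : 1 + |s| ≤ (1 + |s|) ^ 2 := le_self_pow₀ (by linarith [abs_nonneg s]) two_ne_zero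
  have h4 : 1 ≤ 1 + Real.exp (-2 * s) := by linarith [Real.exp_pos (-2 * s)]
  calc _ = 4 * (1 * affW ξ (gevQuantile ξ s) * (1 + |s|)) * ‖d‖ := by ring
    _ ≤ 4 * ((1 + Real.exp (-2 * s)) * affW ξ (gevQuantile ξ s) ^ 2 * (1 + |s|) ^ 2) * ‖d‖ := by
        gcongr
    _ = _ := by unfold hessEnv; ring

/-- The first Bartlett identity. -/
lemma integral_psi1_eq_zero (hξ : -(1 / 2) < ξ) (d : Fin 3 → ℝ) :
    ∫ s, gumbelPDF s * psi1 (gevQuantile ξ s) (baseParam ξ) d = 0 :=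
  integral_eq_zero_of_hasDerivAt_of_integrable (fun s => hasDerivAt_gumbelPDF_mul_affA ξ s d)
    (integrable_psi1 hξ d) (integrable_affA hξ d)

/-- The second Bartlett identity. -/
lemma integral_psi2 (hξ : -(1 / 2) < ξ) (d e : Fin 3 → ℝ) :
    ∫ s, gumbelPDF s * psi2 (gevQuantile ξ s) (baseParam ξ) d e =
      -∫ s, gumbelPDF s * (psi1 (gevQuantile ξ s) (baseParam ξ) d *
        psi1 (gevQuantile ξ s) (baseParam ξ) e) := by
  have i1 := integrable_psi2 hξ d e
  have i2 := integrable_psi1_mul_psi1 hξ d e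
  have i3 := i1.add i2
  have i4 : Integrable fun s => gumbelPDF s * (affQ (gevQuantile ξ s) (baseParam ξ) d e -
        (1 - Real.exp (-s)) * (affA (gevQuantile ξ s) (baseParam ξ) d *
          affA (gevQuantile ξ s) (baseParam ξ) e)) := by
    have cA := continuous_affA_gevQuantile ξ d
    have cA' := continuous_affA_gevQuantile ξ e
    have cQ := continuous_affQ_gevQuantile ξ d e
    refine integrable_gumbelPDF_mul_of_le hξ (C := 48 * (‖d‖ * ‖e‖)) (by fun_prop) fun s => ?_
    have h1 := one_le_affW_gevQuantile ξ s
    have hq := abs_affQ_gevQuantile_le ξ s d e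
    have hd := abs_affA_gevQuantile_le ξ s d
    have he := abs_affA_gevQuantile_le ξ s e
    set E := Real.exp (-2 * s) with hE
    have hE0 : 0 < E := Real.exp_pos _
    have hT : |1 - Real.exp (-s)| ≤ 2 * (1 + E) := by
      have e0 := Real.exp_pos (-s)
      have e1 : Real.exp (-s) ^ 2 = E := by
        rw [hE, ← Real.exp_nat_mul]; congr 1; push_cast; ring
      rw [abs_le]; constructor <;> nlinarith [sq_nonneg (Real.exp (-s) - 1)]
    set W := affW ξ (gevQuantile ξ s) with hW
    have a0 := abs_nonneg s
    have t1 : 16 * W ^ 2 * |s| * (‖d‖ * ‖e‖) ≤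
        16 * (‖d‖ * ‖e‖) * ((1 + E) * ((1 + E) * W ^ 2 * (1 + |s|) ^ 2)) := by
      have h5 : |s| ≤ (1 + |s|) ^ 2 := by nlinarith
      have h6 : 1 ≤ (1 + E) * (1 + E) := by nlinarith
      calc _ = 16 * (‖d‖ * ‖e‖) * (1 * W ^ 2 * |s|) := by ring
        _ ≤ 16 * (‖d‖ * ‖e‖) * (((1 + E) * (1 + E)) * W ^ 2 * (1 + |s|) ^ 2) := by gcongr
        _ = _ := by ring
    calc _ ≤ |affQ (gevQuantile ξ s) (baseParam ξ) d e| + |1 - Real.exp (-s)| *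
          (|affA (gevQuantile ξ s) (baseParam ξ) d| *
            |affA (gevQuantile ξ s) (baseParam ξ) e|) := by
          rw [← abs_mul, ← abs_mul]; exact abs_sub _ _
      _ ≤ 16 * W ^ 2 * |s| * (‖d‖ * ‖e‖) + 2 * (1 + E) *
          ((4 * W * (1 + |s|) * ‖d‖) * (4 * W * (1 + |s|) * ‖e‖)) := by gcongr
      _ ≤ 16 * (‖d‖ * ‖e‖) * ((1 + E) * ((1 + E) * W ^ 2 * (1 + |s|) ^ 2)) +
          32 * (‖d‖ * ‖e‖) * ((1 + E) * ((1 + E) * W ^ 2 * (1 + |s|) ^ 2)) := by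
          refine add_le_add t1 ?_
          have h6 : 1 + E ≤ (1 + E) * (1 + E) := by nlinarith
          calc _ = 32 * (‖d‖ * ‖e‖) * ((1 + E) * W ^ 2 * (1 + |s|) ^ 2) := by ring
            _ ≤ 32 * (‖d‖ * ‖e‖) * (((1 + E) * (1 + E)) * W ^ 2 * (1 + |s|) ^ 2) := by gcongr
            _ = _ := by ring
      _ = _ := by unfold hessEnv; ring
  have i5 : Integrable fun s => gumbelPDF s * (psi2 (gevQuantile ξ s) (baseParam ξ) d e +
        psi1 (gevQuantile ξ s) (baseParam ξ) d * psi1 (gevQuantile ξ s) (baseParam ξ) e) :=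
    i3.congr (Eventually.of_forall fun s => by simp only [Pi.add_apply]; ring)
  have key := integral_eq_zero_of_hasDerivAt_of_integrable
    (fun s => hasDerivAt_bartlett ξ s d e) i5 i4
  have hs := integral_add i1 i2
  have : ∫ s, (gumbelPDF s * psi2 (gevQuantile ξ s) (baseParam ξ) d e +
      gumbelPDF s * (psi1 (gevQuantile ξ s) (baseParam ξ) d *
        psi1 (gevQuantile ξ s) (baseParam ξ) e)) = 0 := by
    rw [← key]; congr 1; ext s; ring
  linarith

/-- The score in a nonzero direction `d` is not almost surely zero: otherwise the integrable
function `g A` would be constant, hence zero, and then `affV d` and `d` would vanish. -/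
lemma integral_psi1_sq_pos (hξ : -(1 / 2) < ξ) {d : Fin 3 → ℝ} (hd : d ≠ 0) :
    0 < ∫ s, gumbelPDF s * (psi1 (gevQuantile ξ s) (baseParam ξ) d *
      psi1 (gevQuantile ξ s) (baseParam ξ) d) := by
  have hnn : ∀ s, 0 ≤ gumbelPDF s * (psi1 (gevQuantile ξ s) (baseParam ξ) d *
      psi1 (gevQuantile ξ s) (baseParam ξ) d) := fun s =>
    mul_nonneg (gumbelPDF_pos s).le (mul_self_nonneg _)
  refine lt_of_le_of_ne (integral_nonneg hnn) fun h0 => hd ?_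
  have hc : Continuous fun s => gumbelPDF s * (psi1 (gevQuantile ξ s) (baseParam ξ) d *
      psi1 (gevQuantile ξ s) (baseParam ξ) d) := by
    have := continuous_psi1_gevQuantile ξ d
    fun_prop
  have hz := (integral_eq_zero_iff_of_nonneg hnn (integrable_psi1_mul_psi1 hξ d d)).1 h0.symm
  have hz' := Continuous.ae_eq_iff_eq volume hc continuous_zero |>.1 hz
  have hpsi : ∀ s, psi1 (gevQuantile ξ s) (baseParam ξ) d = 0 := by
    intro s
    have := congrFun hz' s
    simpa [(gumbelPDF_pos s).ne'] using this
  have hder : ∀ s,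
      HasDerivAt (fun s => gumbelPDF s * affA (gevQuantile ξ s) (baseParam ξ) d) 0 s := by
    intro s
    have := hasDerivAt_gumbelPDF_mul_affA ξ s d
    rwa [hpsi, mul_zero] at this
  have hconst := fun s => is_const_of_deriv_eq_zero (fun s => (hder s).differentiableAt)
    (fun s => (hder s).deriv) s 0
  have hint := integrable_affA hξ d
  -- a constant that is integrable on the line is zero
  have hA0 : gumbelPDF 0 * affA (gevQuantile ξ 0) (baseParam ξ) d = 0 := by
    have : (fun s => gumbelPDF s * affA (gevQuantile ξ s) (baseParam ξ) d) =
      fun _ => gumbelPDF 0 * affA (gevQuantile ξ 0) (baseParam ξ) d := funext hconst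
    rw [this, integrable_const_iff] at hint
    rcases hint with h | h
    · exact h
    · exact absurd h.measure_univ_lt_top (by simp)
  have hA : (fun s => affA (gevQuantile ξ s) (baseParam ξ) d) = fun _ => 0 := by
    ext s
    have := hconst s
    rw [hA0] at this
    exact (mul_eq_zero.1 this).resolve_left (gumbelPDF_pos s).ne'
  have hf : ∀ s, affV d (gevQuantile ξ s) = 0 := by
    intro s
    have h1 := hasDerivAt_affA_gevQuantile ξ s d
    rw [hA] at h1
    have h2 := h1.unique (hasDerivAt_const s 0)
    rw [neg_eq_zero, div_eq_zero_iff] at h2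
    exact h2.resolve_right (gevQuantile_mem ξ s).2.ne'
  have d0 : d 0 = 0 := by simpa [affV] using hf 0
  have d2 : d 2 = 0 := by
    have h1 := hf 1
    have h2 : gevQuantile ξ 0 < gevQuantile ξ 1 := strictMono_gevQuantile ξ zero_lt_one
    rw [gevQuantile_zero_right] at h2
    simpa [affV, d0, h2.ne'] using h1
  have d1 : d 1 = 0 := by
    have := congrFun hA 0
    simpa [affA, affInt] using this
  ext j
  fin_cases j <;> simp [d0, d1, d2]

end

/-! ### Almost sure growth of sums of independent variables -/

/-- Summation by parts. -/
lemma sum_range_mul_sub_eq (b M : ℕ → ℝ) (hM : M 0 = 0) (n : ℕ) :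
    ∑ i ∈ Finset.range n, b (i + 1) * (M (i + 1) - M i) =
      b n * M n - ∑ i ∈ Finset.range n, (b (i + 1) - b i) * M i := by
  induction n with
  | zero => simp [hM]
  | succ n ih => rw [Finset.sum_range_succ, Finset.sum_range_succ, ih]; ring

/-- If the partial sums of `∑ xᵢ / bᵢ` are bounded then those of `∑ xᵢ` are `O(bₙ)`. -/
lemma abs_sum_le_of_abs_weighted_sum_le {x b : ℕ → ℝ} (hb : Monotone b) (hb0 : 0 ≤ b 0)
    (hpos : ∀ n, 0 < b (n + 1)) {B : ℝ}
    (h : ∀ n, |∑ i ∈ Finset.range n, x i / b (i + 1)| ≤ B) (n : ℕ) :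
    |∑ i ∈ Finset.range n, x i| ≤ 2 * B * b n := by
  set M : ℕ → ℝ := fun n => ∑ i ∈ Finset.range n, x i / b (i + 1) with hM
  have hx : ∀ i, x i = b (i + 1) * (M (i + 1) - M i) := by
    intro i
    have := (hpos i).ne'
    simp only [hM, Finset.sum_range_succ]
    field_simp
    ring
  have hB : 0 ≤ B := (abs_nonneg _).trans (h 0)
  have hbn : ∀ n, 0 ≤ b n := fun n => hb0.trans (hb (Nat.zero_le n))
  rw [Finset.sum_congr rfl fun i _ => hx i, sum_range_mul_sub_eq b M (by simp [hM])]
  have h1 : |b n * M n| ≤ b n * B := by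
    rw [abs_mul, abs_of_nonneg (hbn n)]; exact mul_le_mul_of_nonneg_left (h n) (hbn n)
  have h2 : |∑ i ∈ Finset.range n, (b (i + 1) - b i) * M i| ≤ b n * B := by
    calc _ ≤ ∑ i ∈ Finset.range n, |(b (i + 1) - b i) * M i| := Finset.abs_sum_le_sum_abs _ _
      _ ≤ ∑ i ∈ Finset.range n, (b (i + 1) - b i) * B := by
        refine Finset.sum_le_sum fun i _ => ?_
        have : 0 ≤ b (i + 1) - b i := sub_nonneg.2 (hb (Nat.le_succ i))
        rw [abs_mul, abs_of_nonneg this]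
        exact mul_le_mul_of_nonneg_left (h i) this
      _ = (b n - b 0) * B := by rw [← Finset.sum_mul, Finset.sum_range_sub]
      _ ≤ _ := by nlinarith
  have := abs_sub (b n * M n) (∑ i ∈ Finset.range n, (b (i + 1) - b i) * M i)
  linarith

/-- Sums of independent centred variables with bounded variances are `O(n ^ β)` almost surely
for each `β > 1/2`, by convergence of the `L²`-bounded martingale `∑ Xᵢ / (i + 1) ^ β`. -/
lemma ae_exists_abs_sum_le {Ω : Type*} [MeasurableSpace Ω] {P : Measure Ω}
    [IsProbabilityMeasure P] {X : ℕ → Ω → ℝ} (hm : ∀ i, Measurable (X i)) (hind : iIndepFun X P)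
    (h2 : ∀ i, MemLp (X i) 2 P) (h0 : ∀ i, P[X i] = 0) {V : ℝ} (hV : ∀ i, Var[X i; P] ≤ V)
    {β : ℝ} (hβ : 1 / 2 < β) :
    ∀ᵐ ω ∂P, ∃ C, ∀ n : ℕ, |∑ i ∈ Finset.range n, X i ω| ≤ C * (n : ℝ) ^ β := by
  set c : ℕ → ℝ := fun i => ((i + 1 : ℕ) : ℝ) ^ β with hc
  have hcpos : ∀ i, 0 < c i := fun i => by positivity
  set Z : ℕ → Ω → ℝ := fun i ω => X i ω / c i with hZ
  have hZ2 : ∀ i, MemLp (Z i) 2 P := fun i => by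
    have := (h2 i).const_mul (c i)⁻¹
    refine this.ae_eq (Eventually.of_forall fun ω => ?_)
    simp only [hZ]; rw [div_eq_inv_mul]
  have hZ1 : ∀ i, Integrable (Z i) P := fun i => (hZ2 i).integrable one_le_two
  have hZ0 : ∀ i, P[Z i] = 0 := fun i => by
    simp only [hZ, integral_div, h0, zero_div]
  set f : ℕ → Ω → ℝ := fun n ω => ∑ i ∈ Finset.range (n + 1), Z i ω with hf
  set ℱ := Filtration.natural X fun i => (hm i).stronglyMeasurable with hℱ
  have hadX : ∀ i n, i ≤ n → StronglyMeasurable[ℱ n] (X i) := fun i n hin =>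
    (Filtration.stronglyAdapted_natural (fun i => (hm i).stronglyMeasurable) i).mono (ℱ.mono hin)
  have hfint : ∀ n, Integrable (f n) P := fun n => integrable_finsetSum _ fun i _ => hZ1 i
  have hmart : Martingale f ℱ P := by
    refine martingale_of_condExp_sub_eq_zero_nat ?_ hfint ?_
    · intro n
      refine Finset.stronglyMeasurable_fun_sum _ fun i hi => ?_
      have := (hadX i n (Nat.lt_succ_iff.1 (Finset.mem_range.1 hi))).measurable.div_const (c i)
      exact this.stronglyMeasurable
    · intro n
      have e1 : f (n + 1) - f n = (c (n + 1))⁻¹ • X (n + 1) := by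
        ext ω
        simp only [hf, Pi.sub_apply, Pi.smul_apply, smul_eq_mul]
        rw [Finset.sum_range_succ _ (n + 1), add_sub_cancel_left]
        simp only [hZ]
        rw [div_eq_inv_mul]
      rw [e1]
      have e2 := hind.condExp_natural_ae_eq_of_lt (fun i => (hm i).stronglyMeasurable)
        (Nat.lt_succ_self n)
      filter_upwards [condExp_smul (c (n + 1))⁻¹ (X (n + 1)) (m := ℱ n) (μ := P), e2] with ω h3 h4
      rw [h3, Pi.smul_apply, h4, h0, smul_zero]; rfl
  have hsum : Summable fun i : ℕ => V * (c i ^ 2)⁻¹ := by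
    have h3 : Summable fun i : ℕ => ((i + 1 : ℕ) : ℝ) ^ (-(2 * β)) :=
      (summable_nat_add_iff 1).2 (Real.summable_nat_rpow.2 (by linarith))
    refine (h3.mul_left V).congr fun i => ?_
    congr 1
    rw [hc, ← Real.rpow_natCast, ← Real.rpow_mul (by positivity), ← Real.rpow_neg (by positivity)]
    congr 1; push_cast; ring
  set K := ∑' i : ℕ, V * (c i ^ 2)⁻¹ with hK
  have hV0 : 0 ≤ V := (variance_nonneg _ _).trans (hV 0)
  have hvar : ∀ n, ∫ ω, f n ω ^ 2 ∂P ≤ K := by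
    intro n
    have hf0 : P[f n] = 0 := by
      simp only [hf]
      rw [integral_finsetSum _ fun i _ => hZ1 i]
      exact Finset.sum_eq_zero fun i _ => hZ0 i
    have e3 := variance_of_integral_eq_zero (hfint n).aemeasurable hf0
    have e4 : Var[f n; P] = ∑ i ∈ Finset.range (n + 1), Var[Z i; P] := by
      have : f n = ∑ i ∈ Finset.range (n + 1), Z i := by ext ω; simp [hf]
      rw [this]
      refine IndepFun.variance_sum (fun i _ => hZ2 i) fun i _ j _ hij => ?_
      exact (hind.indepFun hij).comp (φ := fun x => x / c i) (ψ := fun x => x / c j)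
        (by fun_prop) (by fun_prop)
    rw [← e3, e4]
    refine (Finset.sum_le_sum fun i _ => ?_).trans (hsum.sum_le_tsum (Finset.range (n + 1))
      fun i _ => by positivity)
    have : Z i = fun ω => (c i)⁻¹ * X i ω := by ext ω; simp only [hZ]; rw [div_eq_inv_mul]
    rw [this, variance_const_mul, inv_pow, mul_comm]
    have := hV i
    gcongr
  have hbdd : ∀ n, eLpNorm (f n) 1 P ≤ ((1 + K).toNNReal : ENNReal) := by
    intro n
    rw [eLpNorm_one_eq_lintegral_enorm, ← ofReal_integral_norm_eq_lintegral_enorm (hfint n)]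
    refine ENNReal.ofReal_le_ofReal ?_
    have hi2 : Integrable (fun ω => f n ω ^ 2) P :=
      (memLp_finsetSum _ fun i _ => hZ2 i).integrable_sq
    calc ∫ ω, ‖f n ω‖ ∂P ≤ ∫ ω, (1 + f n ω ^ 2) ∂P := by
          refine integral_mono (hfint n).norm ((integrable_const 1).add hi2) fun ω => ?_
          simp only [Real.norm_eq_abs]
          nlinarith [sq_nonneg (|f n ω| - 1), sq_abs (f n ω), abs_nonneg (f n ω)]
      _ = 1 + ∫ ω, f n ω ^ 2 ∂P := by
          rw [integral_add (integrable_const 1) hi2]; simp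
      _ ≤ 1 + K := by linarith [hvar n]
  filter_upwards [hmart.submartingale.exists_ae_tendsto_of_bdd hbdd] with ω hω
  obtain ⟨l, hl⟩ := hω
  obtain ⟨B, hB⟩ := hl.norm.bddAbove_range
  refine ⟨2 * max B 0, fun n => ?_⟩
  refine abs_sum_le_of_abs_weighted_sum_le (x := fun i => X i ω) (b := fun n : ℕ => (n : ℝ) ^ β)
    (B := max B 0) ?_ (by positivity) (fun n => by positivity) ?_ n
  · intro i j hij
    have : (0 : ℝ) ≤ β := by linarith
    simp only
    gcongr
  · intro n
    rcases n with _ | n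
    · simp
    · exact (hB ⟨n, rfl⟩).trans (le_max_left _ _)

/-! ### Samples from the Gumbel distribution -/

/-- The standard Gumbel distribution. -/
def gumbelMeasure : Measure ℝ := volume.withDensity fun s => ENNReal.ofReal (gumbelPDF s)

lemma integrable_gumbelMeasure {f : ℝ → ℝ} :
    Integrable f gumbelMeasure ↔ Integrable fun s => gumbelPDF s * f s := by
  rw [gumbelMeasure, integrable_withDensity_iff_integrable_smul' (by fun_prop)
    (Eventually.of_forall fun _ => ENNReal.ofReal_lt_top)]
  simp only [ENNReal.toReal_ofReal (gumbelPDF_pos _).le, smul_eq_mul]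

lemma integral_gumbelMeasure (f : ℝ → ℝ) :
    ∫ s, f s ∂gumbelMeasure = ∫ s, gumbelPDF s * f s := by
  rw [gumbelMeasure, integral_withDensity_eq_integral_toReal_smul (by fun_prop)
    (Eventually.of_forall fun _ => ENNReal.ofReal_lt_top)]
  simp only [ENNReal.toReal_ofReal (gumbelPDF_pos _).le, smul_eq_mul]

section

variable {Ω : Type*} [MeasurableSpace Ω] {P : Measure Ω} {U : ℕ → Ω → ℝ}

lemma integrable_comp_gumbel (hlaw : ∀ i, HasLaw (U i) gumbelMeasure P) {f : ℝ → ℝ}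
    (hf : Measurable f) (hi : Integrable fun s => gumbelPDF s * f s) (i : ℕ) :
    Integrable (fun ω => f (U i ω)) P := by
  have h := integrable_gumbelMeasure.2 hi
  rw [← (hlaw i).map_eq] at h
  exact (integrable_map_measure hf.aestronglyMeasurable (hlaw i).aemeasurable).1 h

lemma integral_comp_gumbel (hlaw : ∀ i, HasLaw (U i) gumbelMeasure P) {f : ℝ → ℝ}
    (hf : Measurable f) (i : ℕ) : ∫ ω, f (U i ω) ∂P = ∫ s, gumbelPDF s * f s := by
  rw [← integral_gumbelMeasure, ← (hlaw i).map_eq,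
    integral_map (hlaw i).aemeasurable hf.aestronglyMeasurable]

/-- The strong law of large numbers for functions of a Gumbel sample. -/
lemma strong_law_gumbel (hind : iIndepFun U P) (hlaw : ∀ i, HasLaw (U i) gumbelMeasure P)
    {f : ℝ → ℝ} (hf : Measurable f) (hi : Integrable fun s => gumbelPDF s * f s) :
    ∀ᵐ ω ∂P, Tendsto (fun n : ℕ => (n : ℝ)⁻¹ * ∑ i ∈ Finset.range n, f (U i ω)) atTop
      (𝓝 (∫ s, gumbelPDF s * f s)) := by
  have h := strong_law_ae (μ := P) (fun i ω => f (U i ω)) (integrable_comp_gumbel hlaw hf hi 0)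
    (fun i j hij => (hind.indepFun hij).comp hf hf)
    (fun i => ((hlaw i).identDistrib (hlaw 0)).comp hf)
  rw [integral_comp_gumbel hlaw hf 0] at h
  exact h

lemma ae_exists_abs_sum_gumbel_le [IsProbabilityMeasure P] (hind : iIndepFun U P)
    (hm : ∀ i, Measurable (U i)) (hlaw : ∀ i, HasLaw (U i) gumbelMeasure P)
    {f : ℝ → ℝ} (hf : Measurable f)
    (hi2 : Integrable fun s => gumbelPDF s * (f s * f s)) (h0 : ∫ s, gumbelPDF s * f s = 0)
    {β : ℝ} (hβ : 1 / 2 < β) :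
    ∀ᵐ ω ∂P, ∃ C, ∀ n : ℕ, |∑ i ∈ Finset.range n, f (U i ω)| ≤ C * (n : ℝ) ^ β := by
  have hmean : ∀ i, ∫ ω, f (U i ω) ∂P = 0 := fun i => by rw [integral_comp_gumbel hlaw hf, h0]
  refine ae_exists_abs_sum_le (X := fun i ω => f (U i ω)) (fun i => hf.comp (hm i))
    (hind.comp (fun _ => f) fun _ => hf) (fun i => ?_) hmean
    (V := ∫ s, gumbelPDF s * (f s * f s)) (fun i => ?_) hβ
  · have hfm : Measurable fun ω => f (U i ω) := hf.comp (hm i)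
    rw [memLp_two_iff_integrable_sq hfm.aestronglyMeasurable]
    have := integrable_comp_gumbel hlaw (f := fun s => f s * f s) (hf.mul hf) hi2 i
    simpa only [sq] using this
  · have hfm : Measurable fun ω => f (U i ω) := hf.comp (hm i)
    rw [variance_of_integral_eq_zero hfm.aemeasurable (hmean i),
      ← integral_comp_gumbel hlaw (f := fun s => f s * f s) (hf.mul hf) i]
    simp only [sq, le_refl]

end

/-! ### Consistent roots of the likelihood equations -/

/-- The Fisher information at the base parameter, as an integral over the Gumbel coordinate. -/
def baseFisher (ξ : ℝ) (j k : Fin 3) : ℝ :=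
  ∫ s, gumbelPDF s * (psi1 (gevQuantile ξ s) (baseParam ξ) (Pi.single j 1) *
    psi1 (gevQuantile ξ s) (baseParam ξ) (Pi.single k 1))

lemma sum_mul_baseFisher {ξ : ℝ} (hξ : -(1 / 2) < ξ) (d e : Fin 3 → ℝ) :
    ∑ j, ∑ k, d j * e k * baseFisher ξ j k =
      ∫ s, gumbelPDF s * (psi1 (gevQuantile ξ s) (baseParam ξ) d *
        psi1 (gevQuantile ξ s) (baseParam ξ) e) := by
  have h : ∀ s, gumbelPDF s * (psi1 (gevQuantile ξ s) (baseParam ξ) d *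
        psi1 (gevQuantile ξ s) (baseParam ξ) e) = ∑ j, ∑ k, d j * e k *
      (gumbelPDF s * (psi1 (gevQuantile ξ s) (baseParam ξ) (Pi.single j 1) *
    psi1 (gevQuantile ξ s) (baseParam ξ) (Pi.single k 1))) := by
    intro s
    rw [psi1_eq_sum (gevQuantile_mem ξ s) d, psi1_eq_sum (gevQuantile_mem ξ s) e,
      Finset.sum_mul_sum, Finset.mul_sum]
    refine Finset.sum_congr rfl fun j _ => ?_
    rw [Finset.mul_sum]
    exact Finset.sum_congr rfl fun k _ => by ring
  simp only [h]
  rw [integral_finsetSum _ fun j _ => integrable_finsetSum _ fun k _ =>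
    (integrable_psi1_mul_psi1 hξ _ _).const_mul _]
  refine Finset.sum_congr rfl fun j _ => ?_
  rw [integral_finsetSum _ fun k _ => (integrable_psi1_mul_psi1 hξ _ _).const_mul _]
  exact Finset.sum_congr rfl fun k _ => (integral_const_mul _ _).symm

/-- The Fisher information is bounded below by a positive multiple of the identity. -/
lemma exists_le_sum_mul_baseFisher {ξ : ℝ} (hξ : -(1 / 2) < ξ) :
    ∃ c > 0, ∀ d : Fin 3 → ℝ, c * ‖d‖ ^ 2 ≤ ∑ j, ∑ k, d j * d k * baseFisher ξ j k := by
  set Q : (Fin 3 → ℝ) → ℝ := fun d => ∑ j, ∑ k, d j * d k * baseFisher ξ j k with hQ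
  have hc : Continuous Q := by fun_prop
  have hpos : ∀ d, d ≠ 0 → 0 < Q d := fun d hd => by
    simp only [hQ]; rw [sum_mul_baseFisher hξ]; exact integral_psi1_sq_pos hξ hd
  obtain ⟨d₀, hd₀, hmin⟩ := (isCompact_sphere (0 : Fin 3 → ℝ) 1).exists_isMinOn
    (NormedSpace.sphere_nonempty.2 zero_le_one) hc.continuousOn
  refine ⟨Q d₀, hpos d₀ (ne_zero_of_mem_unit_sphere ⟨d₀, hd₀⟩), fun d => ?_⟩
  by_cases hd : d = 0
  · simp [hd]
  have hn : 0 < ‖d‖ := norm_pos_iff.2 hd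
  have h1 : Q d₀ ≤ Q (‖d‖⁻¹ • d) := by
    refine hmin ?_
    simp [norm_smul, hn.ne']
  have h2 : Q (‖d‖⁻¹ • d) = (‖d‖ ^ 2)⁻¹ * Q d := by
    simp only [hQ, Finset.mul_sum, Pi.smul_apply, smul_eq_mul]
    refine Finset.sum_congr rfl fun j _ => Finset.sum_congr rfl fun k _ => ?_
    field_simp
  rw [h2, ← div_eq_inv_mul, le_div_iff₀ (by positivity)] at h1
  exact h1

/-- The part of the envelope outside `[-R, R]`. Its mean tends to `0` as `R → ∞`. -/
def tailEnv (ξ : ℝ) (R : ℕ) : ℝ → ℝ := Set.indicator {s | (R : ℝ) < |s|} (hessEnv ξ)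

lemma tailEnv_nonneg (ξ : ℝ) (R : ℕ) (s : ℝ) : 0 ≤ tailEnv ξ R s :=
  Set.indicator_nonneg (fun s _ => zero_le_one.trans (one_le_hessEnv ξ s)) s

lemma measurable_tailEnv (ξ : ℝ) (R : ℕ) : Measurable (tailEnv ξ R) :=
  (continuous_hessEnv ξ).measurable.indicator (measurableSet_lt measurable_const (by fun_prop))

lemma tailEnv_le (ξ : ℝ) (R : ℕ) (s : ℝ) : tailEnv ξ R s ≤ hessEnv ξ s :=
  Set.indicator_le_self' (fun s _ => zero_le_one.trans (one_le_hessEnv ξ s)) s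

lemma integrable_tailEnv {ξ : ℝ} (hξ : -(1 / 2) < ξ) (R : ℕ) :
    Integrable fun s => gumbelPDF s * tailEnv ξ R s := by
  have := measurable_tailEnv ξ R
  refine (integrable_hessEnv hξ).mono' (by fun_prop) (Eventually.of_forall fun s => ?_)
  rw [Real.norm_of_nonneg (mul_nonneg (gumbelPDF_pos s).le (tailEnv_nonneg ξ R s))]
  exact mul_le_mul_of_nonneg_left (tailEnv_le ξ R s) (gumbelPDF_pos s).le

lemma tendsto_integral_tailEnv {ξ : ℝ} (hξ : -(1 / 2) < ξ) :
    Tendsto (fun R : ℕ => ∫ s, gumbelPDF s * tailEnv ξ R s) atTop (𝓝 0) := by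
  rw [← integral_zero ℝ ℝ (μ := volume)]
  refine tendsto_integral_of_dominated_convergence (fun s => gumbelPDF s * hessEnv ξ s)
    (fun R => (integrable_tailEnv hξ R).aestronglyMeasurable) (integrable_hessEnv hξ)
    (fun R => Eventually.of_forall fun s => ?_) (Eventually.of_forall fun s => ?_)
  · rw [Real.norm_of_nonneg (mul_nonneg (gumbelPDF_pos s).le (tailEnv_nonneg ξ R s))]
    exact mul_le_mul_of_nonneg_left (tailEnv_le ξ R s) (gumbelPDF_pos s).le
  · refine tendsto_const_nhds.congr' ?_
    filter_upwards [eventually_ge_atTop ⌈|s|⌉₊] with R hR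
    have : ¬ ((R : ℝ) < |s|) := not_lt.2 (Nat.ceil_le.1 hR)
    simp [tailEnv, this]

lemma ContinuousAt.uncurry_gevQuantile {F : ℝ → (Fin 3 → ℝ) → ℝ} {ξ s : ℝ} {p : Fin 3 → ℝ}
    (hF : ContinuousAt (fun z : ℝ × (Fin 3 → ℝ) => F z.1 z.2) (gevQuantile ξ s, p)) :
    ContinuousAt (fun z : (Fin 3 → ℝ) × ℝ => F (gevQuantile ξ z.2) z.1) (p, s) := by
  have c0 : Continuous fun z : (Fin 3 → ℝ) × ℝ => (gevQuantile ξ z.2, z.1) :=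
    ((continuous_gevQuantile ξ).comp continuous_snd).prodMk continuous_fst
  exact ContinuousAt.comp (x := (p, s)) (g := fun z : ℝ × (Fin 3 → ℝ) => F z.1 z.2) hF
    c0.continuousAt

/-- Uniform continuity of the second derivative near the base parameter, for observations in a
compact part of the support. -/
lemma exists_abs_psi2_sub_le (ξ R : ℝ) {ε : ℝ} (hε : 0 < ε) :
    ∃ ρ > 0, ∀ s, |s| ≤ R → ∀ p, ‖p - baseParam ξ‖ < ρ → ∀ d e,
      |psi2 (gevQuantile ξ s) p d e - psi2 (gevQuantile ξ s) (baseParam ξ) d e| ≤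
        9 * ε * (‖d‖ * ‖e‖) := by
  have hev : ∀ᶠ p in 𝓝 (baseParam ξ), ∀ s ∈ Set.Icc (-R) R, p ∈ affDom (gevQuantile ξ s) ∧
      ∀ j k : Fin 3, |psi2 (gevQuantile ξ s) p (Pi.single j 1) (Pi.single k 1) -
        psi2 (gevQuantile ξ s) (baseParam ξ) (Pi.single j 1) (Pi.single k 1)| < ε := by
    refine isCompact_Icc.eventually_forall_of_forall_eventually fun s _ => ?_
    refine Filter.Eventually.and ?_ ?_
    · have ho : IsOpen {z : (Fin 3 → ℝ) × ℝ | z.1 ∈ affDom (gevQuantile ξ z.2)} := by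
        apply IsOpen.and <;> apply isOpen_lt <;> first | fun_prop | (unfold affV; fun_prop)
      exact ho.mem_nhds (gevQuantile_mem ξ s)
    · simp only [eventually_all]
      intro j k
      have c1 := ContinuousAt.uncurry_gevQuantile
        (F := fun x p => psi2 x p (Pi.single j 1) (Pi.single k 1))
        (continuousAt_psi2 (gevQuantile_mem ξ s) (Pi.single j 1) (Pi.single k 1))
      have c2 := continuous_psi2_gevQuantile ξ (Pi.single j 1) (Pi.single k 1)
      have c3 : ContinuousAt (fun z : (Fin 3 → ℝ) × ℝ =>
        |psi2 (gevQuantile ξ z.2) z.1 (Pi.single j 1) (Pi.single k 1) -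
        psi2 (gevQuantile ξ z.2) (baseParam ξ) (Pi.single j 1) (Pi.single k 1)|)
          (baseParam ξ, s) :=
        (c1.sub (c2.comp continuous_snd).continuousAt).abs
      exact c3.eventually_lt continuousAt_const (by simpa using hε)
  obtain ⟨ρ, hρ, h⟩ := Metric.eventually_nhds_iff.1 hev
  refine ⟨ρ, hρ, fun s hs p hp d e => ?_⟩
  rw [← dist_eq_norm] at hp
  obtain ⟨hd, hjk⟩ := h hp s (abs_le.1 hs)
  rw [psi2_eq_sum hd, psi2_eq_sum (gevQuantile_mem ξ s)]
  simp only [← Finset.sum_sub_distrib, ← mul_sub]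
  calc _ ≤ ∑ j : Fin 3, ∑ k : Fin 3, ‖d‖ * ‖e‖ * ε := by
        refine (Finset.abs_sum_le_sum_abs _ _).trans (Finset.sum_le_sum fun j _ => ?_)
        refine (Finset.abs_sum_le_sum_abs _ _).trans (Finset.sum_le_sum fun k _ => ?_)
        rw [abs_mul, abs_mul]
        have h1 := norm_le_pi_norm d j
        have h2 := norm_le_pi_norm e k
        rw [Real.norm_eq_abs] at h1 h2
        have := (hjk j k).le
        gcongr
    _ = _ := by simp; ring

/-- If `H` is entrywise within `ε` of `-F` then its quadratic form exceeds that of `-F` by at most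
`9 ε ‖d‖²`. -/
lemma sum_mul_le_of_abs_add_le {H F : Fin 3 → Fin 3 → ℝ} {ε : ℝ} (h : ∀ j k, |H j k + F j k| ≤ ε)
    (d : Fin 3 → ℝ) :
    ∑ j, ∑ k, d j * d k * H j k ≤ 9 * ε * ‖d‖ ^ 2 - ∑ j, ∑ k, d j * d k * F j k := by
  have : ∑ j, ∑ k, d j * d k * (H j k + F j k) ≤ ∑ j : Fin 3, ∑ k : Fin 3, ‖d‖ * ‖d‖ * ε := by
    refine Finset.sum_le_sum fun j _ => Finset.sum_le_sum fun k _ => ?_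
    refine (le_abs_self _).trans ?_
    rw [abs_mul, abs_mul]
    have h1 := norm_le_pi_norm d j
    have h2 := norm_le_pi_norm d k
    rw [Real.norm_eq_abs] at h1 h2
    have := h j k
    gcongr
  simp only [mul_add, Finset.sum_add_distrib] at this
  simp at this
  simp
  nlinarith

/-- Uniform strict concavity of the averaged log-likelihood on the part of its domain near the base
parameter. Observations in a compact set contribute a uniformly continuous second derivative; for
the others the one-sided bound suffices, since only an upper bound is needed. -/
lemma eventually_sum_psi2_le {ξ : ℝ} (hξ : -(1 / 2) < ξ) {u : ℕ → ℝ}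
    (hH : ∀ j k, Tendsto (fun n : ℕ => (n : ℝ)⁻¹ * ∑ i ∈ Finset.range n,
      psi2 (gevQuantile ξ (u i)) (baseParam ξ) (Pi.single j 1) (Pi.single k 1)) atTop
        (𝓝 (-baseFisher ξ j k)))
    (hT : ∀ R : ℕ, Tendsto (fun n : ℕ => (n : ℝ)⁻¹ * ∑ i ∈ Finset.range n, tailEnv ξ R (u i)) atTop
      (𝓝 (∫ s, gumbelPDF s * tailEnv ξ R s))) :
    ∃ c > 0, ∃ ρ > 0, ∀ᶠ n : ℕ in atTop, ∀ p, ‖p - baseParam ξ‖ < ρ →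
      (∀ i ∈ Finset.range n, p ∈ affDom (gevQuantile ξ (u i))) → ∀ d,
        ∑ i ∈ Finset.range n, psi2 (gevQuantile ξ (u i)) p d d ≤ -(n * (c * ‖d‖ ^ 2)) := by
  obtain ⟨c, hc, hF⟩ := exists_le_sum_mul_baseFisher hξ
  obtain ⟨ρ₁, hρ₁, C, hC, hub⟩ := exists_psi2_le hξ
  set K := 4 * C + 84 with hK
  have hK0 : 0 < K := by positivity
  obtain ⟨R, hR⟩ := ((tendsto_integral_tailEnv hξ).eventually_lt_const
    (show 0 < c / (8 * K) by positivity)).exists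
  obtain ⟨ρ₂, hρ₂, hloc⟩ := exists_abs_psi2_sub_le ξ R (show 0 < c / 72 by positivity)
  refine ⟨c / 2, by positivity, min ρ₁ ρ₂, lt_min hρ₁ hρ₂, ?_⟩
  have hHev : ∀ᶠ n : ℕ in atTop, ∀ j k, |((n : ℝ)⁻¹ * ∑ i ∈ Finset.range n,
      psi2 (gevQuantile ξ (u i)) (baseParam ξ) (Pi.single j 1) (Pi.single k 1)) +
        baseFisher ξ j k| ≤ c / 72 := by
    simp only [eventually_all]
    intro j k
    have h1 := ((hH j k).add_const (baseFisher ξ j k)).abs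
    rw [neg_add_cancel, abs_zero] at h1
    exact (h1.eventually_lt_const (show 0 < c / 72 by positivity)).mono fun n hn => hn.le
  filter_upwards [hHev, (hT R).eventually_lt_const hR, eventually_gt_atTop 0] with n hn1 hn2 hn0
    p hp hdom d
  have hn : (0 : ℝ) < n := by exact_mod_cast hn0
  have hd2 : 0 ≤ ‖d‖ ^ 2 := by positivity
  -- comparison with the base parameter, observation by observation
  have hi : ∀ i ∈ Finset.range n, psi2 (gevQuantile ξ (u i)) p d d ≤
      psi2 (gevQuantile ξ (u i)) (baseParam ξ) d d +
        (c / 8 * ‖d‖ ^ 2 + K * ‖d‖ ^ 2 * tailEnv ξ R (u i)) := by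
    intro i hin
    by_cases hu : (R : ℝ) < |u i|
    · have h1 := hub _ p (hdom i hin) (hp.le.trans (min_le_left _ _)) d
      have h2 := abs_psi2_gevQuantile_le (s := u i) (p := baseParam ξ) (ξ := ξ) (by simp) d d
      have h3 := (abs_le.1 h2).1
      have h4 := growthBound_le hξ (u i)
      have h5 : tailEnv ξ R (u i) = hessEnv ξ (u i) := Set.indicator_of_mem (by exact hu) _
      have h6 : C * (growthBound ξ (gevQuantile ξ (u i)) * ‖d‖ ^ 2) ≤
          C * ((4 * hessEnv ξ (u i)) * ‖d‖ ^ 2) := by gcongr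
      have h7 : 0 ≤ c / 8 * ‖d‖ ^ 2 := by positivity
      rw [h5, hK]
      linarith
    · have h1 := hloc (u i) (not_lt.1 hu) p (hp.trans_le (min_le_right _ _)) d d
      have h2 := (abs_le.1 h1).2
      have h3 : 0 ≤ K * ‖d‖ ^ 2 * tailEnv ξ R (u i) :=
        mul_nonneg (by positivity) (tailEnv_nonneg _ _ _)
      linarith
  have hsum := Finset.sum_le_sum hi
  rw [Finset.sum_add_distrib, Finset.sum_add_distrib, Finset.sum_const,
    Finset.card_range, nsmul_eq_mul, ← Finset.mul_sum] at hsum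
  have hbase : ∑ i ∈ Finset.range n, psi2 (gevQuantile ξ (u i)) (baseParam ξ) d d =
      n * ∑ j, ∑ k, d j * d k * ((n : ℝ)⁻¹ * ∑ i ∈ Finset.range n,
        psi2 (gevQuantile ξ (u i)) (baseParam ξ) (Pi.single j 1) (Pi.single k 1)) := by
    rw [Finset.sum_congr rfl fun i _ => psi2_eq_sum (gevQuantile_mem ξ (u i)) d d,
      Finset.sum_comm, Finset.mul_sum]
    refine Finset.sum_congr rfl fun j _ => ?_
    rw [Finset.sum_comm, Finset.mul_sum]
    refine Finset.sum_congr rfl fun k _ => ?_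
    rw [← Finset.mul_sum]
    field_simp
  have h8 := sum_mul_le_of_abs_add_le hn1 d
  have h9 := hF d
  have h10 : ∑ i ∈ Finset.range n, tailEnv ξ R (u i) ≤ n * (c / (8 * K)) := by
    rw [inv_mul_eq_div, div_lt_iff₀ hn] at hn2
    linarith
  have h11 : K * ‖d‖ ^ 2 * ∑ i ∈ Finset.range n, tailEnv ξ R (u i) ≤ n * (c / 8 * ‖d‖ ^ 2) := by
    calc _ ≤ K * ‖d‖ ^ 2 * (n * (c / (8 * K))) := by gcongr
      _ = _ := by field_simp
  have h12 : n * ∑ j, ∑ k, d j * d k * ((n : ℝ)⁻¹ * ∑ i ∈ Finset.range n,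
        psi2 (gevQuantile ξ (u i)) (baseParam ξ) (Pi.single j 1) (Pi.single k 1)) ≤
      n * (9 * (c / 72) * ‖d‖ ^ 2 - c * ‖d‖ ^ 2) := by
    refine mul_le_mul_of_nonneg_left (h8.trans (by linarith)) hn.le
  rw [hbase] at hsum
  have h13 : (0 : ℝ) ≤ n * (c * ‖d‖ ^ 2) := by positivity
  linarith

/-- A root of the likelihood equations near the base parameter is within `O(n ^ (β - 1))` of it: the
segment between them lies in the convex domain of the log-likelihood, which is strictly concave
along it, and the score at the base parameter is `O(n ^ β)`. -/
lemma eventually_norm_sub_le {ξ : ℝ} {u : ℕ → ℝ} {β c ρ C : ℝ} (hc : 0 < c)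
    (hconc : ∀ᶠ n : ℕ in atTop, ∀ p, ‖p - baseParam ξ‖ < ρ →
      (∀ i ∈ Finset.range n, p ∈ affDom (gevQuantile ξ (u i))) → ∀ d,
        ∑ i ∈ Finset.range n, psi2 (gevQuantile ξ (u i)) p d d ≤ -(n * (c * ‖d‖ ^ 2)))
    (hS : ∀ j, ∀ n : ℕ, |∑ i ∈ Finset.range n,
      psi1 (gevQuantile ξ (u i)) (baseParam ξ) (Pi.single j 1)| ≤ C * (n : ℝ) ^ β)
    {lam : ℕ → Fin 3 → ℝ}
    (hnear : ∀ᶠ n in atTop, ‖lam n - baseParam ξ‖ < ρ)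
    (hroot : ∀ᶠ n in atTop, (∀ i ∈ Finset.range n, lam n ∈ affDom (gevQuantile ξ (u i))) ∧
      ∀ d, ∑ i ∈ Finset.range n, psi1 (gevQuantile ξ (u i)) (lam n) d = 0) :
    ∀ᶠ n : ℕ in atTop, ‖lam n - baseParam ξ‖ ≤ 3 * C / c * (n : ℝ) ^ (β - 1) := by
  filter_upwards [hconc, hnear, hroot, eventually_gt_atTop 0] with n h1 h2 h3 hn0
  obtain ⟨hdom, hzero⟩ := h3
  have hn : (0 : ℝ) < n := by exact_mod_cast hn0
  set b := baseParam ξ with hb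
  set d := lam n - b with hd
  set φ : ℝ → ℝ := fun r => ∑ i ∈ Finset.range n, psi1 (gevQuantile ξ (u i)) (b + r • d) d with hφ
  have hseg : ∀ r ∈ Set.Icc (0 : ℝ) 1, ‖b + r • d - b‖ < ρ ∧
      ∀ i ∈ Finset.range n, b + r • d ∈ affDom (gevQuantile ξ (u i)) := by
    intro r hr
    constructor
    · rw [add_sub_cancel_left, norm_smul, Real.norm_of_nonneg hr.1]
      exact (mul_le_of_le_one_left (norm_nonneg _) hr.2).trans_lt h2
    · intro i hi
      have := (convex_affDom (gevQuantile ξ (u i))) (gevQuantile_mem ξ (u i)) (hdom i hi)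
        (sub_nonneg.2 hr.2) hr.1 (by ring)
      convert this using 1
      rw [hd]; module
  have hder : ∀ r ∈ Set.Icc (0 : ℝ) 1, HasDerivAt φ
      (∑ i ∈ Finset.range n, psi2 (gevQuantile ξ (u i)) (b + r • d) d d) r := by
    intro r hr
    refine HasDerivAt.fun_sum fun i hi => ?_
    obtain ⟨L, hL, hLe⟩ := exists_hasFDerivAt_psi1 ((hseg r hr).2 i hi) d
    have hlin : HasDerivAt (fun r : ℝ => b + r • d) d r := by
      simpa using ((hasDerivAt_id r).smul_const d).const_add b
    have := hL.comp_hasDerivAt r hlin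
    rw [hLe] at this
    exact this
  obtain ⟨r, hr, hslope⟩ := exists_hasDerivAt_eq_slope φ _ zero_lt_one
    (fun r hr => (hder r hr).continuousAt.continuousWithinAt)
    (fun r hr => hder r (Set.Ioo_subset_Icc_self hr))
  have hr' := Set.Ioo_subset_Icc_self hr
  have hle := h1 _ (hseg r hr').1 (hseg r hr').2 d
  have hφ1 : φ 1 = 0 := by
    simp only [hφ, one_smul, hd, add_sub_cancel]
    exact hzero _
  have hφ0 : φ 0 ≤ 3 * C * (n : ℝ) ^ β * ‖d‖ := by
    simp only [hφ, zero_smul, add_zero]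
    rw [Finset.sum_congr rfl fun i _ => psi1_eq_sum (gevQuantile_mem ξ (u i)) d, Finset.sum_comm]
    calc _ = ∑ j, d j * ∑ i ∈ Finset.range n,
          psi1 (gevQuantile ξ (u i)) b (Pi.single j 1) := by simp only [Finset.mul_sum]; rfl
      _ ≤ ∑ j : Fin 3, ‖d‖ * (C * (n : ℝ) ^ β) := by
        refine Finset.sum_le_sum fun j _ => (le_abs_self _).trans ?_
        rw [abs_mul]
        have := norm_le_pi_norm d j
        rw [Real.norm_eq_abs] at this
        exact mul_le_mul this (hS j n) (abs_nonneg _) (norm_nonneg _)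
      _ = _ := by simp; ring
  rw [hφ1, sub_zero, div_one, zero_sub] at hslope
  have hkey : n * (c * ‖d‖ ^ 2) ≤ 3 * C * (n : ℝ) ^ β * ‖d‖ := by linarith
  rcases (norm_nonneg d).eq_or_lt with h0 | h0
  · rw [← h0]
    have hC := (abs_nonneg _).trans (hS 0 1)
    simp at hC
    positivity
  · have hb1 : (n : ℝ) ^ (β - 1) = (n : ℝ) ^ β / n := by
      rw [Real.rpow_sub hn, Real.rpow_one]
    rw [hb1, div_mul_div_comm, le_div_iff₀ (by positivity)]
    have : ‖d‖ * (‖d‖ * (c * n)) ≤ ‖d‖ * (3 * C * (n : ℝ) ^ β) := by nlinarith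
    exact le_of_mul_le_mul_left this h0

/-- Convergence of the averaged Hessian at parameters for which `v` and `v₀` are comparable at
all observations. -/
lemma tendsto_avg_psi2 {ξ : ℝ} (hξ : -(1 / 2) < ξ) {u : ℕ → ℝ} {j k : Fin 3} {l : ℝ}
    (hH : Tendsto (fun n : ℕ => (n : ℝ)⁻¹ * ∑ i ∈ Finset.range n,
      psi2 (gevQuantile ξ (u i)) (baseParam ξ) (Pi.single j 1) (Pi.single k 1)) atTop (𝓝 l))
    (hT : ∀ R : ℕ, Tendsto (fun n : ℕ => (n : ℝ)⁻¹ * ∑ i ∈ Finset.range n, tailEnv ξ R (u i)) atTop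
      (𝓝 (∫ s, gumbelPDF s * tailEnv ξ R s)))
    {lam : ℕ → Fin 3 → ℝ} (hlam : Tendsto lam atTop (𝓝 (baseParam ξ)))
    (hW : ∀ᶠ n in atTop, ∀ i ∈ Finset.range n,
      ‖lam n - baseParam ξ‖ * (2 * affW ξ (gevQuantile ξ (u i))) ≤ 1) :
    Tendsto (fun n : ℕ => (n : ℝ)⁻¹ * ∑ i ∈ Finset.range n,
      psi2 (gevQuantile ξ (u i)) (lam n) (Pi.single j 1) (Pi.single k 1)) atTop (𝓝 l) := by
  have hs : ∀ j : Fin 3, ‖(Pi.single j 1 : Fin 3 → ℝ)‖ = 1 := fun j => by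
    rw [Pi.norm_single, norm_one]
  refine tendsto_of_tendsto_of_dist hH ?_
  rw [Metric.tendsto_atTop']
  intro ε hε
  obtain ⟨R, hR⟩ := ((tendsto_integral_tailEnv hξ).eventually_lt_const
    (show 0 < ε / 504 by positivity)).exists
  obtain ⟨ρ, hρ, hloc⟩ := exists_abs_psi2_sub_le ξ R (show 0 < ε / 27 by positivity)
  have hnear : ∀ᶠ n in atTop, ‖lam n - baseParam ξ‖ < ρ := by
    simpa only [dist_eq_norm] using (Metric.tendsto_nhds.1 hlam) ρ hρ
  obtain ⟨N, hN⟩ := eventually_atTop.1 (((hT R).eventually_lt_const hR).and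
    ((hnear.and hW).and (eventually_gt_atTop 0)))
  refine ⟨N, fun n hn => ?_⟩
  obtain ⟨h1, ⟨h2, h3⟩, hn0⟩ := hN n hn.le
  have hnp : (0 : ℝ) < n := by exact_mod_cast hn0
  have hi : ∀ i ∈ Finset.range n,
      |psi2 (gevQuantile ξ (u i)) (lam n) (Pi.single j 1) (Pi.single k 1) -
        psi2 (gevQuantile ξ (u i)) (baseParam ξ) (Pi.single j 1) (Pi.single k 1)| ≤
        ε / 3 + 168 * tailEnv ξ R (u i) := by
    intro i hin
    by_cases hu : (R : ℝ) < |u i|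
    · have h4 := abs_psi2_gevQuantile_le (h3 i hin) (Pi.single j 1) (Pi.single k 1)
      have h5 := abs_psi2_gevQuantile_le (s := u i) (p := baseParam ξ) (ξ := ξ) (by simp)
        (Pi.single j 1) (Pi.single k 1)
      have h6 : tailEnv ξ R (u i) = hessEnv ξ (u i) := Set.indicator_of_mem (by exact hu) _
      rw [hs, hs] at h4 h5
      rw [h6]
      refine (abs_sub _ _).trans ?_
      linarith
    · have h4 := hloc (u i) (not_lt.1 hu) (lam n) h2 (Pi.single j 1) (Pi.single k 1)
      rw [hs, hs] at h4
      have := tailEnv_nonneg ξ R (u i)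
      linarith
  rw [Real.dist_eq, sub_zero, abs_of_nonneg dist_nonneg, Real.dist_eq, abs_sub_comm, ← mul_sub,
    ← Finset.sum_sub_distrib, abs_mul, abs_of_pos (inv_pos.2 hnp), inv_mul_eq_div, div_lt_iff₀ hnp]
  have h7 := (Finset.abs_sum_le_sum_abs _ _).trans (Finset.sum_le_sum hi)
  rw [Finset.sum_add_distrib, Finset.sum_const, Finset.card_range,
    nsmul_eq_mul, ← Finset.mul_sum] at h7
  rw [inv_mul_eq_div, div_lt_iff₀ hnp] at h1
  have : 0 < ε * n := by positivity
  linarith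

/-- Almost surely, along every consistent sequence of roots of the likelihood equations the
averaged Hessian converges to minus the Fisher information. The roots are within `O(n ^ (β - 1))`
of the base parameter while the weights `W` of the sample are `O(n ^ (1/q))`, so that in the end
the domination is two-sided at all observations. -/
lemma ae_tendsto_avg_psi2_of_root {Ω : Type*} [MeasurableSpace Ω] {P : Measure Ω}
    [IsProbabilityMeasure P] {U : ℕ → Ω → ℝ} (hind : iIndepFun U P) (hm : ∀ i, Measurable (U i))
    (hlaw : ∀ i, HasLaw (U i) gumbelMeasure P) {ξ : ℝ} (hξ : -(1 / 2) < ξ) :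
    ∀ᵐ ω ∂P, ∀ lam : ℕ → Fin 3 → ℝ, Tendsto lam atTop (𝓝 (baseParam ξ)) →
      (∀ᶠ n in atTop, (∀ i ∈ Finset.range n, lam n ∈ affDom (gevQuantile ξ (U i ω))) ∧
        ∀ d, ∑ i ∈ Finset.range n, psi1 (gevQuantile ξ (U i ω)) (lam n) d = 0) →
      ∀ j k, Tendsto (fun n : ℕ => (n : ℝ)⁻¹ * ∑ i ∈ Finset.range n,
        psi2 (gevQuantile ξ (U i ω)) (lam n) (Pi.single j 1) (Pi.single k 1)) atTop
          (𝓝 (-baseFisher ξ j k)) := by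
  obtain ⟨q, hq, hqi⟩ := exists_integrable_affW_rpow hξ
  have hq0 : 0 < q := by linarith
  have hq1 : 1 / q < 1 / 2 := one_div_lt_one_div_of_lt (by norm_num) hq
  -- `β > 1/2` is needed for the growth of the score, `β - 1 + 1/q < 0` for `‖lam n - base‖ W → 0`
  set β := (3 / 2 - 1 / q) / 2 with hβ
  have hβ1 : 1 / 2 < β := by linarith
  have hβ2 : β - 1 + 1 / q < 0 := by linarith
  have e1 : ∀ᵐ ω ∂P, ∀ j k, Tendsto (fun n : ℕ => (n : ℝ)⁻¹ * ∑ i ∈ Finset.range n,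
      psi2 (gevQuantile ξ (U i ω)) (baseParam ξ) (Pi.single j 1) (Pi.single k 1)) atTop
        (𝓝 (-baseFisher ξ j k)) := by
    simp only [ae_all_iff]
    intro j k
    have := strong_law_gumbel hind hlaw
      (continuous_psi2_gevQuantile ξ (Pi.single j 1) (Pi.single k 1)).measurable
      (integrable_psi2 hξ _ _)
    rw [integral_psi2 hξ] at this
    exact this
  have e2 : ∀ᵐ ω ∂P, ∀ R : ℕ, Tendsto (fun n : ℕ => (n : ℝ)⁻¹ * ∑ i ∈ Finset.range n,
      tailEnv ξ R (U i ω)) atTop (𝓝 (∫ s, gumbelPDF s * tailEnv ξ R s)) :=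
    ae_all_iff.2 fun R => strong_law_gumbel hind hlaw (measurable_tailEnv ξ R)
      (integrable_tailEnv hξ R)
  have e3 : ∀ᵐ ω ∂P, ∀ j : Fin 3, ∃ C, ∀ n : ℕ, |∑ i ∈ Finset.range n,
      psi1 (gevQuantile ξ (U i ω)) (baseParam ξ) (Pi.single j 1)| ≤ C * (n : ℝ) ^ β := by
    refine ae_all_iff.2 fun j => ?_
    exact ae_exists_abs_sum_gumbel_le hind hm hlaw
      (continuous_psi1_gevQuantile ξ (Pi.single j 1)).measurable
      (integrable_psi1_mul_psi1 hξ _ _) (integral_psi1_eq_zero hξ _) hβ1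
  have hWm : Measurable fun s => affW ξ (gevQuantile ξ s) ^ q :=
    (continuous_affW_gevQuantile ξ).measurable.pow_const q
  have e4 := strong_law_gumbel hind hlaw hWm hqi
  filter_upwards [e1, e2, e3, e4] with ω h1 h2 h3 h4 lam hlam hroot j k
  obtain ⟨c, hc, ρ, hρ, hconc⟩ := eventually_sum_psi2_le hξ h1 h2
  choose C hC using h3
  set C' := ∑ j, |C j| with hC'
  have hC2 : ∀ j, ∀ n : ℕ, |∑ i ∈ Finset.range n,
      psi1 (gevQuantile ξ (U i ω)) (baseParam ξ) (Pi.single j 1)| ≤ C' * (n : ℝ) ^ β := by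
    intro j n
    refine (hC j n).trans ?_
    have : C j ≤ C' := (le_abs_self _).trans
      (Finset.single_le_sum (f := fun j => |C j|) (fun _ _ => abs_nonneg _) (Finset.mem_univ j))
    gcongr
  have hnear : ∀ᶠ n in atTop, ‖lam n - baseParam ξ‖ < ρ := by
    simpa only [dist_eq_norm] using (Metric.tendsto_nhds.1 hlam) ρ hρ
  have hrate := eventually_norm_sub_le hc hconc hC2 hnear hroot
  refine tendsto_avg_psi2 hξ (h1 j k) h2 hlam ?_
  set A := ∫ s, gumbelPDF s * affW ξ (gevQuantile ξ s) ^ q with hA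
  have hA0 : 0 ≤ A := integral_nonneg fun s => mul_nonneg (gumbelPDF_pos s).le
    (Real.rpow_nonneg (zero_le_one.trans (one_le_affW_gevQuantile ξ s)) _)
  have hC'0 : 0 ≤ C' := Finset.sum_nonneg fun _ _ => abs_nonneg _
  set K := 2 * (3 * C' / c) * (A + 1) ^ (1 / q) with hK
  have hlim : Tendsto (fun n : ℕ => K * (n : ℝ) ^ (β - 1 + 1 / q)) atTop (𝓝 0) := by
    have := (tendsto_rpow_neg_atTop (y := -(β - 1 + 1 / q)) (by linarith)).comp
      tendsto_natCast_atTop_atTop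
    simpa using this.const_mul K
  filter_upwards [hrate, h4.eventually_lt_const (show A < A + 1 by linarith),
    hlim.eventually_lt_const zero_lt_one, eventually_gt_atTop 0] with n g1 g2 g3 hn0 i hi
  have hn : (0 : ℝ) < n := by exact_mod_cast hn0
  have hWi : affW ξ (gevQuantile ξ (U i ω)) ≤ (A + 1) ^ (1 / q) * (n : ℝ) ^ (1 / q) := by
    have w1 := one_le_affW_gevQuantile ξ (U i ω)
    rw [inv_mul_eq_div, div_lt_iff₀ hn] at g2
    have w2 : affW ξ (gevQuantile ξ (U i ω)) ^ q ≤ (A + 1) * n :=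
      (Finset.single_le_sum (f := fun i => affW ξ (gevQuantile ξ (U i ω)) ^ q)
        (fun i _ => Real.rpow_nonneg (zero_le_one.trans (one_le_affW_gevQuantile ξ _)) _)
        hi).trans g2.le
    rw [← Real.mul_rpow (by linarith) hn.le]
    calc affW ξ (gevQuantile ξ (U i ω)) = (affW ξ (gevQuantile ξ (U i ω)) ^ q) ^ (1 / q) := by
          rw [← Real.rpow_mul (by linarith), mul_one_div_cancel hq0.ne', Real.rpow_one]
      _ ≤ _ := by gcongr
  have hW0 := one_le_affW_gevQuantile ξ (U i ω)
  calc _ ≤ (3 * C' / c * (n : ℝ) ^ (β - 1)) *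
        (2 * ((A + 1) ^ (1 / q) * (n : ℝ) ^ (1 / q))) := by gcongr
    _ = K * ((n : ℝ) ^ (β - 1) * (n : ℝ) ^ (1 / q)) := by rw [hK]; ring
    _ = K * (n : ℝ) ^ (β - 1 + 1 / q) := by rw [← Real.rpow_add hn]
    _ ≤ 1 := g3.le

/-! ### The affine coordinates of the GEV family -/

/-- `log (1 + w) / w`, with the value `1` at `w = 0`. -/
def logSlope : ℝ → ℝ := dslope (fun w => Real.log (1 + w)) 0

lemma hasDerivAt_log_one_add : HasDerivAt (fun w : ℝ => Real.log (1 + w)) 1 0 := by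
  have h : HasDerivAt (fun w : ℝ => 1 + w) 1 0 := (hasDerivAt_id (0 : ℝ)).const_add 1
  simpa using h.log (by norm_num)

lemma logSlope_zero : logSlope 0 = 1 := by
  rw [logSlope, dslope_same, hasDerivAt_log_one_add.deriv]

lemma mul_logSlope (w : ℝ) : w * logSlope w = Real.log (1 + w) := by
  simpa [logSlope] using sub_smul_dslope (fun w : ℝ => Real.log (1 + w)) 0 w

lemma analyticAt_logSlope : AnalyticAt ℝ logSlope 0 := by
  have h : AnalyticAt ℝ (fun w : ℝ => Real.log (1 + w)) 0 :=
    (analyticAt_const.add analyticAt_id).log (by norm_num)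
  obtain ⟨p, hp⟩ := h
  exact ⟨_, hp.has_fpower_series_dslope_fslope⟩

/-- The coordinates `(σ, η, ξ)` of `θ` relative to the location and scale of `θ₀`: with
`x = (y - μ₀) / τ₀`, the log-density of `θ` at `y` is `psi x (σ, η, ξ) - log τ₀`. Here
`σ = (τ - ξ (μ - μ₀)) / τ₀`, and `η` is the value at `y = μ₀` of `-log t(y; θ)`, that is
`log (1 + ξ z) / ξ` for `z = (μ₀ - μ) / τ`, continued by `z` at `ξ = 0`. -/
def gevCoord (θ₀ θ : Fin 3 → ℝ) : Fin 3 → ℝ :=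
  ![(θ 0 - θ 2 * (θ 1 - θ₀ 1)) / θ₀ 0,
    (θ₀ 1 - θ 1) / θ 0 * logSlope (θ 2 * ((θ₀ 1 - θ 1) / θ 0)), θ 2]

lemma gevCoord_zero (θ₀ θ : Fin 3 → ℝ) :
    gevCoord θ₀ θ 0 = (θ 0 - θ 2 * (θ 1 - θ₀ 1)) / θ₀ 0 := rfl

lemma gevCoord_one (θ₀ θ : Fin 3 → ℝ) : gevCoord θ₀ θ 1 =
    (θ₀ 1 - θ 1) / θ 0 * logSlope (θ 2 * ((θ₀ 1 - θ 1) / θ 0)) := rfl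

lemma gevCoord_two (θ₀ θ : Fin 3 → ℝ) : gevCoord θ₀ θ 2 = θ 2 := rfl

lemma gevCoord_self {θ₀ : Fin 3 → ℝ} (h : 0 < θ₀ 0) : gevCoord θ₀ θ₀ = baseParam (θ₀ 2) := by
  ext i
  fin_cases i <;> simp [gevCoord, baseParam, h.ne']

lemma affV_gevCoord {θ₀ θ : Fin 3 → ℝ} (h₀ : 0 < θ₀ 0) (h : 0 < θ 0) (y : ℝ) :
    affV (gevCoord θ₀ θ) ((y - θ₀ 1) / θ₀ 0) = θ 0 / θ₀ 0 * gevW θ y := by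
  unfold affV gevW
  rw [gevCoord_zero, gevCoord_two]
  field_simp
  ring

lemma gevCoord_mem_affDom {θ₀ θ : Fin 3 → ℝ} {y : ℝ} (h₀ : 0 < θ₀ 0) (h : 0 < θ 0)
    (hσ : 0 < gevCoord θ₀ θ 0) (hw : 0 < gevW θ y) :
    gevCoord θ₀ θ ∈ affDom ((y - θ₀ 1) / θ₀ 0) := by
  refine ⟨hσ, ?_⟩
  rw [affV_gevCoord h₀ h]
  positivity

lemma affT_gevCoord {θ₀ θ : Fin 3 → ℝ} {y : ℝ} (h₀ : 0 < θ₀ 0) (h : 0 < θ 0)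
    (hσ : 0 < gevCoord θ₀ θ 0) (hw : 0 < gevW θ y) :
    affT ((y - θ₀ 1) / θ₀ 0) (gevCoord θ₀ θ) = gevT θ y := by
  have hmem := gevCoord_mem_affDom h₀ h hσ hw
  unfold affT gevT
  rcases eq_or_ne (θ 2) 0 with hξ | hξ
  · rw [if_pos hξ]
    have hH : affH ((y - θ₀ 1) / θ₀ 0) (gevCoord θ₀ θ) = (y - θ₀ 1) / θ 0 := by
      unfold affH affInt affV
      rw [gevCoord_two, hξ, gevCoord_zero, hξ]
      simp
      field_simp
    rw [hH, gevCoord_one, hξ, zero_mul, logSlope_zero]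
    congr 1
    field_simp
    ring
  · rw [if_neg hξ, Real.rpow_def_of_pos hw]
    congr 1
    have h1 := mul_affInt_one hmem
    rw [affV_gevCoord h₀ h, gevCoord_two] at h1
    have h2 := mul_logSlope (θ 2 * ((θ₀ 1 - θ 1) / θ 0))
    have h3 : gevCoord θ₀ θ 0 = θ 0 / θ₀ 0 * (1 + θ 2 * ((θ₀ 1 - θ 1) / θ 0)) := by
      rw [gevCoord_zero]; field_simp; ring
    have h4 : 0 < 1 + θ 2 * ((θ₀ 1 - θ 1) / θ 0) := by
      rw [h3] at hσ
      exact pos_of_mul_pos_right hσ (by positivity)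
    rw [h3, Real.log_mul (by positivity) hw.ne', Real.log_mul (by positivity) h4.ne', ← h2] at h1
    have h5 : Real.log (gevW θ y) = θ 2 * (affH ((y - θ₀ 1) / θ₀ 0) (gevCoord θ₀ θ) +
        gevCoord θ₀ θ 1) := by
      rw [gevCoord_one, affH]; linarith
    rw [h5]
    field_simp
    ring

lemma gevT_pos {θ : Fin 3 → ℝ} {y : ℝ} (hw : 0 < gevW θ y) : 0 < gevT θ y := by
  unfold gevT
  split_ifs
  · exact Real.exp_pos _
  · exact Real.rpow_pos_of_pos hw _

lemma gevPDF_pos_iff {θ : Fin 3 → ℝ} {y : ℝ} (h : 0 < θ 0) : 0 < gevPDF θ y ↔ 0 < gevW θ y := by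
  unfold gevPDF
  split_ifs with hw
  · have := Real.rpow_pos_of_pos (gevT_pos hw) (θ 2 + 1)
    simp only [hw, iff_true]
    positivity
  · simp [hw]

/-- In affine coordinates the log-density of the GEV distribution is `psi`. -/
lemma log_gevPDF {θ₀ θ : Fin 3 → ℝ} {y : ℝ} (h₀ : 0 < θ₀ 0) (h : 0 < θ 0)
    (hσ : 0 < gevCoord θ₀ θ 0) (hw : 0 < gevW θ y) :
    Real.log (gevPDF θ y) = psi ((y - θ₀ 1) / θ₀ 0) (gevCoord θ₀ θ) - Real.log (θ₀ 0) := by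
  have hmem := gevCoord_mem_affDom h₀ h hσ hw
  have hT := affT_gevCoord h₀ h hσ hw
  have ht := gevT_pos hw
  have hlogT : Real.log (gevT θ y) =
      -gevCoord θ₀ θ 1 - affH ((y - θ₀ 1) / θ₀ 0) (gevCoord θ₀ θ) := by
    rw [← hT, affT, Real.log_exp]
  have h1 := mul_affInt_one hmem
  -- `θ₂ log t = -log w`, also when `θ₂ = 0`
  have h5 : θ 2 * Real.log (gevT θ y) = -Real.log (gevW θ y) := by
    unfold gevT
    split_ifs with hξ
    · simp [gevW, hξ]
    · rw [Real.log_rpow hw]; field_simp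
  rw [psi, affV_gevCoord h₀ h, hT, ← hlogT, gevPDF, if_pos hw,
    Real.log_mul (by have := Real.rpow_pos_of_pos ht (θ 2 + 1); positivity) (Real.exp_ne_zero _),
    Real.log_mul (by positivity) (Real.rpow_pos_of_pos ht _).ne', Real.log_exp,
    Real.log_rpow ht, Real.log_inv, Real.log_mul (by positivity) hw.ne',
    Real.log_div h.ne' h₀.ne', add_mul, h5]
  ring

lemma contDiffAt_gevCoord {θ₀ : Fin 3 → ℝ} (h₀ : 0 < θ₀ 0) : ContDiffAt ℝ 2 (gevCoord θ₀) θ₀ := by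
  have hc : ∀ i : Fin 3, ContDiffAt ℝ 2 (fun θ : Fin 3 → ℝ => θ i) θ₀ := fun i => by fun_prop
  have hz : ContDiffAt ℝ 2 (fun θ : Fin 3 → ℝ => (θ₀ 1 - θ 1) / θ 0) θ₀ :=
    (contDiffAt_const.sub (hc 1)).div (hc 0) h₀.ne'
  have hQ : ContDiffAt ℝ 2 logSlope (θ₀ 2 * ((θ₀ 1 - θ₀ 1) / θ₀ 0)) := by
    simpa using analyticAt_logSlope.contDiffAt
  refine contDiffAt_pi.2 fun i => ?_
  fin_cases i
  · exact ((hc 0).sub ((hc 2).mul ((hc 1).sub contDiffAt_const))).div_const _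
  · exact hz.mul (hQ.comp θ₀ ((hc 2).mul hz))
  · exact hc 2

/-- The Jacobian matrix of `gevCoord θ₀`. -/
def gevJac (θ₀ θ : Fin 3 → ℝ) : Matrix (Fin 3) (Fin 3) ℝ :=
  Matrix.of fun m j => fderiv ℝ (gevCoord θ₀) θ (Pi.single j 1) m

lemma continuousAt_gevJac {θ₀ : Fin 3 → ℝ} (h₀ : 0 < θ₀ 0) : ContinuousAt (gevJac θ₀) θ₀ := by
  have h := (contDiffAt_gevCoord h₀).continuousAt_fderiv (by norm_num)
  refine continuousAt_pi.2 fun m => continuousAt_pi.2 fun j => ?_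
  exact (continuous_apply m).continuousAt.comp (h.clm_apply continuousAt_const)

lemma gevJac_self {θ₀ : Fin 3 → ℝ} (h₀ : 0 < θ₀ 0) : gevJac θ₀ θ₀ =
    !![1 / θ₀ 0, -(θ₀ 2 / θ₀ 0), 0; 0, -(1 / θ₀ 0), 0; 0, 0, 1] := by
  have hc : ∀ i : Fin 3, HasFDerivAt (fun θ : Fin 3 → ℝ => θ i)
      (ContinuousLinearMap.proj (R := ℝ) (φ := fun _ : Fin 3 => ℝ) i) θ₀ :=
    fun i => hasFDerivAt_apply i θ₀
  have hd := ((contDiffAt_gevCoord h₀).differentiableAt (by norm_num)).hasFDerivAt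
  have hcomp : ∀ (m j : Fin 3) (L : (Fin 3 → ℝ) →L[ℝ] ℝ),
      HasFDerivAt (fun θ => gevCoord θ₀ θ m) L θ₀ → gevJac θ₀ θ₀ m j = L (Pi.single j 1) := by
    intro m j L hL
    exact DFunLike.congr_fun ((hasFDerivAt_pi'.1 hd m).unique hL) _
  have hQ : HasFDerivAt (fun θ : Fin 3 → ℝ => logSlope (θ 2 * ((θ₀ 1 - θ 1) / θ 0)))
      (fderiv ℝ (fun θ : Fin 3 → ℝ => logSlope (θ 2 * ((θ₀ 1 - θ 1) / θ 0))) θ₀) θ₀ := by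
    refine DifferentiableAt.hasFDerivAt ?_
    have hQ : DifferentiableAt ℝ logSlope (θ₀ 2 * ((θ₀ 1 - θ₀ 1) / θ₀ 0)) := by
      simpa using analyticAt_logSlope.differentiableAt
    refine hQ.comp θ₀ (f := fun θ : Fin 3 → ℝ => θ 2 * ((θ₀ 1 - θ 1) / θ 0)) ?_
    fun_prop (disch := exact h₀.ne')
  have h0 := (((hc 0).sub ((hc 2).mul ((hc 1).sub_const (θ₀ 1)))).mul_const (θ₀ 0)⁻¹)
  have h1 := (((hc 1).const_sub (θ₀ 1)).mul
    ((hasDerivAt_inv h₀.ne').comp_hasFDerivAt θ₀ (hc 0))).mul hQ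
  ext m j
  fin_cases m
  · refine (hcomp 0 j _ (h0.congr_of_eventuallyEq (Eventually.of_forall fun θ => by
      simp [gevCoord_zero, div_eq_mul_inv]))).trans ?_
    fin_cases j <;> (simp; try ring)
  · refine (hcomp 1 j _ (h1.congr_of_eventuallyEq (Eventually.of_forall fun θ => by
      simp [gevCoord_one, div_eq_mul_inv]))).trans ?_
    fin_cases j <;> simp [logSlope_zero]
  · refine (hcomp 2 j _ (hc 2)).trans ?_
    fin_cases j <;> simp

lemma det_gevJac_self_ne_zero {θ₀ : Fin 3 → ℝ} (h₀ : 0 < θ₀ 0) : (gevJac θ₀ θ₀).det ≠ 0 := by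
  rw [gevJac_self h₀, Matrix.det_fin_three]
  simp [h₀.ne']

/-! ### The log-likelihood in affine coordinates -/

section

/-- A set of parameters near which the log-likelihood of the sample is a `C²` function of the affine
coordinates relative to `θ₀`. -/
def gevRegular (θ₀ : Fin 3 → ℝ) (y : ℕ → ℝ) (n : ℕ) : Set (Fin 3 → ℝ) :=
  {θ | ContDiffAt ℝ 2 (gevCoord θ₀) θ ∧ 0 < θ 0 ∧ 0 < gevCoord θ₀ θ 0 ∧
    ∀ i ∈ Finset.range n, 0 < gevW θ (y i)}

variable {θ₀ θ : Fin 3 → ℝ} {y : ℕ → ℝ} {n : ℕ}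

lemma isOpen_gevRegular (θ₀ : Fin 3 → ℝ) (y : ℕ → ℝ) (n : ℕ) : IsOpen (gevRegular θ₀ y n) := by
  rw [isOpen_iff_mem_nhds]
  rintro θ ⟨h1, h2, h3, h4⟩
  refine Filter.Eventually.and (h1.eventually (by norm_num)) (Filter.Eventually.and ?_
    (Filter.Eventually.and ?_ ?_))
  · exact (continuous_apply 0).continuousAt.eventually_const_lt h2
  · exact ((continuous_apply 0).continuousAt.comp h1.continuousAt).eventually_const_lt h3
  · refine (Finset.eventually_all _).2 fun i hi => ?_
    have hw : ContinuousAt (fun θ : Fin 3 → ℝ => gevW θ (y i)) θ := ?_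
    · exact hw.eventually_const_lt (h4 i hi)
    unfold gevW
    have hc : ∀ i : Fin 3, ContinuousAt (fun θ : Fin 3 → ℝ => θ i) θ := fun i =>
      (continuous_apply i).continuousAt
    exact continuousAt_const.add ((hc 2).mul ((continuousAt_const.sub (hc 1)).div (hc 0) h2.ne'))

lemma gevCoord_mem_of_mem_gevRegular (h₀ : 0 < θ₀ 0) (h : θ ∈ gevRegular θ₀ y n) {i : ℕ}
    (hi : i ∈ Finset.range n) : gevCoord θ₀ θ ∈ affDom ((y i - θ₀ 1) / θ₀ 0) :=
  gevCoord_mem_affDom h₀ h.2.1 h.2.2.1 (h.2.2.2 i hi)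

lemma gevLogLik_eq (h₀ : 0 < θ₀ 0) (h : θ ∈ gevRegular θ₀ y n) : gevLogLik y n θ =
    ∑ i ∈ Finset.range n, (psi ((y i - θ₀ 1) / θ₀ 0) (gevCoord θ₀ θ) - Real.log (θ₀ 0)) :=
  Finset.sum_congr rfl fun i hi => log_gevPDF h₀ h.2.1 h.2.2.1 (h.2.2.2 i hi)

lemma exists_hasFDerivAt_gevLogLik (h₀ : 0 < θ₀ 0) (h : θ ∈ gevRegular θ₀ y n) :
    ∃ L : (Fin 3 → ℝ) →L[ℝ] ℝ, HasFDerivAt (gevLogLik y n) L θ ∧ ∀ d, L d =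
      ∑ i ∈ Finset.range n,
        psi1 ((y i - θ₀ 1) / θ₀ 0) (gevCoord θ₀ θ) (fderiv ℝ (gevCoord θ₀) θ d) := by
  have hd := (h.1.differentiableAt (by norm_num)).hasFDerivAt
  have hex : ∀ i, ∃ L : (Fin 3 → ℝ) →L[ℝ] ℝ, i ∈ Finset.range n →
      HasFDerivAt (psi ((y i - θ₀ 1) / θ₀ 0)) L (gevCoord θ₀ θ) ∧
        ∀ d, L d = psi1 ((y i - θ₀ 1) / θ₀ 0) (gevCoord θ₀ θ) d := by
    intro i
    by_cases hi : i ∈ Finset.range n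
    · obtain ⟨L, hL⟩ := exists_hasFDerivAt_psi (gevCoord_mem_of_mem_gevRegular h₀ h hi)
      exact ⟨L, fun _ => hL⟩
    · exact ⟨0, fun h => absurd h hi⟩
  choose L hL using hex
  refine ⟨∑ i ∈ Finset.range n, (L i).comp (fderiv ℝ (gevCoord θ₀) θ), ?_, fun d => ?_⟩
  · refine HasFDerivAt.congr_of_eventuallyEq (HasFDerivAt.fun_sum fun i hi =>
      ((hL i hi).1.comp θ hd).sub_const (Real.log (θ₀ 0))) ?_
    filter_upwards [(isOpen_gevRegular θ₀ y n).mem_nhds h] with η hη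
    exact gevLogLik_eq h₀ hη
  · rw [sum_apply]
    exact Finset.sum_congr rfl fun i hi => (hL i hi).2 _

/-- The score at the true parameter is the score in affine coordinates, in the directions of the
columns of the Jacobian. -/
lemma gevScore_eq (h₀ : 0 < θ₀ 0) {z : ℝ} (hz : 0 < gevW θ₀ z) (i : Fin 3) :
    gevScore θ₀ z i = psi1 ((z - θ₀ 1) / θ₀ 0) (baseParam (θ₀ 2)) ((gevJac θ₀ θ₀).col i) := by
  have hreg : θ₀ ∈ gevRegular θ₀ (fun _ => z) 1 :=
    ⟨contDiffAt_gevCoord h₀, h₀, by rw [gevCoord_self h₀]; simp, fun _ _ => hz⟩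
  obtain ⟨L, hL, hd⟩ := exists_hasFDerivAt_gevLogLik h₀ hreg
  have he : (fun η : Fin 3 → ℝ => Real.log (gevPDF η z)) = gevLogLik (fun _ => z) 1 := by
    ext η; simp [gevLogLik]
  rw [gevScore, he, hL.fderiv, hd, gevCoord_self h₀, Finset.sum_range_one]
  rfl

lemma sum_psi1_eq (h₀ : 0 < θ₀ 0) (h : θ ∈ gevRegular θ₀ y n) (d : Fin 3 → ℝ) :
    ∑ i ∈ Finset.range n, psi1 ((y i - θ₀ 1) / θ₀ 0) (gevCoord θ₀ θ) d =
      ∑ m, d m * ∑ i ∈ Finset.range n,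
        psi1 ((y i - θ₀ 1) / θ₀ 0) (gevCoord θ₀ θ) (Pi.single m 1) := by
  simp only [Finset.mul_sum]
  rw [Finset.sum_comm]
  exact Finset.sum_congr rfl fun i hi =>
    psi1_eq_sum (gevCoord_mem_of_mem_gevRegular h₀ h hi) d

/-- At a local maximum the likelihood equations hold in affine coordinates, since `gevDomain` is a
neighbourhood of the maximum and the Jacobian is invertible. -/
lemma sum_psi1_eq_zero (h₀ : 0 < θ₀ 0) (h : θ ∈ gevRegular θ₀ y n)
    (hdet : (gevJac θ₀ θ).det ≠ 0) (hmle : IsLocalMLE y n θ) (d : Fin 3 → ℝ) :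
    ∑ i ∈ Finset.range n, psi1 ((y i - θ₀ 1) / θ₀ 0) (gevCoord θ₀ θ) d = 0 := by
  have hdom : gevDomain y n ∈ 𝓝 θ := by
    filter_upwards [(isOpen_gevRegular θ₀ y n).mem_nhds h,
      (continuous_apply 2).continuousAt.eventually_const_lt hmle.1.1.2] with η hη hη2
    exact ⟨⟨hη.2.1, hη2⟩, fun i hi => (gevPDF_pos_iff hη.2.1).2 (hη.2.2.2 i hi)⟩
  have hmax : IsLocalMax (gevLogLik y n) θ := hmle.2.isLocalMax hdom
  obtain ⟨L, hL, hd⟩ := exists_hasFDerivAt_gevLogLik h₀ h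
  have hL0 : L = 0 := hmax.hasFDerivAt_eq_zero hL
  have hv : Matrix.vecMul (fun m => ∑ i ∈ Finset.range n,
      psi1 ((y i - θ₀ 1) / θ₀ 0) (gevCoord θ₀ θ) (Pi.single m 1)) (gevJac θ₀ θ) = 0 := by
    ext j
    have := hd (Pi.single j 1)
    rw [hL0, sum_psi1_eq h₀ h] at this
    simp only [Matrix.vecMul, dotProduct, gevJac, Matrix.of_apply, Pi.zero_apply]
    rw [zero_apply] at this
    rw [this]
    exact Finset.sum_congr rfl fun m _ => mul_comm _ _
  have h0 := Matrix.eq_zero_of_vecMul_eq_zero hdet hv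
  rw [sum_psi1_eq h₀ h]
  refine Finset.sum_eq_zero fun m _ => ?_
  rw [show ∑ i ∈ Finset.range n, psi1 ((y i - θ₀ 1) / θ₀ 0) (gevCoord θ₀ θ) (Pi.single m 1) = 0
    from congr_fun h0 m, mul_zero]

/-- Second derivatives of the log-likelihood with respect to the affine coordinates. -/
def affHess (θ₀ : Fin 3 → ℝ) (y : ℕ → ℝ) (n : ℕ) (p : Fin 3 → ℝ) : Matrix (Fin 3) (Fin 3) ℝ :=
  Matrix.of fun j k => ∑ i ∈ Finset.range n,
    psi2 ((y i - θ₀ 1) / θ₀ 0) p (Pi.single j 1) (Pi.single k 1)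

/-- At a root of the likelihood equations the Hessian transforms as a quadratic form: the term with
the second derivative of the coordinate change is multiplied by the gradient, which vanishes. -/
lemma hessianMatrix_gevLogLik (h₀ : 0 < θ₀ 0) (h : θ ∈ gevRegular θ₀ y n)
    (hroot : ∀ d, ∑ i ∈ Finset.range n, psi1 ((y i - θ₀ 1) / θ₀ 0) (gevCoord θ₀ θ) d = 0) :
    hessianMatrix (gevLogLik y n) θ =
      (gevJac θ₀ θ).transpose * affHess θ₀ y n (gevCoord θ₀ θ) * gevJac θ₀ θ := by
  have hd := (h.1.differentiableAt (by norm_num)).hasFDerivAt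
  have hd2 : DifferentiableAt ℝ (fderiv ℝ (gevCoord θ₀)) θ :=
    (h.1.fderiv_right (m := 1) (by norm_num)).differentiableAt (by norm_num)
  have hex : ∀ (m : Fin 3) (i : ℕ), ∃ L : (Fin 3 → ℝ) →L[ℝ] ℝ, i ∈ Finset.range n →
      HasFDerivAt (fun p => psi1 ((y i - θ₀ 1) / θ₀ 0) p (Pi.single m 1)) L (gevCoord θ₀ θ) ∧
        ∀ e, L e = psi2 ((y i - θ₀ 1) / θ₀ 0) (gevCoord θ₀ θ) (Pi.single m 1) e := by
    intro m i
    by_cases hi : i ∈ Finset.range n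
    · obtain ⟨L, hL⟩ :=
        exists_hasFDerivAt_psi1 (gevCoord_mem_of_mem_gevRegular h₀ h hi) (Pi.single m 1)
      exact ⟨L, fun _ => hL⟩
    · exact ⟨0, fun h => absurd h hi⟩
  choose L hL using hex
  ext i j
  have hJ : ∀ m : Fin 3, DifferentiableAt ℝ (fun η => gevJac θ₀ η m j) θ := fun m =>
    differentiableAt_pi.1 (hd2.clm_apply (differentiableAt_const (Pi.single j 1 : Fin 3 → ℝ))) m
  have hG : ∀ m : Fin 3, HasFDerivAt (fun η => ∑ i ∈ Finset.range n,
      psi1 ((y i - θ₀ 1) / θ₀ 0) (gevCoord θ₀ η) (Pi.single m 1))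
      (∑ i ∈ Finset.range n, (L m i).comp (fderiv ℝ (gevCoord θ₀) θ)) θ := fun m =>
    HasFDerivAt.fun_sum fun i hi =>
      HasFDerivAt.comp (g := fun p => psi1 ((y i - θ₀ 1) / θ₀ 0) p (Pi.single m 1)) θ
        (hL m i hi).1 hd
  have hf : (fun η => fderiv ℝ (gevLogLik y n) η (Pi.single j 1)) =ᶠ[𝓝 θ] fun η =>
      ∑ m, gevJac θ₀ η m j * ∑ i ∈ Finset.range n,
        psi1 ((y i - θ₀ 1) / θ₀ 0) (gevCoord θ₀ η) (Pi.single m 1) := by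
    filter_upwards [(isOpen_gevRegular θ₀ y n).mem_nhds h] with η hη
    obtain ⟨M, hM, hMd⟩ := exists_hasFDerivAt_gevLogLik h₀ hη
    rw [hM.fderiv, hMd, sum_psi1_eq h₀ hη]
    rfl
  have hD := HasFDerivAt.fun_sum (u := Finset.univ) fun m (_ : m ∈ Finset.univ) =>
    (hJ m).hasFDerivAt.fun_mul (hG m)
  rw [hessianMatrix, Matrix.of_apply, hf.fderiv_eq, hD.fderiv]
  simp only [hroot, zero_smul, add_zero, sum_apply, smul_apply,
    ContinuousLinearMap.comp_apply, smul_eq_mul, Matrix.mul_apply, Matrix.transpose_apply, affHess,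
    Matrix.of_apply]
  refine Finset.sum_congr rfl fun m _ => ?_
  rw [mul_comm]
  congr 1
  simp only [Finset.mul_sum]
  rw [Finset.sum_comm]
  refine Finset.sum_congr rfl fun l hl => ?_
  rw [(hL m l hl).2, psi2_eq_sum (gevCoord_mem_of_mem_gevRegular h₀ h hl),
    Finset.sum_eq_single m (fun b _ hb => by simp [hb]) (by simp)]
  refine Finset.sum_congr rfl fun k _ => ?_
  rw [Pi.single_eq_same, one_mul, psi2_comm]
  rfl

/-- Near the true parameter, local maximum likelihood estimates are regular. -/
lemma eventually_mem_gevRegular (h₀ : 0 < θ₀ 0) : ∀ᶠ θ in 𝓝 θ₀, (gevJac θ₀ θ).det ≠ 0 ∧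
    ∀ y n, IsLocalMLE y n θ → θ ∈ gevRegular θ₀ y n := by
  have h1 : ∀ᶠ θ in 𝓝 θ₀, (gevJac θ₀ θ).det ≠ 0 := by
    have hc : ContinuousAt (fun θ => (gevJac θ₀ θ).det) θ₀ :=
      (continuous_id.matrix_det).continuousAt.comp (continuousAt_gevJac h₀)
    exact hc.eventually_ne (det_gevJac_self_ne_zero h₀)
  have h2 : gevRegular θ₀ (fun _ => 0) 0 ∈ 𝓝 θ₀ := by
    refine (isOpen_gevRegular θ₀ _ 0).mem_nhds ⟨contDiffAt_gevCoord h₀, h₀, ?_, by simp⟩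
    rw [gevCoord_self h₀]; simp
  filter_upwards [h1, h2] with θ hθ1 hθ2
  refine ⟨hθ1, fun y n hmle => ⟨hθ2.1, hθ2.2.1, hθ2.2.2.1, fun i hi => ?_⟩⟩
  exact (gevPDF_pos_iff hθ2.2.1).1 (hmle.1.2 i hi)

end

/-! ### The GEV distribution as an image of the Gumbel distribution -/

/-- The map that carries the standard Gumbel distribution to the GEV distribution `P_θ`. -/
def gevOfGumbel (θ : Fin 3 → ℝ) (s : ℝ) : ℝ := θ 1 + θ 0 * gevQuantile (θ 2) s

section

variable {θ : Fin 3 → ℝ}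

lemma gevOfGumbel_sub_div (h : 0 < θ 0) (s : ℝ) :
    (gevOfGumbel θ s - θ 1) / θ 0 = gevQuantile (θ 2) s := by
  rw [gevOfGumbel]; field_simp; ring

lemma gevW_gevOfGumbel (h : 0 < θ 0) (s : ℝ) : gevW θ (gevOfGumbel θ s) = Real.exp (θ 2 * s) := by
  rw [gevW, gevOfGumbel_sub_div h, ← affV_gevQuantile]; rfl

/-- The density transforms with the Jacobian of `gevOfGumbel`. -/
lemma gevPDF_gevOfGumbel (h : 0 < θ 0) (s : ℝ) :
    θ 0 * Real.exp (θ 2 * s) * gevPDF θ (gevOfGumbel θ s) = gumbelPDF s := by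
  have hw : 0 < gevW θ (gevOfGumbel θ s) := by rw [gevW_gevOfGumbel h]; exact Real.exp_pos _
  have hσ : 0 < gevCoord θ θ 0 := by rw [gevCoord_self h]; simp
  have hl := log_gevPDF h h hσ hw
  rw [gevCoord_self h, gevOfGumbel_sub_div h, psi, affV_gevQuantile, affT_gevQuantile,
    affH_gevQuantile, Real.log_exp] at hl
  rw [← Real.exp_log ((gevPDF_pos_iff h).2 hw), hl, Real.exp_sub, Real.exp_log h, mul_assoc,
    mul_div_assoc', ← Real.exp_add, mul_div_cancel₀ _ h.ne', gumbelPDF]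
  congr 1
  simp; ring

lemma hasDerivAt_gevOfGumbel (θ : Fin 3 → ℝ) (s : ℝ) :
    HasDerivAt (gevOfGumbel θ) (θ 0 * Real.exp (θ 2 * s)) s :=
  ((hasDerivAt_gevQuantile (θ 2) s).const_mul (θ 0)).const_add (θ 1)

lemma injective_gevOfGumbel (h : 0 < θ 0) : Function.Injective (gevOfGumbel θ) := by
  intro s t hst
  have := congrArg (fun z => (z - θ 1) / θ 0) hst
  simp only [gevOfGumbel_sub_div h] at this
  exact (strictMono_gevQuantile (θ 2)).injective this

lemma continuous_gevOfGumbel (θ : Fin 3 → ℝ) : Continuous (gevOfGumbel θ) :=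
  continuous_iff_continuousAt.2 fun s => (hasDerivAt_gevOfGumbel θ s).continuousAt

lemma measurableEmbedding_gevOfGumbel (h : 0 < θ 0) : MeasurableEmbedding (gevOfGumbel θ) :=
  (continuous_gevOfGumbel θ).measurableEmbedding (injective_gevOfGumbel h)

lemma mem_range_gevOfGumbel (h : 0 < θ 0) {z : ℝ} (hz : 0 < gevW θ z) :
    z ∈ Set.range (gevOfGumbel θ) := by
  have hmem : baseParam (θ 2) ∈ affDom ((z - θ 1) / θ 0) := ⟨one_pos, hz⟩
  refine ⟨affH ((z - θ 1) / θ 0) (baseParam (θ 2)), ?_⟩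
  rw [gevOfGumbel, gevQuantile_affH hmem]
  field_simp
  ring

/-- The GEV distribution is the image of the Gumbel distribution, by the change of variables
formula. -/
lemma gevMeasure_eq_map (h : 0 < θ 0) : gevMeasure θ = gumbelMeasure.map (gevOfGumbel θ) := by
  have he := measurableEmbedding_gevOfGumbel h
  ext B hB
  rw [gevMeasure, gumbelMeasure, he.map_apply, withDensity_apply _ hB,
    withDensity_apply _ (he.measurable hB)]
  calc ∫⁻ z in B, ENNReal.ofReal (gevPDF θ z)
      = ∫⁻ z in gevOfGumbel θ '' (gevOfGumbel θ ⁻¹' B), ENNReal.ofReal (gevPDF θ z) := by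
        rw [Set.image_preimage_eq_inter_range, ← lintegral_indicator hB,
          ← lintegral_indicator (hB.inter he.measurableSet_range)]
        refine lintegral_congr fun z => ?_
        by_cases hz : z ∈ Set.range (gevOfGumbel θ)
        · by_cases hzB : z ∈ B <;> simp [Set.indicator, hz, hzB]
        · have hw : ¬ 0 < gevW θ z := fun hw => hz (mem_range_gevOfGumbel h hw)
          simp [Set.indicator, hz, gevPDF, hw]
    _ = ∫⁻ s in gevOfGumbel θ ⁻¹' B, ENNReal.ofReal |θ 0 * Real.exp (θ 2 * s)| *
          ENNReal.ofReal (gevPDF θ (gevOfGumbel θ s)) :=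
        lintegral_image_eq_lintegral_abs_deriv_mul (he.measurable hB)
          (fun s _ => (hasDerivAt_gevOfGumbel θ s).hasDerivWithinAt)
          (injective_gevOfGumbel h).injOn _
    _ = ∫⁻ s in gevOfGumbel θ ⁻¹' B, ENNReal.ofReal (gumbelPDF s) := by
        refine lintegral_congr fun s => ?_
        rw [abs_of_pos (by positivity), ← ENNReal.ofReal_mul (by positivity), gevPDF_gevOfGumbel h]

end

/-- A sample from the GEV distribution comes, almost surely, from a Gumbel sample. -/
lemma exists_gumbel_sample {Ω : Type*} [MeasurableSpace Ω] {P : Measure Ω} {θ : Fin 3 → ℝ}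
    (h : 0 < θ 0) {Y : ℕ → Ω → ℝ} (hindep : iIndepFun Y P)
    (hlaw : ∀ i, HasLaw (Y i) (gevMeasure θ) P) :
    ∃ U : ℕ → Ω → ℝ, (∀ i, Measurable (U i)) ∧ iIndepFun U P ∧
      (∀ i, HasLaw (U i) gumbelMeasure P) ∧ ∀ᵐ ω ∂P, ∀ i, Y i ω = gevOfGumbel θ (U i ω) := by
  have he := measurableEmbedding_gevOfGumbel h
  -- a measurable left inverse; it is an inverse on the support, hence almost surely
  obtain ⟨g, hg, hgf⟩ := he.exists_measurable_extend measurable_id fun _ => ⟨0⟩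
  have hgf' : ∀ s, g (gevOfGumbel θ s) = s := fun s => congr_fun hgf s
  have hmk : ∀ i, Y i =ᵐ[P] (hlaw i).aemeasurable.mk (Y i) := fun i =>
    (hlaw i).aemeasurable.ae_eq_mk
  refine ⟨fun i => g ∘ (hlaw i).aemeasurable.mk (Y i),
    fun i => hg.comp (hlaw i).aemeasurable.measurable_mk, ?_, fun i => ?_, ?_⟩
  · exact (hindep.congr hmk).comp (fun _ => g) fun _ => hg
  · have hYi : HasLaw ((hlaw i).aemeasurable.mk (Y i)) (gevMeasure θ) P :=
      (hlaw i).congr (hmk i).symm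
    refine HasLaw.comp ⟨hg.aemeasurable, ?_⟩ hYi
    rw [gevMeasure_eq_map h, Measure.map_map hg he.measurable, hgf, Measure.map_id]
  · rw [ae_all_iff]
    intro i
    have h1 : ∀ᵐ z ∂gevMeasure θ, z = gevOfGumbel θ (g z) := by
      rw [gevMeasure_eq_map h, he.ae_map_iff]
      exact Eventually.of_forall fun s => by rw [hgf']
    have h2 := ae_of_ae_map (hlaw i).aemeasurable ((hlaw i).map_eq.symm ▸ h1)
    filter_upwards [h2, hmk i] with ω hω hω'
    rw [Function.comp_apply, ← hω']
    exact hω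

/-! ### The Fisher information -/

lemma gevScore_gevOfGumbel {θ₀ : Fin 3 → ℝ} (h₀ : 0 < θ₀ 0) (s : ℝ) (i : Fin 3) :
    gevScore θ₀ (gevOfGumbel θ₀ s) i =
      psi1 (gevQuantile (θ₀ 2) s) (baseParam (θ₀ 2)) ((gevJac θ₀ θ₀).col i) := by
  rw [gevScore_eq h₀ (by rw [gevW_gevOfGumbel h₀]; exact Real.exp_pos _), gevOfGumbel_sub_div h₀]

lemma memLp_gevScore {θ₀ : Fin 3 → ℝ} (h : θ₀ ∈ gevParamSpace) (i : Fin 3) :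
    MemLp (fun z => gevScore θ₀ z i) 2 (gevMeasure θ₀) := by
  rw [gevMeasure_eq_map h.1, (measurableEmbedding_gevOfGumbel h.1).memLp_map_measure_iff]
  have he : (fun z => gevScore θ₀ z i) ∘ gevOfGumbel θ₀ = fun s =>
      psi1 (gevQuantile (θ₀ 2) s) (baseParam (θ₀ 2)) ((gevJac θ₀ θ₀).col i) :=
    funext fun s => gevScore_gevOfGumbel h.1 s i
  rw [he, memLp_two_iff_integrable_sq (continuous_psi1_gevQuantile _ _).aestronglyMeasurable,
    integrable_gumbelMeasure]
  simpa only [sq] using integrable_psi1_mul_psi1 h.2 _ _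

/-- The Fisher information transforms as a quadratic form. -/
lemma gevFisher_eq {θ₀ : Fin 3 → ℝ} (h : θ₀ ∈ gevParamSpace) : gevFisher θ₀ =
    (gevJac θ₀ θ₀).transpose * Matrix.of (baseFisher (θ₀ 2)) * gevJac θ₀ θ₀ := by
  ext i j
  rw [gevFisher, Matrix.of_apply, gevMeasure_eq_map h.1,
    (measurableEmbedding_gevOfGumbel h.1).integral_map]
  simp only [gevScore_gevOfGumbel h.1]
  rw [integral_gumbelMeasure, ← sum_mul_baseFisher h.2]
  simp only [Matrix.mul_apply, Matrix.transpose_apply, Matrix.of_apply, Finset.sum_mul,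
    Matrix.col_apply]
  rw [Finset.sum_comm]
  refine Finset.sum_congr rfl fun m _ => Finset.sum_congr rfl fun k _ => ?_
  ring

/-! ### Eigenvalues and positive definiteness -/

lemma posDef_of_sum_pos {M : Matrix (Fin 3) (Fin 3) ℝ} (hM : ∀ j k, M j k = M k j)
    (h : ∀ d : Fin 3 → ℝ, d ≠ 0 → 0 < ∑ j, ∑ k, d j * d k * M j k) : M.PosDef := by
  refine Matrix.PosDef.of_dotProduct_mulVec_pos (Matrix.IsHermitian.ext fun i j => ?_)
    fun d hd => ?_
  · simp [hM i j]
  · refine (h d hd).trans_eq ?_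
    simp only [dotProduct, Matrix.mulVec, Finset.mul_sum, star_trivial]
    exact Finset.sum_congr rfl fun j _ => Finset.sum_congr rfl fun k _ => by ring

/-- The eigenvalues of a matrix are bounded by the sum of the absolute values of its entries. -/
lemma abs_le_of_hasEigenvalue {A : Matrix (Fin 3) (Fin 3) ℝ} {l : ℝ}
    (hl : Module.End.HasEigenvalue (Matrix.toLin' A) l) : |l| ≤ ∑ i, ∑ j, |A i j| := by
  obtain ⟨v, hv⟩ := hl.exists_hasEigenvector
  have hAv : A.mulVec v = l • v := by
    rw [← Matrix.toLin'_apply]; exact hv.apply_eq_smul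
  have hn : 0 < ‖v‖ := norm_pos_iff.2 hv.2
  have h1 : ‖l • v‖ ≤ (∑ i, ∑ j, |A i j|) * ‖v‖ := by
    refine (pi_norm_le_iff_of_nonneg (by positivity)).2 fun i => ?_
    rw [← hAv, Real.norm_eq_abs, Matrix.mulVec, dotProduct]
    calc _ ≤ ∑ j, |A i j * v j| := Finset.abs_sum_le_sum_abs _ _
      _ ≤ ∑ j, |A i j| * ‖v‖ := by
        refine Finset.sum_le_sum fun j _ => ?_
        rw [abs_mul]
        exact mul_le_mul_of_nonneg_left (norm_le_pi_norm v j) (abs_nonneg _)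
      _ = (∑ j, |A i j|) * ‖v‖ := by rw [Finset.sum_mul]
      _ ≤ _ := by
        refine mul_le_mul_of_nonneg_right ?_ hn.le
        exact Finset.single_le_sum (f := fun i => ∑ j, |A i j|)
          (fun i _ => Finset.sum_nonneg fun j _ => abs_nonneg _) (Finset.mem_univ i)
  rw [norm_smul, Real.norm_eq_abs] at h1
  exact le_of_mul_le_mul_right h1 hn

/-- This holds also when there is no real eigenvalue, where `largestEigenvalue` is `sSup ∅ = 0`. -/
lemma abs_largestEigenvalue_le (A : Matrix (Fin 3) (Fin 3) ℝ) :
    |largestEigenvalue A| ≤ ∑ i, ∑ j, |A i j| := by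
  have h0 : 0 ≤ ∑ i, ∑ j, |A i j| :=
    Finset.sum_nonneg fun i _ => Finset.sum_nonneg fun j _ => abs_nonneg _
  have hub : ∀ l ∈ {l : ℝ | Module.End.HasEigenvalue (Matrix.toLin' A) l},
      l ≤ ∑ i, ∑ j, |A i j| := fun l hl => (abs_le.1 (abs_le_of_hasEigenvalue hl)).2
  refine abs_le.2 ⟨?_, Real.sSup_le hub h0⟩
  rcases Set.eq_empty_or_nonempty {l : ℝ | Module.End.HasEigenvalue (Matrix.toLin' A) l}
    with he | ⟨l, hl⟩
  · rw [largestEigenvalue, he, Real.sSup_empty]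
    linarith
  · exact (abs_le.1 (abs_le_of_hasEigenvalue hl)).1.trans (le_csSup ⟨_, hub⟩ hl)

lemma tendsto_largestEigenvalue {A : ℕ → Matrix (Fin 3) (Fin 3) ℝ} (h : Tendsto A atTop (𝓝 0)) :
    Tendsto (fun n => largestEigenvalue (A n)) atTop (𝓝 0) := by
  refine squeeze_zero_norm (fun n => abs_largestEigenvalue_le (A n)) ?_
  have hc : Continuous fun A : Matrix (Fin 3) (Fin 3) ℝ => ∑ i, ∑ j, |A i j| := by fun_prop
  exact (hc.tendsto' 0 0 (by simp)).comp h

/-- If `B n / n` has an invertible limit then the inverse of `B n` tends to `0`. -/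
lemma tendsto_inv_of_tendsto_smul {B : ℕ → Matrix (Fin 3) (Fin 3) ℝ}
    {M : Matrix (Fin 3) (Fin 3) ℝ} (hM : M.det ≠ 0)
    (h : Tendsto (fun n : ℕ => (n : ℝ)⁻¹ • B n) atTop (𝓝 M)) :
    Tendsto (fun n => (B n)⁻¹) atTop (𝓝 0) := by
  have hinv : ContinuousAt (Inv.inv : Matrix (Fin 3) (Fin 3) ℝ → _) M :=
    continuousAt_matrix_inv M (by
      simpa only [Ring.inverse_eq_inv'] using! continuousAt_inv₀ hM)
  have h1 := (tendsto_inv_atTop_nhds_zero_nat (𝕜 := ℝ)).smul (hinv.tendsto.comp h)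
  rw [zero_smul] at h1
  refine h1.congr' ?_
  filter_upwards [eventually_gt_atTop 0,
    h.eventually ((continuous_id.matrix_det).continuousAt.eventually_ne hM)] with n hn hdet
  have hn' : (n : ℝ) ≠ 0 := by positivity
  have hB : B n = (n : ℝ) • ((n : ℝ)⁻¹ • B n) := by rw [smul_smul, mul_inv_cancel₀ hn', one_smul]
  conv_rhs => rw [hB]
  have := Matrix.inv_smul' ((n : ℝ)⁻¹ • B n) (Units.mk0 (n : ℝ) hn') (isUnit_iff_ne_zero.2 hdet)
  exact this.symm

/-! ### The Hessian at the maximum likelihood estimator -/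

lemma posDef_baseFisher {ξ : ℝ} (hξ : -(1 / 2) < ξ) : (Matrix.of (baseFisher ξ)).PosDef := by
  obtain ⟨c, hc, h⟩ := exists_le_sum_mul_baseFisher hξ
  refine posDef_of_sum_pos (fun j k => ?_) fun d hd => lt_of_lt_of_le ?_ (h d)
  · simp only [Matrix.of_apply, baseFisher, mul_comm (psi1 _ _ (Pi.single j 1))]
  · have := norm_pos_iff.2 hd
    positivity

lemma mulVec_injective_of_det_ne_zero {J : Matrix (Fin 3) (Fin 3) ℝ} (hJ : J.det ≠ 0) :
    Function.Injective J.mulVec :=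
  Matrix.mulVec_injective_of_isUnit ((Matrix.isUnit_iff_isUnit_det J).2 (isUnit_iff_ne_zero.2 hJ))

lemma posDef_gevFisher {θ₀ : Fin 3 → ℝ} (h : θ₀ ∈ gevParamSpace) : (gevFisher θ₀).PosDef := by
  rw [gevFisher_eq h, ← Matrix.conjTranspose_eq_transpose_of_trivial]
  exact (posDef_baseFisher h.2).conjTranspose_mul_mul_same
    (mulVec_injective_of_det_ne_zero (det_gevJac_self_ne_zero h.1))

/-- The conclusion for a fixed sample `y i = gevOfGumbel θ₀ (u i)` along which the averaged second
derivatives converge at every consistent sequence of roots of the likelihood equations. -/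
lemma tendsto_hessian_of_isLocalMLE {θ₀ : Fin 3 → ℝ} (h : θ₀ ∈ gevParamSpace) {y u : ℕ → ℝ}
    (hyu : ∀ i, y i = gevOfGumbel θ₀ (u i)) {θhat : ℕ → Fin 3 → ℝ}
    (hmle : ∀ᶠ n in atTop, IsLocalMLE y n (θhat n)) (hcons : Tendsto θhat atTop (𝓝 θ₀))
    (hroot : ∀ lam : ℕ → Fin 3 → ℝ, Tendsto lam atTop (𝓝 (baseParam (θ₀ 2))) →
      (∀ᶠ n in atTop, (∀ i ∈ Finset.range n, lam n ∈ affDom (gevQuantile (θ₀ 2) (u i))) ∧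
        ∀ d, ∑ i ∈ Finset.range n, psi1 (gevQuantile (θ₀ 2) (u i)) (lam n) d = 0) →
      ∀ j k, Tendsto (fun n : ℕ => (n : ℝ)⁻¹ * ∑ i ∈ Finset.range n,
        psi2 (gevQuantile (θ₀ 2) (u i)) (lam n) (Pi.single j 1) (Pi.single k 1)) atTop
          (𝓝 (-baseFisher (θ₀ 2) j k))) :
    Tendsto (fun n : ℕ => (n : ℝ)⁻¹ • hessianMatrix (gevLogLik y n) (θhat n)) atTop
        (𝓝 (-gevFisher θ₀)) ∧
      ∀ᶠ n in atTop, (-hessianMatrix (gevLogLik y n) (θhat n)).PosDef := by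
  have h₀ := h.1
  have hx : ∀ i, (y i - θ₀ 1) / θ₀ 0 = gevQuantile (θ₀ 2) (u i) := fun i => by
    rw [hyu, gevOfGumbel_sub_div h₀]
  have hlam : Tendsto (fun n => gevCoord θ₀ (θhat n)) atTop (𝓝 (baseParam (θ₀ 2))) := by
    rw [← gevCoord_self h₀]
    exact (contDiffAt_gevCoord h₀).continuousAt.tendsto.comp hcons
  have hJ : Tendsto (fun n => gevJac θ₀ (θhat n)) atTop (𝓝 (gevJac θ₀ θ₀)) :=
    (continuousAt_gevJac h₀).tendsto.comp hcons
  have hreg : ∀ᶠ n in atTop, (gevJac θ₀ (θhat n)).det ≠ 0 ∧ θhat n ∈ gevRegular θ₀ y n ∧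
      ∀ d, ∑ i ∈ Finset.range n,
        psi1 ((y i - θ₀ 1) / θ₀ 0) (gevCoord θ₀ (θhat n)) d = 0 := by
    filter_upwards [hcons.eventually (eventually_mem_gevRegular h₀), hmle] with n hn hn'
    exact ⟨hn.1, hn.2 y n hn', sum_psi1_eq_zero h₀ (hn.2 y n hn') hn.1 hn'⟩
  have hH := hroot _ hlam (by
    filter_upwards [hreg] with n hn
    refine ⟨fun i hi => ?_, fun d => ?_⟩
    · rw [← hx]; exact gevCoord_mem_of_mem_gevRegular h₀ hn.2.1 hi
    · simpa only [hx] using hn.2.2 d)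
  have hHm : Tendsto (fun n : ℕ => (n : ℝ)⁻¹ • affHess θ₀ y n (gevCoord θ₀ (θhat n))) atTop
      (𝓝 (-Matrix.of (baseFisher (θ₀ 2)))) := by
    refine tendsto_pi_nhds.2 fun j => tendsto_pi_nhds.2 fun k => ?_
    simpa only [affHess, Matrix.smul_apply, Matrix.of_apply, smul_eq_mul, hx, Matrix.neg_apply]
      using! hH j k
  constructor
  · have hc : Continuous fun z : Matrix (Fin 3) (Fin 3) ℝ × Matrix (Fin 3) (Fin 3) ℝ =>
        z.1.transpose * z.2 * z.1 :=
      (continuous_fst.matrix_transpose.matrix_mul continuous_snd).matrix_mul continuous_fst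
    have hlim := (hc.tendsto (gevJac θ₀ θ₀, -Matrix.of (baseFisher (θ₀ 2)))).comp
      (hJ.prodMk_nhds hHm)
    rw [gevFisher_eq h]
    simp only [Matrix.mul_neg, Matrix.neg_mul] at hlim
    refine hlim.congr' ?_
    filter_upwards [hreg] with n hn
    rw [hessianMatrix_gevLogLik h₀ hn.2.1 hn.2.2]
    simp
  · obtain ⟨c, hc, hF⟩ := exists_le_sum_mul_baseFisher h.2
    have hclose : ∀ᶠ n : ℕ in atTop, ∀ j k,
        |((n : ℝ)⁻¹ • affHess θ₀ y n (gevCoord θ₀ (θhat n))) j k + baseFisher (θ₀ 2) j k| ≤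
          c / 18 := by
      simp only [eventually_all]
      intro j k
      have h1 := (((tendsto_pi_nhds.1 (tendsto_pi_nhds.1 hHm j) k).add_const
        (baseFisher (θ₀ 2) j k)).abs).eventually_lt_const (u := c / 18)
          (by simp; positivity)
      filter_upwards [h1] with n hn using hn.le
    filter_upwards [hreg, hclose, eventually_gt_atTop 0] with n hn hcl hn0
    -- positive definiteness is inherited from the limit, in affine coordinates first
    have hneg : (-affHess θ₀ y n (gevCoord θ₀ (θhat n))).PosDef := by
      refine posDef_of_sum_pos (fun j k => ?_) fun d hd => ?_
      · simp only [Matrix.neg_apply, affHess, Matrix.of_apply, psi2_comm _ _ (Pi.single j 1)]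
      · have h1 := sum_mul_le_of_abs_add_le hcl d
        have h2 := hF d
        have hd' := norm_pos_iff.2 hd
        have h3 : 0 < c * ‖d‖ ^ 2 := by positivity
        have h4 : ∑ j, ∑ k, d j * d k *
            (-affHess θ₀ y n (gevCoord θ₀ (θhat n))) j k = -(n * ∑ j, ∑ k, d j * d k *
            ((n : ℝ)⁻¹ • affHess θ₀ y n (gevCoord θ₀ (θhat n))) j k) := by
          simp only [Finset.mul_sum, ← Finset.sum_neg_distrib]
          refine Finset.sum_congr rfl fun j _ => Finset.sum_congr rfl fun k _ => ?_
          simp only [Matrix.smul_apply, Matrix.neg_apply, smul_eq_mul]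
          field_simp
        rw [h4]
        have hn1 : (0 : ℝ) < n := by positivity
        have h5 : ∑ j, ∑ k, d j * d k *
            ((n : ℝ)⁻¹ • affHess θ₀ y n (gevCoord θ₀ (θhat n))) j k < 0 := by linarith
        have := mul_neg_of_pos_of_neg hn1 h5
        linarith
    have := hneg.conjTranspose_mul_mul_same (mulVec_injective_of_det_ne_zero hn.1)
    rw [hessianMatrix_gevLogLik h₀ hn.2.1 hn.2.2]
    simpa [Matrix.conjTranspose_eq_transpose_of_trivial] using this

end

theorem corollary1 {Ω : Type*} [MeasurableSpace Ω] (P : Measure Ω) [IsProbabilityMeasure P]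
    (θ₀ : Fin 3 → ℝ) (hθ₀ : θ₀ ∈ gevParamSpace)
    (Y : ℕ → Ω → ℝ) (hindep : iIndepFun Y P) (hlaw : ∀ i, HasLaw (Y i) (gevMeasure θ₀) P)
    (θhat : ℕ → Ω → (Fin 3 → ℝ))
    (hmle : ∀ᵐ ω ∂P, ∀ᶠ n in atTop, IsLocalMLE (fun i => Y i ω) n (θhat n ω))
    (hcons : ∀ᵐ ω ∂P, Tendsto (fun n => θhat n ω) atTop (𝓝 θ₀)) :
    (∀ i, MemLp (fun y => gevScore θ₀ y i) 2 (gevMeasure θ₀)) ∧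
    (∀ᵐ ω ∂P, Tendsto
      (fun n : ℕ => (n : ℝ)⁻¹ • hessianMatrix (gevLogLik (fun i => Y i ω) n) (θhat n ω))
      atTop (𝓝 (-gevFisher θ₀))) ∧
    (∀ᵐ ω ∂P,
      (∀ᶠ n in atTop, (-hessianMatrix (gevLogLik (fun i => Y i ω) n) (θhat n ω)).PosDef) ∧
      Tendsto (fun n : ℕ =>
          largestEigenvalue (-hessianMatrix (gevLogLik (fun i => Y i ω) n) (θhat n ω))⁻¹)
        atTop (𝓝 0)) := by
  obtain ⟨U, hUm, hUi, hUl, hYU⟩ := exists_gumbel_sample hθ₀.1 hindep hlaw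
  have key : ∀ᵐ ω ∂P, Tendsto
      (fun n : ℕ => (n : ℝ)⁻¹ • hessianMatrix (gevLogLik (fun i => Y i ω) n) (θhat n ω))
        atTop (𝓝 (-gevFisher θ₀)) ∧
      ∀ᶠ n in atTop, (-hessianMatrix (gevLogLik (fun i => Y i ω) n) (θhat n ω)).PosDef := by
    filter_upwards [hYU, hmle, hcons, ae_tendsto_avg_psi2_of_root hUi hUm hUl hθ₀.2]
      with ω h1 h2 h3 h4
    exact tendsto_hessian_of_isLocalMLE hθ₀ h1 h2 h3 h4
  refine ⟨memLp_gevScore hθ₀, key.mono fun ω h => h.1, key.mono fun ω h => ⟨h.2, ?_⟩⟩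
  refine tendsto_largestEigenvalue (tendsto_inv_of_tendsto_smul
    (posDef_gevFisher hθ₀).det_pos.ne' ?_)
  simpa using! h.1.neg
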